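/- **Setting.** Let $p\in(1,\infty)$. Let $(X,d)$ be an unbounded metric space in which every ball is relatively compact (hence $X$ is complete, separable and locally compact), and let $m$ be a positive Radon measure on $X$ with full support. Write $B(x,r)=\{y:d(x,y)<r\}$, $V(x,r)=m(B(x,r))$, $a\wedge b=\min\{a,b\}$. Assume * the chain condition: there is $C>0$ such that for all $x,y\in X$ and $n\ge1$ there are points $x=x_0,\dots,x_n=y$ with $d(x_k,x_{k-1})\le C\,d(x,y)/n$ for $1\le k\le n$; * volume doubling: there is $C>0$ with $V(x,2r)\le C\,V(x,r)$ for all $x\in X$, $r>0$. A *doubling function* is a homeomorphism $\Psi:[0,\infty)\to[0,\infty)$ for which there are $C>1$ and $0<\beta_1\le\beta_2$ with $\Psi(2r)\le C\Psi(r)$ for $r>0$ and $C^{-1}(R/r)^{\beta_1}\le\Psi(R)/\Psi(r)\le C(R/r)^{\beta_2}$ for $0<r\le R$. Let $\Psi,\Upsilon$ be doubling functions. * $\mathrm{SUG}(\Upsilon,\Psi)$: there is an increasing $\Theta:[0,1]\to[0,\infty)$ with $\Theta(1)\ge1$, $\sum_{n\ge0}\Theta(2^{-n})<\infty$ and $\frac{\Upsilon(R)}{\Upsilon(r)}\le\Theta\big(\tfrac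 rR\big)\frac{\Psi(R)}{\Psi(r)}$ for $0<r\le R$. * $\mathrm{UG}(\Upsilon,\Psi)$: there is $C\ge1$ with $\frac{\Upsilon(R)}{\Upsilon(r)}\le C\,\frac{\Psi(R)}{\Psi(r)}$ for $0<r\le R$. **$p$-energies.** A *$p$-form* $(\mathcal E,\mathcal F)$ consists of a linear subspace $\mathcal F$ of $L^p(X;m)$ and $\mathcal E:\mathcal F\to[0,\infty)$ such that $\mathcal E^{1/p}$ is a seminorm. Put $\mathcal E_1=\mathcal E+\|\cdot\|_{L^p}^p$. It is a *$p$-energy* if $\mathcal F$ is dense in $L^p(X;m)$; $(\mathcal F,\mathcal E_1^{1/p})$ is complete; for every $\varphi:\mathbb R\to\mathbb R$ with $\varphi(0)=0$ and $|\varphi(t)-\varphi(s)|\le|t-s|$ and every $f\in\mathcal F$ one has $\varphi(f)\in\mathcal F$ and $\mathcal E(\varphi(f))\le\mathcal E(f)$; and for all $f,g\in\mathcal F$ the number $\mathcal E(f+g)+\mathcal E(f-g)$ is $\ge$ (if $p\le2$), respectively $\le$ (if $p\ge2$), $2\big(\mathcal E(f)^{1/(p-1)}+\mathcal E(g)^{1/(p-1)}\big)^{p-1}$.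 It is *regular* if $\mathcal F\cap C_c(X)$ is uniformly dense in $C_c(X)$ and $\mathcal E_1^{1/p}$-dense in $\mathcal F$. It is *strongly local* if $\mathcal E(f+g)=\mathcal E(f)+\mathcal E(g)$ whenever $f,g\in\mathcal F$ have compact support and $g$ is constant in an open neighbourhood of $\operatorname{supp}(f)$. For a strongly local regular $p$-energy, $\Gamma$ denotes its canonical $p$-energy measure, i.e. the family of finite Borel measures $\Gamma(f)$, $f\in\mathcal F$, with: (1) $\Gamma(f)(X)=\mathcal E(f)$; (2) $\Gamma(\cdot)(A)^{1/p}$ is a seminorm on $\mathcal F$ for every Borel set $A$; (3) $\Gamma(f)(A)=\Gamma(g)(A)$ if $f,g\in\mathcal F\cap C_c(X)$ and $f-g$ is constant on the Borel set $A$; (4) for every Borel set $A$, $\Gamma(\cdot)(A)$ satisfies the same two inequalities as $\mathcal E$ above; (5) $\mathrm d\Gamma(\varphi(f))=|\varphi'(f)|^p\,\mathrm d\Gamma(f)$ for $f\in\mathcal F\cap C_c(X)$ and $\varphi:\mathbb R\to\mathbb R$ piecewise $C^1$ with $\varphi(0)=0$. **Non-local $p$-forms.** A *non-local $p$-form associated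 with $\Upsilon$* is given by a measurable kernel $K$ on $X\times X\setminus\mathrm{diag}$ with $K(x,y)=K(y,x)$ and, for some $C_1,C_2>0$ and all $x\ne y$, $$\frac{C_1}{V(x,d(x,y))\Upsilon(d(x,y))}\le K(x,y)\le\frac{C_2}{V(x,d(x,y))\Upsilon(d(x,y))},$$ through $\mathcal E(u)=\int_X\int_X|u(x)-u(y)|^pK(x,y)\,m(\mathrm dx)m(\mathrm dy)$ and $\mathcal F=\{u\in L^p(X;m):\mathcal E(u)<\infty\}$. Its energy measure is $\Gamma(u)(\mathrm dx)=\big(\int_X|u(x)-u(y)|^pK(x,y)\,m(\mathrm dy)\big)m(\mathrm dx)$. **Conditions.** Let $\Gamma$ be the energy measure of a strongly local regular $p$-energy (superscript $L$) or of a non-local $p$-form (superscript $J$). * $\mathrm{PI}^{(L)}(\Psi)$: there are $C>0$, $A\ge1$ with $\int_{B(x,r)}|f-f_{B(x,r)}|^p\,\mathrm dm\le C\,\Psi(r)\,\Gamma(f)(B(x,Ar))$ for all $x\in X$, $r>0$, $f\in\mathcal F$, where $f_B=\frac1{m(B)}\int_Bf\,\mathrm dm$. * $\mathrm{CE}^{(\bullet)}_{\mathrm{strong}}(\Psi)$,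 $\bullet\in\{L,J\}$: there are $\delta\in(0,1)$, $A>1$, $C>0$ such that for all $x_0\in X$, $r>0$ there is $\phi\in\mathcal F$ with $0\le\phi\le1$ $m$-a.e., $\phi=1$ $m$-a.e. in an open neighbourhood of $\overline{B(x_0,r)}$, $\operatorname{supp}(\phi)\subseteq B(x_0,Ar)$, and for all $x,y\in X$, $s>0$ $$|\phi(x)-\phi(y)|\le C\Big(\frac{d(x,y)}r\wedge1\Big)^\delta,\qquad \Gamma(\phi)(B(x,s))\le C\Big(\frac sr\wedge1\Big)^\delta\frac{V(x,s)}{\Psi(s\wedge r)}.$$ **Theorem.** (a) Let $(\mathcal E^{(L)},\mathcal F^{(L)})$ be a strongly local regular $p$-energy satisfying $\mathrm{PI}^{(L)}(\Psi)$ and $\mathrm{CE}^{(L)}_{\mathrm{strong}}(\Psi)$, and assume $\mathrm{SUG}(\Upsilon,\Psi)$. Then every non-local $p$-form associated with $\Upsilon$ is a regular $p$-energy satisfying $\mathrm{CE}^{(J)}_{\mathrm{strong}}(\Upsilon)$. (b) Let $(\mathcal E^{(J,\Psi)},\mathcal F^{(J,\Psi)})$ be a non-local $p$-form associated with $\Psi$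 that is a regular $p$-energy and satisfies $\mathrm{CE}^{(J)}_{\mathrm{strong}}(\Psi)$, and assume $\mathrm{UG}(\Upsilon,\Psi)$. Then every non-local $p$-form associated with $\Upsilon$ is a regular $p$-energy satisfying $\mathrm{CE}^{(J)}_{\mathrm{strong}}(\Upsilon)$. -/

import Mathlib

open MeasureTheory Metric
open scoped ENNReal NNReal Topology

namespace PEnergy

noncomputable section

/-! ### Scaling functions -/

/-- `Ψ` restricts to a homeomorphism of `[0,∞)` onto itself, is doubling, and satisfies
`C⁻¹ (R/r)^β₁ ≤ Ψ(R)/Ψ(r) ≤ C (R/r)^β₂` for `0 < r ≤ R`, with `0 < β₁ ≤ β₂`.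
Only the values of `Ψ` on `[0,∞)` matter. -/
def IsDoublingFunction (Ψ : ℝ → ℝ) : Prop :=
  (∃ e : ℝ≥0 ≃ₜ ℝ≥0, ∀ r : ℝ≥0, Ψ r = e r) ∧
  ∃ C > (1 : ℝ), ∃ β₁ > (0 : ℝ), ∃ β₂ : ℝ, β₁ ≤ β₂ ∧
    (∀ r > (0 : ℝ), Ψ (2 * r) ≤ C * Ψ r) ∧
    ∀ r R : ℝ, 0 < r → r ≤ R →
      1 / C * (R / r) ^ β₁ ≤ Ψ R / Ψ r ∧ Ψ R / Ψ r ≤ C * (R / r) ^ β₂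

/-- `SUG(Υ, Ψ)`: `Υ` grows strictly slower than `Ψ`. -/
def StrictUpperGrowth (Υ Ψ : ℝ → ℝ) : Prop :=
  ∃ Θ : ℝ → ℝ, MonotoneOn Θ (Set.Icc 0 1) ∧ (∀ t ∈ Set.Icc (0 : ℝ) 1, 0 ≤ Θ t) ∧ 1 ≤ Θ 1 ∧
    Summable (fun n : ℕ => Θ (1 / 2 ^ n)) ∧
    ∀ r R : ℝ, 0 < r → r ≤ R → Υ R / Υ r ≤ Θ (r / R) * (Ψ R / Ψ r)

/-- `UG(Υ, Ψ)`: `Υ` grows no faster than `Ψ`. -/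
def UpperGrowth (Υ Ψ : ℝ → ℝ) : Prop :=
  ∃ C ≥ (1 : ℝ), ∀ r R : ℝ, 0 < r → r ≤ R → Υ R / Υ r ≤ C * (Ψ R / Ψ r)

/-! ### Geometric conditions -/

/-- The chain condition. -/
def ChainCondition (X : Type*) [MetricSpace X] : Prop :=
  ∃ C > (0 : ℝ), ∀ x y : X, ∀ n : ℕ, 1 ≤ n →
    ∃ z : ℕ → X, z 0 = x ∧ z n = y ∧
      ∀ k : ℕ, 1 ≤ k → k ≤ n → dist (z k) (z (k - 1)) ≤ C * (dist x y / n)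

variable {X : Type*} [MetricSpace X] [MeasurableSpace X]

/-- The volume `V(x,r) = μ(B(x,r))` of an open ball. -/
def vol (μ : Measure X) (x : X) (r : ℝ) : ℝ := μ.real (ball x r)

/-- The volume doubling condition. -/
def VolumeDoubling (μ : Measure X) : Prop :=
  ∃ C > (0 : ℝ), ∀ (x : X) (r : ℝ), 0 < r → vol μ x (2 * r) ≤ C * vol μ x r

/-- The support of the measure `|f| dμ`. -/
def essSupport (μ : Measure X) (f : X → ℝ) : Set X :=
  (μ.withDensity fun x => ‖f x‖ₑ).support

/-- `φ` is a cutoff function for `U ⊆ V`. -/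
structure IsCutoff (μ : Measure X) (φ : X → ℝ) (U V : Set X) : Prop where
  bounds : ∀ᵐ x ∂μ, 0 ≤ φ x ∧ φ x ≤ 1
  eq_one : ∃ W : Set X, IsOpen W ∧ closure U ⊆ W ∧ ∀ᵐ x ∂μ, x ∈ W → φ x = 1
  support_subset : essSupport μ φ ⊆ V

/-! ### `p`-forms and `p`-energies -/

/-- A `p`-form. The domain is a linear subspace of `L^p(X, μ)`, given by the representatives of its
elements: it is saturated under `μ`-a.e. equality, which the functional respects.
Only the values of `energy` on the domain matter. -/
structure PForm (p : ℝ) (μ : Measure X) where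
  dom : Submodule ℝ (X → ℝ)
  energy : (X → ℝ) → ℝ
  memLp : ∀ f ∈ dom, MemLp f (ENNReal.ofReal p) μ
  dom_congr : ∀ f ∈ dom, ∀ g : X → ℝ, f =ᵐ[μ] g → g ∈ dom
  energy_congr : ∀ f ∈ dom, ∀ g : X → ℝ, f =ᵐ[μ] g → energy f = energy g
  energy_nonneg : ∀ f ∈ dom, 0 ≤ energy f
  energy_smul : ∀ f ∈ dom, ∀ a : ℝ,
    energy (a • f) ^ (1 / p) = |a| * energy f ^ (1 / p)
  energy_add : ∀ f ∈ dom, ∀ g ∈ dom,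
    energy (f + g) ^ (1 / p) ≤ energy f ^ (1 / p) + energy g ^ (1 / p)

namespace PForm

variable {p : ℝ} {μ : Measure X}

/-- `𝓔₁(f) = 𝓔(f) + ‖f‖_p^p`. -/
def energyOne (𝓔 : PForm p μ) (f : X → ℝ) : ℝ := 𝓔.energy f + ∫ x, |f x| ^ p ∂μ

/-- The class `𝓕 ∩ C_c(X)`. -/
def core (𝓔 : PForm p μ) : Set (X → ℝ) := {f | f ∈ 𝓔.dom ∧ Continuous f ∧ HasCompactSupport f}

/-- A `p`-energy: a densely defined `p`-form that is closed, Markovian and satisfies the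
`p`-Clarkson inequality. -/
structure IsPEnergy (𝓔 : PForm p μ) : Prop where
  dense : ∀ f : X → ℝ, MemLp f (ENNReal.ofReal p) μ → ∀ ε > (0 : ℝ),
    ∃ g ∈ 𝓔.dom, eLpNorm (f - g) (ENNReal.ofReal p) μ ≤ ENNReal.ofReal ε
  closed : ∀ u : ℕ → X → ℝ, (∀ n, u n ∈ 𝓔.dom) →
    (∀ ε > (0 : ℝ), ∃ N, ∀ m ≥ N, ∀ n ≥ N, 𝓔.energyOne (u m - u n) ^ (1 / p) < ε) →
    ∃ f ∈ 𝓔.dom, Filter.Tendsto (fun n => 𝓔.energyOne (u n - f) ^ (1 / p)) Filter.atTop (𝓝 0)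
  markov : ∀ φ : ℝ → ℝ, φ 0 = 0 → (∀ s t : ℝ, |φ t - φ s| ≤ |t - s|) →
    ∀ f ∈ 𝓔.dom, φ ∘ f ∈ 𝓔.dom ∧ 𝓔.energy (φ ∘ f) ≤ 𝓔.energy f
  clarkson_le_two : p ≤ 2 → ∀ f ∈ 𝓔.dom, ∀ g ∈ 𝓔.dom,
    2 * (𝓔.energy f ^ (1 / (p - 1)) + 𝓔.energy g ^ (1 / (p - 1))) ^ (p - 1)
      ≤ 𝓔.energy (f + g) + 𝓔.energy (f - g)
  clarkson_two_le : 2 ≤ p → ∀ f ∈ 𝓔.dom, ∀ g ∈ 𝓔.dom,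
    𝓔.energy (f + g) + 𝓔.energy (f - g)
      ≤ 2 * (𝓔.energy f ^ (1 / (p - 1)) + 𝓔.energy g ^ (1 / (p - 1))) ^ (p - 1)

/-- Regularity: `𝓕 ∩ C_c(X)` is uniformly dense in `C_c(X)` and `𝓔₁`-dense in `𝓕`. -/
structure IsRegular (𝓔 : PForm p μ) : Prop where
  uniform_dense : ∀ g : X → ℝ, Continuous g → HasCompactSupport g → ∀ ε > (0 : ℝ),
    ∃ f ∈ 𝓔.core, ∀ x, |f x - g x| ≤ ε
  energy_dense : ∀ g ∈ 𝓔.dom, ∀ ε > (0 : ℝ), ∃ f ∈ 𝓔.core, 𝓔.energyOne (f - g) ^ (1 / p) ≤ ε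

/-- Strong locality. -/
def IsStronglyLocal (𝓔 : PForm p μ) : Prop :=
  ∀ f ∈ 𝓔.dom, ∀ g ∈ 𝓔.dom, IsCompact (essSupport μ f) → IsCompact (essSupport μ g) →
    (∃ (U : Set X) (c : ℝ), IsOpen U ∧ essSupport μ f ⊆ U ∧ ∀ᵐ x ∂μ, x ∈ U → g x = c) →
    𝓔.energy (f + g) = 𝓔.energy f + 𝓔.energy g

end PForm

/-! ### Energy measures of strongly local forms -/

/-- `φ` is continuous and, off a finite set of breakpoints, piecewise `C¹`: it is `C¹` up to the
endpoints on every compact interval with no breakpoint in its interior. -/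
def IsPiecewiseC1 (φ : ℝ → ℝ) : Prop :=
  Continuous φ ∧ ∃ S : Finset ℝ, ∀ a b : ℝ, a < b → (∀ s ∈ S, s ∉ Set.Ioo a b) →
    ContDiffOn ℝ 1 φ (Set.Icc a b)

/-- The conditions that characterize the canonical `p`-energy measure of a strongly local regular
`p`-energy. In `chain` the derivative is taken to be `0` where it does not exist; this happens only
at breakpoints, whose preimages under `f` are null for `Γ f`. The condition `φ 0 = 0` places
`φ ∘ f` in the domain. -/
structure IsEnergyMeasure {p : ℝ} {μ : Measure X} (𝓔 : PForm p μ)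
    (Γ : (X → ℝ) → Measure X) : Prop where
  total : ∀ f ∈ 𝓔.dom, Γ f Set.univ = ENNReal.ofReal (𝓔.energy f)
  smul : ∀ A : Set X, MeasurableSet A → ∀ f ∈ 𝓔.dom, ∀ a : ℝ,
    (Γ (a • f)).real A ^ (1 / p) = |a| * (Γ f).real A ^ (1 / p)
  add : ∀ A : Set X, MeasurableSet A → ∀ f ∈ 𝓔.dom, ∀ g ∈ 𝓔.dom,
    (Γ (f + g)).real A ^ (1 / p) ≤ (Γ f).real A ^ (1 / p) + (Γ g).real A ^ (1 / p)
  strongly_local : ∀ f ∈ 𝓔.core, ∀ g ∈ 𝓔.core, ∀ A : Set X, MeasurableSet A →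
    (∃ c : ℝ, ∀ x ∈ A, f x - g x = c) → Γ f A = Γ g A
  clarkson_le_two : p ≤ 2 → ∀ f ∈ 𝓔.dom, ∀ g ∈ 𝓔.dom, ∀ A : Set X, MeasurableSet A →
    2 * ((Γ f).real A ^ (1 / (p - 1)) + (Γ g).real A ^ (1 / (p - 1))) ^ (p - 1)
      ≤ (Γ (f + g)).real A + (Γ (f - g)).real A
  clarkson_two_le : 2 ≤ p → ∀ f ∈ 𝓔.dom, ∀ g ∈ 𝓔.dom, ∀ A : Set X, MeasurableSet A →
    (Γ (f + g)).real A + (Γ (f - g)).real A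
      ≤ 2 * ((Γ f).real A ^ (1 / (p - 1)) + (Γ g).real A ^ (1 / (p - 1))) ^ (p - 1)
  chain : ∀ f ∈ 𝓔.core, ∀ φ : ℝ → ℝ, IsPiecewiseC1 φ → φ 0 = 0 →
    ∀ A : Set X, MeasurableSet A →
      Γ (φ ∘ f) A = ∫⁻ x in A, ENNReal.ofReal (|deriv φ (f x)| ^ p) ∂(Γ f)

open Classical in
/-- The canonical `p`-energy measure `f ↦ Γ(f)` of a strongly local regular `p`-energy. For such a
form the family `Γ` exists and `Γ(f)`, `f ∈ 𝓕`, is determined by the conditions: they imply the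
Leibniz and chain rules for the derivative `Γ(f;g)` of `Γ(f)`, hence
`∫ φ dΓ(f) = 𝓔(f; fφ) - ((p-1)/p)^(p-1) 𝓔(|f|^(p/(p-1)); φ)` for `f, φ ∈ 𝓕 ∩ C_c(X)`, and the
remaining `f` follow by density. -/
def energyMeasure {p : ℝ} {μ : Measure X} (𝓔 : PForm p μ) : (X → ℝ) → Measure X :=
  if h : ∃ Γ : (X → ℝ) → Measure X, IsEnergyMeasure 𝓔 Γ then h.choose else 0

/-- The Poincaré inequality `PI(Ψ)` for a form with domain `F` and energy measure `Γ`. -/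
def PoincareInequality (p : ℝ) (μ : Measure X) (F : Set (X → ℝ)) (Γ : (X → ℝ) → Measure X)
    (Ψ : ℝ → ℝ) : Prop :=
  ∃ C > (0 : ℝ), ∃ A ≥ (1 : ℝ), ∀ (x : X) (r : ℝ), 0 < r → ∀ f ∈ F,
    ∫⁻ y in ball x r, ENNReal.ofReal (|f y - ⨍ z in ball x r, f z ∂μ| ^ p) ∂μ
      ≤ ENNReal.ofReal (C * Ψ r) * Γ f (ball x (A * r))

/-- The strong cutoff energy inequality `CE_strong(Ψ)` for a form with domain `F` and energy
measure `Γ`. -/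
def CEStrong (μ : Measure X) (F : Set (X → ℝ)) (Γ : (X → ℝ) → Measure X) (Ψ : ℝ → ℝ) : Prop :=
  ∃ δ ∈ Set.Ioo (0 : ℝ) 1, ∃ A > (1 : ℝ), ∃ C > (0 : ℝ), ∀ (x₀ : X) (r : ℝ), 0 < r →
    ∃ φ ∈ F, IsCutoff μ φ (ball x₀ r) (ball x₀ (A * r)) ∧
      (∀ x y : X, |φ x - φ y| ≤ C * min (dist x y / r) 1 ^ δ) ∧
      ∀ (x : X) (s : ℝ), 0 < s →
        Γ φ (ball x s) ≤ ENNReal.ofReal (C * min (s / r) 1 ^ δ * (vol μ x s / Ψ (min s r)))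

/-! ### Non-local forms -/

/-- A symmetric jump kernel satisfying the two-sided bound `K^(J)(Υ)`. Its values on the diagonal
play no role. -/
structure StableKernel (μ : Measure X) (Υ : ℝ → ℝ) where
  K : X → X → ℝ
  measurable : Measurable (Function.uncurry K)
  symm : ∀ x y : X, x ≠ y → K x y = K y x
  bounds : ∃ C₁ > (0 : ℝ), ∃ C₂ > (0 : ℝ), ∀ x y : X, x ≠ y →
    C₁ / (vol μ x (dist x y) * Υ (dist x y)) ≤ K x y ∧
      K x y ≤ C₂ / (vol μ x (dist x y) * Υ (dist x y))

/-- `∬ |u(x) - u(y)|^p K(x,y) μ(dx) μ(dy)`. -/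
def jumpEnergy (p : ℝ) (μ : Measure X) (K : X → X → ℝ) (u : X → ℝ) : ℝ≥0∞ :=
  ∫⁻ x, ∫⁻ y, ‖u x - u y‖ₑ ^ p * ENNReal.ofReal (K x y) ∂μ ∂μ

/-- The measure `Γ_Ω(u)(dx) = (∫_Ω |u(x) - u(y)|^p K(x,y) μ(dy)) μ(dx)`. -/
def jumpEnergyMeasure (p : ℝ) (μ : Measure X) (K : X → X → ℝ) (Ω : Set X) (u : X → ℝ) :
    Measure X :=
  μ.withDensity fun x => ∫⁻ y in Ω, ‖u x - u y‖ₑ ^ p * ENNReal.ofReal (K x y) ∂μ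

section jump

variable {Y : Type*} [MeasurableSpace Y] {p : ℝ} {μ : Measure Y} {K : Y → Y → ℝ} {u v : Y → ℝ}

lemma jumpEnergy_congr (h : u =ᵐ[μ] v) : jumpEnergy p μ K u = jumpEnergy p μ K v := by
  unfold jumpEnergy
  refine lintegral_congr_ae ?_
  filter_upwards [h] with x hx
  refine lintegral_congr_ae ?_
  filter_upwards [h] with y hy
  rw [hx, hy]

lemma jumpEnergy_smul (hp : 0 < p) (a : ℝ) :
    jumpEnergy p μ K (a • u) = ‖a‖ₑ ^ p * jumpEnergy p μ K u := by
  have hne : ‖a‖ₑ ^ p ≠ ∞ := ENNReal.rpow_ne_top_of_nonneg hp.le enorm_ne_top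
  unfold jumpEnergy
  rw [← lintegral_const_mul' _ _ hne]
  refine lintegral_congr fun x => ?_
  rw [← lintegral_const_mul' _ _ hne]
  refine lintegral_congr fun y => ?_
  rw [Pi.smul_apply, Pi.smul_apply, smul_eq_mul, smul_eq_mul, ← mul_sub, enorm_mul,
    ENNReal.mul_rpow_of_nonneg _ _ hp.le, mul_assoc]

lemma aemeasurable_enorm_sub [SFinite μ] (hu : AEStronglyMeasurable u μ) :
    AEMeasurable (fun z : Y × Y => ‖u z.1 - u z.2‖ₑ) (μ.prod μ) :=
  (hu.comp_fst.sub hu.comp_snd).enorm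

lemma jumpEnergy_eq [SFinite μ] (hK : Measurable (Function.uncurry K))
    (hu : AEStronglyMeasurable u μ) :
    jumpEnergy p μ K u = ∫⁻ z : Y × Y, ‖u z.1 - u z.2‖ₑ ^ p
      ∂((μ.prod μ).withDensity fun z => ENNReal.ofReal (K z.1 z.2)) := by
  have hK' : Measurable fun z : Y × Y => ENNReal.ofReal (K z.1 z.2) := hK.ennreal_ofReal
  have h := (aemeasurable_enorm_sub hu).pow_const p
  rw [lintegral_withDensity_eq_lintegral_mul₀ hK'.aemeasurable h, lintegral_prod _
    (hK'.aemeasurable.mul h)]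
  simp only [jumpEnergy, Pi.mul_apply, mul_comm]

lemma jumpEnergy_add [SFinite μ] (hp : 1 ≤ p) (hK : Measurable (Function.uncurry K))
    (hu : AEStronglyMeasurable u μ) (hv : AEStronglyMeasurable v μ) :
    jumpEnergy p μ K (u + v) ^ (1 / p)
      ≤ jumpEnergy p μ K u ^ (1 / p) + jumpEnergy p μ K v ^ (1 / p) := by
  have hp0 : 0 ≤ p := zero_le_one.trans hp
  rw [jumpEnergy_eq hK (hu.add hv), jumpEnergy_eq hK hu, jumpEnergy_eq hK hv]
  have hac := withDensity_absolutelyContinuous (μ.prod μ) fun z => ENNReal.ofReal (K z.1 z.2)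
  refine le_trans (ENNReal.rpow_le_rpow (lintegral_mono fun z => ENNReal.rpow_le_rpow ?_ hp0)
    (by positivity)) (ENNReal.lintegral_Lp_add_le ((aemeasurable_enorm_sub hu).mono_ac hac)
      ((aemeasurable_enorm_sub hv).mono_ac hac) hp)
  have : (u + v) z.1 - (u + v) z.2 = (u z.1 - u z.2) + (v z.1 - v z.2) := by
    simp only [Pi.add_apply]; ring
  rw [this]
  exact enorm_add_le _ _

lemma jumpEnergy_add_ne_top [SFinite μ] (hp : 1 ≤ p) (hK : Measurable (Function.uncurry K))
    (hu : AEStronglyMeasurable u μ) (hv : AEStronglyMeasurable v μ)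
    (hu' : jumpEnergy p μ K u ≠ ∞) (hv' : jumpEnergy p μ K v ≠ ∞) :
    jumpEnergy p μ K (u + v) ≠ ∞ := by
  have hp0 : 0 < p := zero_lt_one.trans_le hp
  have h := jumpEnergy_add hp hK hu hv
  intro htop
  rw [htop, ENNReal.top_rpow_of_pos (by positivity), top_le_iff, ENNReal.add_eq_top] at h
  rcases h with h | h
  · exact ENNReal.rpow_ne_top_of_nonneg (by positivity) hu' h
  · exact ENNReal.rpow_ne_top_of_nonneg (by positivity) hv' h

end jump

/-- The non-local `p`-form associated with `Υ` and a kernel `κ`: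
`𝓔(u) = ∬ |u(x) - u(y)|^p K(x,y) μ(dx) μ(dy)` with domain `{u ∈ L^p : 𝓔(u) < ∞}`. -/
def nonlocalForm {p : ℝ} (hp : 1 < p) {μ : Measure X} [SFinite μ] {Υ : ℝ → ℝ}
    (κ : StableKernel μ Υ) : PForm p μ where
  dom :=
    { carrier := {u | MemLp u (ENNReal.ofReal p) μ ∧ jumpEnergy p μ κ.K u ≠ ∞}
      add_mem' := fun hu hv => ⟨hu.1.add hv.1, jumpEnergy_add_ne_top hp.le κ.measurable
        hu.1.aestronglyMeasurable hv.1.aestronglyMeasurable hu.2 hv.2⟩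
      zero_mem' := by
        have h0 : 0 < p := zero_lt_one.trans hp
        exact ⟨MemLp.zero, by simp [jumpEnergy, h0]⟩
      smul_mem' := fun a u hu => ⟨hu.1.const_smul a, by
        have h0 : 0 < p := zero_lt_one.trans hp
        rw [jumpEnergy_smul h0]
        exact ENNReal.mul_ne_top (ENNReal.rpow_ne_top_of_nonneg h0.le enorm_ne_top) hu.2⟩ }
  energy u := (jumpEnergy p μ κ.K u).toReal
  memLp _ hu := hu.1
  dom_congr _ hu _ h := ⟨(memLp_congr_ae h).1 hu.1, jumpEnergy_congr (p := p) (K := κ.K) h ▸ hu.2⟩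
  energy_congr _ _ _ h := by rw [jumpEnergy_congr h]
  energy_nonneg _ _ := ENNReal.toReal_nonneg
  energy_smul u _ a := by
    have h0 : 0 < p := zero_lt_one.trans hp
    rw [jumpEnergy_smul h0, ENNReal.toReal_mul, ← ENNReal.toReal_rpow,
      Real.mul_rpow (by positivity) ENNReal.toReal_nonneg, ← Real.rpow_mul (by positivity),
      mul_one_div_cancel h0.ne', Real.rpow_one, toReal_enorm, Real.norm_eq_abs]
  energy_add u hu v hv := by
    have h0 : 0 < p := zero_lt_one.trans hp
    have h := jumpEnergy_add hp.le κ.measurable hu.1.aestronglyMeasurable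
      hv.1.aestronglyMeasurable
    have hu' : jumpEnergy p μ κ.K u ^ (1 / p) ≠ ∞ :=
      ENNReal.rpow_ne_top_of_nonneg (by positivity) hu.2
    have hv' : jumpEnergy p μ κ.K v ^ (1 / p) ≠ ∞ :=
      ENNReal.rpow_ne_top_of_nonneg (by positivity) hv.2
    rw [ENNReal.toReal_rpow, ENNReal.toReal_rpow, ENNReal.toReal_rpow,
      ← ENNReal.toReal_add hu' hv']
    exact ENNReal.toReal_mono (ENNReal.add_ne_top.2 ⟨hu', hv'⟩) h

/-- `PI^(L)(Ψ)` for a strongly local regular `p`-energy. -/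
def LocalPI {p : ℝ} {μ : Measure X} (𝓔 : PForm p μ) (Ψ : ℝ → ℝ) : Prop :=
  PoincareInequality p μ (𝓔.dom : Set (X → ℝ)) (energyMeasure 𝓔) Ψ

/-- `CE^(L)_strong(Ψ)` for a strongly local regular `p`-energy. -/
def LocalCEStrong {p : ℝ} {μ : Measure X} (𝓔 : PForm p μ) (Ψ : ℝ → ℝ) : Prop :=
  CEStrong μ (𝓔.dom : Set (X → ℝ)) (energyMeasure 𝓔) Ψ

/-- `CE^(J)_strong(Υ)` for the non-local `p`-form associated with `Υ` and the kernel `κ`. -/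
def NonlocalCEStrong {p : ℝ} (hp : 1 < p) {μ : Measure X} [SFinite μ] {Υ : ℝ → ℝ}
    (κ : StableKernel μ Υ) : Prop :=
  CEStrong μ ((nonlocalForm hp κ).dom : Set (X → ℝ))
    (jumpEnergyMeasure p μ κ.K Set.univ) Υ

end

end PEnergy

namespace PEnergy

set_option linter.unusedSectionVars false

/-! ### Doubling functions and volumes -/

/-! The cutoff functions for `κ` are the ones already given. Only their non-local energy must be
estimated again, and only at short range. If `φ` is Hölder at scale `r`, then jumps of length at
least `s` contribute at most a multiple of `(s/r)^γ / Υ s` to its energy density, by summing over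
dyadic annuli (`StableKernel.exists_tail`). This needs `γ ≤ δ` and `γ` below the lower growth
exponent of `Υ`. So for `s ≤ r` it is enough to bound the energy of jumps shorter than `s` that
start in `B(x,s)`, which is `HasNearCutoffs`. For `s > r` one covers by balls of radius `r`
(`HasNearCutoffs.nonlocalCEStrong`).

Short jumps are where the growth conditions enter. In (b), `UpperGrowth` says that at distances
below `s` the kernel `κ` is at most a multiple of `Ψ s / Υ s` times `η`, so the energy bound for `η`
rescales correctly. In (a), the jumps are sliced by length `t = s / 2^n`. The Poincaré inequality on
balls of radius `2t`, summed over a `t`-net of `B(x,s)`, bounds a slice by `(Ψ t / Υ t)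
Γ(φ)(B(x,Ls))` (`exists_annulus_le`). By `StrictUpperGrowth` this is at most `Θ(2^(-n)) (Ψ s / Υ s)
Γ(φ)(B(x,Ls))`, and the sum over `n` converges.

It remains to show that the form is a regular `p`-energy. Closedness is Fatou's lemma, the Markov
property is pointwise, and the Clarkson inequalities come from the scalar ones by integrating with
Hölder or Minkowski. Density and regularity follow from the cutoff energy inequality for `κ` itself.
At scale `ε`, a function is replaced by the combination of normalized cutoff functions over an
`ε`-net whose coefficients are its ball averages (`exists_discretization`). The `p`-th power of the
`L^p` error is bounded by the averaged oscillation at scale `ε`, and the short-range energy of the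
combination by `1 / Υ ε` times that oscillation. The oscillation is at most a multiple of `Υ ε`
times the energy of jumps shorter than `Lε`, so the powers of `Υ ε` cancel. What is left is
near-diagonal energy, which vanishes as `ε → 0`. Truncation to a large ball may destroy finiteness
of the energy, so its error is measured in `L^p` only, and the radius is chosen after `ε`
(`exists_core_approx`). -/

lemma IsDoublingFunction.pos {Ψ : ℝ → ℝ} (h : IsDoublingFunction Ψ) {r : ℝ} (hr : 0 < r) :
    0 < Ψ r := by
  obtain ⟨⟨e, he⟩, C, hC, β₁, -, β₂, -, -, hg⟩ := h
  have h0 : 0 ≤ Ψ r := by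
    lift r to ℝ≥0 using hr.le
    rw [he]; exact NNReal.coe_nonneg _
  refine h0.lt_of_ne' fun h => ?_
  -- The growth bound with `R = r`: if `Ψ r` were `0`, the quotient would be `0` by convention,
  -- against the lower bound `1 / C`.
  have := (hg r r hr le_rfl).1
  rw [h, div_self hr.ne', Real.one_rpow, div_zero, mul_one] at this
  have : 0 < 1 / C := by positivity
  linarith

/-- Lower polynomial growth of a doubling function. -/
lemma IsDoublingFunction.exists_lower {Ψ : ℝ → ℝ} (h : IsDoublingFunction Ψ) :
    ∃ C > (0 : ℝ), ∃ β > (0 : ℝ), ∀ r R : ℝ, 0 < r → r ≤ R → (R / r) ^ β * Ψ r ≤ C * Ψ R := by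
  have hpos := @h.pos
  obtain ⟨-, C, hC, β₁, hβ₁, β₂, -, -, hg⟩ := h
  refine ⟨C, by linarith, β₁, hβ₁, fun r R hr hR => ?_⟩
  have := (hg r R hr hR).1
  rw [le_div_iff₀ (hpos hr)] at this
  have hC0 : 0 < C := by linarith
  calc (R / r) ^ β₁ * Ψ r = C * (1 / C * (R / r) ^ β₁ * Ψ r) := by field_simp
    _ ≤ _ := by gcongr

/-- Values of a doubling function at `R ≤ Λ r` are controlled by its value at `r`. -/
lemma IsDoublingFunction.exists_le {Ψ : ℝ → ℝ} (h : IsDoublingFunction Ψ) (Λ : ℝ) :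
    ∃ C > (0 : ℝ), ∀ r R : ℝ, 0 < r → 0 < R → R ≤ Λ * r → Ψ R ≤ C * Ψ r := by
  have hpos := @h.pos
  obtain ⟨C₁, hC₁, β, hβ, hlow⟩ := h.exists_lower
  obtain ⟨-, C, hC, β₁, hβ₁, β₂, hβ₂, -, hg⟩ := h
  -- The first summand serves `R ≤ r`, where lower growth gives almost monotonicity; the second
  -- serves `r ≤ R ≤ Λ r`.
  refine ⟨C₁ + C * (max Λ 1) ^ β₂, by positivity, fun r R hr hR hΛ => ?_⟩
  have hr' := hpos hr
  rcases le_total R r with hRr | hRr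
  · have h1 := hlow R r hR hRr
    have h2 : 1 ≤ (r / R) ^ β := Real.one_le_rpow ((one_le_div hR).2 hRr) hβ.le
    have : Ψ R ≤ C₁ * Ψ r := le_trans (le_mul_of_one_le_left (hpos hR).le h2) h1
    have : 0 ≤ C * (max Λ 1) ^ β₂ * Ψ r := by positivity
    linarith
  · have h1 := (hg r R hr hRr).2
    rw [div_le_iff₀ hr'] at h1
    have h2 : (R / r) ^ β₂ ≤ (max Λ 1) ^ β₂ := by
      refine Real.rpow_le_rpow (by positivity) ?_ (by linarith)
      rw [div_le_iff₀ hr]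
      exact hΛ.trans (by gcongr; exact le_max_left _ _)
    have h3 : C * (R / r) ^ β₂ * Ψ r ≤ C * (max Λ 1) ^ β₂ * Ψ r := by gcongr
    have : 0 ≤ C₁ * Ψ r := by positivity
    linarith

section volume

variable {X : Type*} [MetricSpace X] [ProperSpace X] [MeasurableSpace X]
  {μ : Measure X} [IsFiniteMeasureOnCompacts μ]

lemma measure_ball_ne_top (x : X) (r : ℝ) : μ (ball x r) ≠ ∞ := measure_ball_lt_top.ne

lemma ofReal_vol (x : X) (r : ℝ) : ENNReal.ofReal (vol μ x r) = μ (ball x r) :=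
  ofReal_measureReal (measure_ball_ne_top x r)

lemma vol_pos [μ.IsOpenPosMeasure] (x : X) {r : ℝ} (hr : 0 < r) : 0 < vol μ x r :=
  ENNReal.toReal_pos (measure_ball_pos μ x hr).ne' (measure_ball_ne_top x r)

lemma vol_mono {x y : X} {r s : ℝ} (h : ball x r ⊆ ball y s) : vol μ x r ≤ vol μ y s :=
  measureReal_mono h (measure_ball_ne_top y s)

/-- Comparison of the volumes of nearby balls of comparable radii. -/
lemma VolumeDoubling.exists_le (h : VolumeDoubling μ) (Λ : ℝ) :
    ∃ C > (0 : ℝ), ∀ (x y : X) (r s : ℝ), 0 < s → dist x y + r ≤ Λ * s →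
      vol μ y r ≤ C * vol μ x s := by
  obtain ⟨C, hC, hd⟩ := h
  have hpow : ∀ (n : ℕ) (x : X) (s : ℝ), 0 < s → vol μ x (2 ^ n * s) ≤ C ^ n * vol μ x s := by
    intro n x s hs
    induction n with
    | zero => simp
    | succ n ih =>
      calc vol μ x (2 ^ (n + 1) * s) = vol μ x (2 * (2 ^ n * s)) := by ring_nf
        _ ≤ C * vol μ x (2 ^ n * s) := hd _ _ (by positivity)
        _ ≤ C * (C ^ n * vol μ x s) := by gcongr
        _ = _ := by ring
  obtain ⟨n, hn⟩ := pow_unbounded_of_one_lt Λ (one_lt_two (α := ℝ))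
  refine ⟨C ^ n, by positivity, fun x y r s hs hle => le_trans (vol_mono ?_) (hpow n x s hs)⟩
  refine ball_subset_ball' ?_
  rw [dist_comm]
  nlinarith

/-! ### Nets -/

/-- The finite set `J` is `ε`-separated. -/
def Sep (ε : ℝ) (J : Finset X) : Prop := ∀ i ∈ J, ∀ j ∈ J, i ≠ j → ε ≤ dist i j

lemma Sep.filter {ε : ℝ} {J : Finset X} (h : Sep ε J) (q : X → Prop) [DecidablePred q] :
    Sep ε (J.filter q) :=
  fun i hi j hj => h i (Finset.mem_filter.1 hi).1 j (Finset.mem_filter.1 hj).1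

/-- Bounded overlap: separated sets in a ball of comparable radius have bounded cardinality. -/
lemma VolumeDoubling.exists_card_le [OpensMeasurableSpace X] [μ.IsOpenPosMeasure]
    (h : VolumeDoubling μ) (Λ : ℝ) :
    ∃ N : ℕ, ∀ (ε : ℝ) (x : X) (J : Finset X), 0 < ε → Sep ε J →
      (∀ j ∈ J, dist j x < Λ * ε) → J.card ≤ N := by
  -- The balls `B(j, ε/2)` are disjoint and lie in `B(x, (Λ+1)ε)`. Since `dist j x + (Λ+1)ε ≤
  -- 2(2Λ+1)·(ε/2)`, each carries at least the fraction `1/C` of the volume of that ball.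
  obtain ⟨C, hC, hv⟩ := h.exists_le (2 * (2 * Λ + 1))
  obtain ⟨N, hN⟩ := exists_nat_ge C
  refine ⟨N, fun ε x J hε hJ hx => ?_⟩
  rcases J.eq_empty_or_nonempty with rfl | ⟨j₀, hj₀⟩
  · simp
  have hV : 0 < vol μ x ((Λ + 1) * ε) :=
    vol_pos x (by have := dist_nonneg.trans_lt (hx j₀ hj₀); nlinarith)
  have hdisj : (J : Set X).PairwiseDisjoint fun j => ball j (ε / 2) := by
    intro i hi j hj hij
    refine ball_disjoint_ball ?_
    have := hJ i hi j hj hij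
    linarith
  have h1 : ∑ j ∈ J, vol μ j (ε / 2) ≤ vol μ x ((Λ + 1) * ε) := by
    have h2 := measureReal_biUnion_finset (μ := μ) hdisj (fun j _ => measurableSet_ball)
      (fun j _ => measure_ball_ne_top j _)
    unfold vol
    rw [← h2]
    refine measureReal_mono (Set.iUnion₂_subset fun j hj => ball_subset_ball' ?_)
      (measure_ball_ne_top _ _)
    have := hx j hj
    linarith
  have h3 : (J.card : ℝ) * vol μ x ((Λ + 1) * ε) ≤ C * vol μ x ((Λ + 1) * ε) := by
    calc (J.card : ℝ) * vol μ x ((Λ + 1) * ε) = ∑ j ∈ J, vol μ x ((Λ + 1) * ε) := by simp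
      _ ≤ ∑ j ∈ J, C * vol μ j (ε / 2) := by
        refine Finset.sum_le_sum fun j hj => hv j x _ _ (by positivity) ?_
        have := hx j hj
        nlinarith
      _ = C * ∑ j ∈ J, vol μ j (ε / 2) := by rw [Finset.mul_sum]
      _ ≤ _ := by gcongr
  have := le_of_mul_le_mul_right h3 hV
  exact_mod_cast this.trans hN

/-- Every ball has a finite `ε`-net. -/
lemma VolumeDoubling.exists_net [OpensMeasurableSpace X] [μ.IsOpenPosMeasure]
    (h : VolumeDoubling μ) (x : X) (R : ℝ) {ε : ℝ} (hε : 0 < ε) :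
    ∃ J : Finset X, Sep ε J ∧ (∀ j ∈ J, dist j x < R) ∧
      ∀ y, dist y x < R → ∃ j ∈ J, dist y j < ε := by
  classical
  obtain ⟨N, hN⟩ := h.exists_card_le (R / ε)
  have hR : R / ε * ε = R := by field_simp
  let P : ℕ → Prop := fun n => ∃ J : Finset X, Sep ε J ∧ (∀ j ∈ J, dist j x < R) ∧ J.card = n
  have hP0 : P 0 := ⟨∅, by simp [Sep], by simp, by simp⟩
  have hPN : ∀ n, P n → n ≤ N := by
    rintro n ⟨J, h1, h2, rfl⟩
    exact hN ε x J hε h1 (by rwa [hR])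
  -- Cardinalities are bounded by `N`, so a separated set of largest cardinality exists. A point at
  -- distance at least `ε` from all of it could be added, so it is a net.
  obtain ⟨J, h1, h2, h3⟩ := Nat.findGreatest_spec (P := P) (Nat.zero_le N) hP0
  refine ⟨J, h1, h2, fun y hy => ?_⟩
  by_contra! hc
  have hyJ : y ∉ J := fun hyJ => by
    have := hc y hyJ
    rw [dist_self] at this; linarith
  have hP1 : P (Nat.findGreatest P N + 1) := by
    refine ⟨insert y J, ?_, ?_, by rw [Finset.card_insert_of_notMem hyJ, h3]⟩
    · intro i hi j hj hij
      rw [Finset.mem_insert] at hi hj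
      rcases hi with rfl | hi <;> rcases hj with rfl | hj
      · exact absurd rfl hij
      · exact hc j hj
      · rw [dist_comm]; exact hc i hi
      · exact h1 i hi j hj hij
    · intro j hj
      rcases Finset.mem_insert.1 hj with rfl | hj
      exacts [hy, h2 j hj]
  have := Nat.le_findGreatest (hPN _ hP1) hP1
  omega

open Classical in
/-- Bounded overlap of the balls around a separated set, in integrated form. -/
lemma sum_setLIntegral_ball_le [OpensMeasurableSpace X] {Γ : Measure X} {J : Finset X} {s : ℝ}
    {N : ℕ} (hN : ∀ x, (J.filter fun j => dist j x < s).card ≤ N) {B : Set X}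
    (hB : ∀ j ∈ J, ball j s ⊆ B) (f : X → ℝ≥0∞) :
    ∑ j ∈ J, ∫⁻ x in ball j s, f x ∂Γ ≤ N * ∫⁻ x in B, f x ∂Γ := by
  -- The overlap count is turned into an inequality of measures, so that it applies to every `f`
  -- without measurability.
  have hle : ∑ j ∈ J, Γ.restrict (ball j s) ≤ (N : ℝ≥0∞) • Γ.restrict B := by
    refine Measure.le_iff.2 fun A hA => ?_
    rw [Measure.finsetSum_apply, Measure.smul_apply, smul_eq_mul]
    calc ∑ j ∈ J, Γ.restrict (ball j s) A
        = ∑ j ∈ J, ∫⁻ x in A, (ball j s).indicator 1 x ∂(Γ.restrict B) := by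
          refine Finset.sum_congr rfl fun j hj => ?_
          rw [lintegral_indicator_one measurableSet_ball, Measure.restrict_restrict hA,
            Measure.restrict_apply hA, Measure.restrict_apply measurableSet_ball]
          congr 1
          ext z
          have := @hB j hj z
          simp only [Set.mem_inter_iff]; tauto
      _ = ∫⁻ x in A, ∑ j ∈ J, (ball j s).indicator 1 x ∂(Γ.restrict B) := by
          rw [lintegral_finsetSum]
          exact fun j _ => measurable_one.indicator measurableSet_ball
      _ ≤ ∫⁻ x in A, N ∂(Γ.restrict B) := by
          refine lintegral_mono fun x => ?_
          have : ∑ j ∈ J, (ball j s).indicator (1 : X → ℝ≥0∞) x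
              = ((J.filter fun j => dist j x < s).card : ℝ≥0∞) := by
            rw [Finset.card_filter]
            push_cast
            refine Finset.sum_congr rfl fun j _ => ?_
            simp [Set.indicator_apply, dist_comm]
          simp only [this]
          exact_mod_cast hN x
      _ = _ := by simp
  calc ∑ j ∈ J, ∫⁻ x in ball j s, f x ∂Γ = ∫⁻ x, f x ∂(∑ j ∈ J, Γ.restrict (ball j s)) := by
        rw [lintegral_finsetSum_measure]
    _ ≤ ∫⁻ x, f x ∂((N : ℝ≥0∞) • Γ.restrict B) := lintegral_mono' hle le_rfl
    _ = _ := by rw [lintegral_smul_measure, smul_eq_mul]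

/-- Bounded overlap of the balls around a separated set. -/
lemma VolumeDoubling.exists_overlap [OpensMeasurableSpace X] [μ.IsOpenPosMeasure]
    (h : VolumeDoubling μ) (Λ : ℝ) :
    ∃ N : ℕ, ∀ (ε : ℝ) (J : Finset X), 0 < ε → Sep ε J → ∀ (Γ : Measure X) (B : Set X),
      (∀ j ∈ J, ball j (Λ * ε) ⊆ B) → ∀ f : X → ℝ≥0∞,
      ∑ j ∈ J, ∫⁻ x in ball j (Λ * ε), f x ∂Γ ≤ N * ∫⁻ x in B, f x ∂Γ := by
  classical
  obtain ⟨N, hN⟩ := h.exists_card_le Λ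
  refine ⟨N, fun ε J hε hJ Γ B hB f => sum_setLIntegral_ball_le (fun x => ?_) hB f⟩
  convert hN ε x _ hε (hJ.filter fun j => dist j x < Λ * ε) fun j hj => (Finset.mem_filter.1 hj).2

/-- Subadditivity at the level of measures: the restriction to `B` is at most the sum of the
restrictions to the covering balls. Neither `f` nor `B` has to be measurable. -/
lemma lintegral_le_sum_ball {Γ : Measure X} {J : Finset X} {B : Set X} {ε : ℝ}
    (hB : ∀ y ∈ B, ∃ j ∈ J, dist y j < ε) (f : X → ℝ≥0∞) :
    ∫⁻ x in B, f x ∂Γ ≤ ∑ j ∈ J, ∫⁻ x in ball j ε, f x ∂Γ := by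
  rw [← lintegral_finsetSum_measure]
  refine lintegral_mono' ?_ le_rfl
  refine Measure.le_iff.2 fun A hA => ?_
  rw [Measure.finsetSum_apply, Measure.restrict_apply hA]
  simp only [Measure.restrict_apply hA]
  refine (measure_mono fun y hy => ?_).trans (measure_biUnion_finset_le J _)
  obtain ⟨j, hj, hyj⟩ := hB y hy.2
  exact Set.mem_biUnion hj ⟨hy.1, hyj⟩

end volume

/-! ### Clarkson's inequality -/

/-- The interpolating function between the two sides of Clarkson's inequality. -/
lemma hasDerivAt_clarkson (r x : ℝ) {α : ℝ} (hα : 0 < α) (h₁ : 0 < 1 + α * x)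
    (h₂ : 0 < 1 - α * x) :
    HasDerivAt (fun α : ℝ => (1 + α ^ (1 - r) * x) * (1 + α * x) ^ (r - 1)
        + (1 - α ^ (1 - r) * x) * (1 - α * x) ^ (r - 1))
      ((r - 1) * x * (1 - α ^ (-r)) * ((1 + α * x) ^ (r - 2) - (1 - α * x) ^ (r - 2))) α := by
  have e₀ := (Real.hasDerivAt_rpow_const (p := 1 - r) (Or.inl hα.ne')).mul_const x
  have e₁ := (((hasDerivAt_id α).mul_const x).const_add 1).rpow_const (p := r - 1)
    (Or.inl h₁.ne')
  have e₂ := (((hasDerivAt_id α).mul_const x).const_sub 1).rpow_const (p := r - 1)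
    (Or.inl h₂.ne')
  refine (((e₀.const_add 1).mul e₁).add ((e₀.const_sub 1).mul e₂)).congr_deriv ?_
  have a₁ : (1 + α * x) ^ (r - 1) = (1 + α * x) * (1 + α * x) ^ (r - 2) := by
    rw [show r - 1 = 1 + (r - 2) by ring, Real.rpow_add h₁, Real.rpow_one]
  have a₂ : (1 - α * x) ^ (r - 1) = (1 - α * x) * (1 - α * x) ^ (r - 2) := by
    rw [show r - 1 = 1 + (r - 2) by ring, Real.rpow_add h₂, Real.rpow_one]
  have a₃ : α ^ (1 - r) = α * α ^ (-r) := by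
    rw [show 1 - r = 1 + -r by ring, Real.rpow_add hα, Real.rpow_one]
  have s₁ : 1 - r - 1 = -r := by ring
  have s₂ : r - 1 - 1 = r - 2 := by ring
  simp only [id, s₁, s₂, a₁, a₂, a₃]
  ring

/-- At `α = x^(1/(r-1))` one has `α^(1-r) x = 1`, so the second summand of the interpolating
function disappears and the first is the `r/(r-1)`-norm side of Clarkson. At `α = 1` the function is
`(1+x)^r + (1-x)^r`. -/
lemma clarkson_end {r x : ℝ} (hr : 1 < r) (hx : 0 < x) :
    (1 + (x ^ (1 / (r - 1))) ^ (1 - r) * x) * (1 + x ^ (1 / (r - 1)) * x) ^ (r - 1)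
        + (1 - (x ^ (1 / (r - 1))) ^ (1 - r) * x) * (1 - x ^ (1 / (r - 1)) * x) ^ (r - 1)
      = 2 * (1 + x ^ (r / (r - 1))) ^ (r - 1) := by
  have hr' : r - 1 ≠ 0 := by linarith
  have h₁ : (x ^ (1 / (r - 1))) ^ (1 - r) * x = 1 := by
    rw [← Real.rpow_mul hx.le, show 1 / (r - 1) * (1 - r) = -1 by field_simp; ring,
      Real.rpow_neg_one, inv_mul_cancel₀ hx.ne']
  have h₂ : x ^ (1 / (r - 1)) * x = x ^ (r / (r - 1)) := by
    nth_rewrite 2 [← Real.rpow_one x]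
    rw [← Real.rpow_add hx]
    congr 1
    field_simp
    ring
  rw [h₁, h₂]; ring

/-- For `α ≤ 1` and `r ≥ 2` the derivative in `hasDerivAt_clarkson` has one factor `1 - α^(-r) ≤ 0`
and one nonnegative difference of `(r-2)`-th powers. The interpolating function therefore decreases,
and its two end values are the two sides. The cases `x = 0` and `x = 1` are separate because the
derivative formula needs `α > 0` and `αx < 1`. -/
lemma clarkson_unit_two_le {r x : ℝ} (hr : 2 ≤ r) (hx : 0 ≤ x) (hx1 : x ≤ 1) :
    (1 + x) ^ r + (1 - x) ^ r ≤ 2 * (1 + x ^ (r / (r - 1))) ^ (r - 1) := by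
  rcases hx.eq_or_lt with rfl | hx
  · have : r / (r - 1) ≠ 0 := div_ne_zero (by linarith) (by linarith)
    norm_num [Real.zero_rpow this]
  rcases hx1.eq_or_lt with rfl | hx1
  · have h := Real.rpow_add_one (two_ne_zero (α := ℝ)) (r - 1)
    rw [sub_add_cancel] at h
    norm_num [Real.zero_rpow (show r ≠ 0 by linarith)]
    linarith
  have hα0 : 0 < x ^ (1 / (r - 1)) := by positivity
  have hα1 : x ^ (1 / (r - 1)) ≤ 1 :=
    Real.rpow_le_one hx.le hx1.le (one_div_nonneg.2 (by linarith))
  have hD : ∀ α ∈ Set.Icc (x ^ (1 / (r - 1))) 1, 0 < α ∧ 0 < 1 + α * x ∧ 0 < 1 - α * x := by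
    rintro α ⟨h1, h2⟩
    have := hα0.trans_le h1
    exact ⟨this, by positivity, by nlinarith⟩
  have hanti := antitoneOn_of_deriv_nonpos (convex_Icc (x ^ (1 / (r - 1))) 1)
    (fun α hα => (hasDerivAt_clarkson r x (hD α hα).1 (hD α hα).2.1
      (hD α hα).2.2).continuousAt.continuousWithinAt)
    (fun α hα => (hasDerivAt_clarkson r x (hD α (interior_subset hα)).1
      (hD α (interior_subset hα)).2.1
      (hD α (interior_subset hα)).2.2).differentiableAt.differentiableWithinAt)
    (fun α hα => by
      have hα := interior_subset hα
      obtain ⟨h1, h2, h3⟩ := hD α hα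
      rw [(hasDerivAt_clarkson r x h1 h2 h3).deriv]
      have e1 : 1 ≤ α ^ (-r) := Real.one_le_rpow_of_pos_of_le_one_of_nonpos h1 hα.2 (by linarith)
      have e2 : (1 - α * x) ^ (r - 2) ≤ (1 + α * x) ^ (r - 2) :=
        Real.rpow_le_rpow h3.le (by nlinarith) (by linarith)
      exact mul_nonpos_of_nonpos_of_nonneg
        (mul_nonpos_of_nonneg_of_nonpos (mul_nonneg (by linarith) hx.le) (by linarith))
        (by linarith))
  have := hanti (Set.left_mem_Icc.2 hα1) (Set.right_mem_Icc.2 hα1) hα1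
  simp only [Real.one_rpow, one_mul] at this
  rw [clarkson_end (by linarith) hx] at this
  refine le_trans (le_of_eq ?_) this
  have hx1' : 0 < 1 - x := by linarith
  have hx2' : 0 < 1 + x := by linarith
  rw [show r = 1 + (r - 1) by ring, Real.rpow_add hx1', Real.rpow_add hx2']
  simp

/-- The same interpolation: for `r ≤ 2` the exponent `r - 2` is nonpositive, the difference of
powers changes sign, and the function increases. -/
lemma clarkson_unit_le_two {r x : ℝ} (hr1 : 1 < r) (hr : r ≤ 2) (hx : 0 ≤ x) (hx1 : x ≤ 1) :
    2 * (1 + x ^ (r / (r - 1))) ^ (r - 1) ≤ (1 + x) ^ r + (1 - x) ^ r := by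
  rcases hx.eq_or_lt with rfl | hx
  · have : r / (r - 1) ≠ 0 := div_ne_zero (by linarith) (by linarith)
    norm_num [Real.zero_rpow this]
  rcases hx1.eq_or_lt with rfl | hx1
  · have h := Real.rpow_add_one (two_ne_zero (α := ℝ)) (r - 1)
    rw [sub_add_cancel] at h
    norm_num [Real.zero_rpow (show r ≠ 0 by linarith)]
    linarith
  have hα0 : 0 < x ^ (1 / (r - 1)) := by positivity
  have hα1 : x ^ (1 / (r - 1)) ≤ 1 :=
    Real.rpow_le_one hx.le hx1.le (one_div_nonneg.2 (by linarith))
  have hD : ∀ α ∈ Set.Icc (x ^ (1 / (r - 1))) 1, 0 < α ∧ 0 < 1 + α * x ∧ 0 < 1 - α * x := by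
    rintro α ⟨h1, h2⟩
    have := hα0.trans_le h1
    exact ⟨this, by positivity, by nlinarith⟩
  have hmono := monotoneOn_of_deriv_nonneg (convex_Icc (x ^ (1 / (r - 1))) 1)
    (fun α hα => (hasDerivAt_clarkson r x (hD α hα).1 (hD α hα).2.1
      (hD α hα).2.2).continuousAt.continuousWithinAt)
    (fun α hα => (hasDerivAt_clarkson r x (hD α (interior_subset hα)).1
      (hD α (interior_subset hα)).2.1
      (hD α (interior_subset hα)).2.2).differentiableAt.differentiableWithinAt)
    (fun α hα => by
      have hα := interior_subset hα
      obtain ⟨h1, h2, h3⟩ := hD α hα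
      rw [(hasDerivAt_clarkson r x h1 h2 h3).deriv]
      have e1 : 1 ≤ α ^ (-r) := Real.one_le_rpow_of_pos_of_le_one_of_nonpos h1 hα.2 (by linarith)
      have e2 : (1 + α * x) ^ (r - 2) ≤ (1 - α * x) ^ (r - 2) :=
        Real.rpow_le_rpow_of_nonpos h3 (by nlinarith) (by linarith)
      exact mul_nonneg_of_nonpos_of_nonpos
        (mul_nonpos_of_nonneg_of_nonpos (mul_nonneg (by linarith) hx.le) (by linarith))
        (by linarith))
  have := hmono (Set.left_mem_Icc.2 hα1) (Set.right_mem_Icc.2 hα1) hα1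
  simp only [Real.one_rpow, one_mul] at this
  rw [clarkson_end (by linarith) hx] at this
  refine this.trans (le_of_eq ?_)
  have hx1' : 0 < 1 - x := by linarith
  have hx2' : 0 < 1 + x := by linarith
  rw [show r = 1 + (r - 1) by ring, Real.rpow_add hx1', Real.rpow_add hx2']
  simp

/-- Reduction of a two-sided expression in `a, b` to the ratio of the smaller to the larger. -/
lemma clarkson_reduce {r a b : ℝ} (hr : 1 < r) (hb : 0 ≤ b) (hab : b ≤ a) (ha : 0 < a) :
    ((a + b) ^ r + (a - b) ^ r = a ^ r * ((1 + b / a) ^ r + (1 - b / a) ^ r)) ∧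
    2 * ((a ^ r) ^ (1 / (r - 1)) + (b ^ r) ^ (1 / (r - 1))) ^ (r - 1)
      = a ^ r * (2 * (1 + (b / a) ^ (r / (r - 1))) ^ (r - 1)) := by
  have hr' : r - 1 ≠ 0 := by linarith
  have h0 : 0 ≤ b / a := by positivity
  have h1 : b / a ≤ 1 := (div_le_one ha).2 hab
  constructor
  · rw [mul_add, ← Real.mul_rpow ha.le (by positivity), ← Real.mul_rpow ha.le (by linarith)]
    congr 2 <;> field_simp
  · rw [← Real.rpow_mul ha.le, ← Real.rpow_mul hb, mul_one_div]
    have : b ^ (r / (r - 1)) = a ^ (r / (r - 1)) * (b / a) ^ (r / (r - 1)) := by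
      rw [← Real.mul_rpow ha.le h0, mul_div_cancel₀ _ ha.ne']
    rw [this, ← mul_one_add, Real.mul_rpow (by positivity) (by positivity), ← Real.rpow_mul ha.le,
      div_mul_cancel₀ _ hr']
    ring

/-- Changing the sign of `a` or `b` only permutes `|a + b|` and `|a - b|`. -/
lemma abs_add_rpow_add_abs_sub_rpow (r a b : ℝ) :
    |a + b| ^ r + |a - b| ^ r = (|a| + |b|) ^ r + |(|a| - |b|)| ^ r := by
  rcases abs_cases a with ⟨ha, ha'⟩ | ⟨ha, ha'⟩ <;> rcases abs_cases b with ⟨hb, hb'⟩ | ⟨hb, hb'⟩ <;>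
    rw [ha, hb]
  · rw [abs_of_nonneg (add_nonneg ha' hb')]
  · rw [add_comm, ← sub_eq_add_neg, abs_of_nonneg (show 0 ≤ a - b by linarith), sub_neg_eq_add]
  · rw [add_comm, abs_of_nonpos (show a - b ≤ 0 by linarith), ← abs_neg (a + b)]
    ring_nf
  · rw [abs_of_nonpos (show a + b ≤ 0 by linarith), ← abs_neg (a - b)]
    ring_nf

lemma clarkson_real_two_le {r : ℝ} (hr : 2 ≤ r) (a b : ℝ) :
    |a + b| ^ r + |a - b| ^ r
      ≤ 2 * ((|a| ^ r) ^ (1 / (r - 1)) + (|b| ^ r) ^ (1 / (r - 1))) ^ (r - 1) := by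
  rw [abs_add_rpow_add_abs_sub_rpow]
  have key : ∀ a b : ℝ, 0 ≤ b → b ≤ a → 0 < a → (a + b) ^ r + |a - b| ^ r
      ≤ 2 * ((a ^ r) ^ (1 / (r - 1)) + (b ^ r) ^ (1 / (r - 1))) ^ (r - 1) := by
    intro a b hb hab ha
    obtain ⟨h1, h2⟩ := clarkson_reduce (r := r) (by linarith) hb hab ha
    rw [abs_of_nonneg (sub_nonneg.2 hab), h1, h2]
    gcongr
    exact clarkson_unit_two_le hr (by positivity) ((div_le_one ha).2 hab)
  rcases le_total |b| |a| with h | h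
  · rcases (abs_nonneg a).eq_or_lt with h0 | h0
    · have : |b| = 0 := le_antisymm (h.trans h0.ge) (abs_nonneg b)
      rw [← h0, this]
      have : r ≠ 0 := by linarith
      simp [Real.zero_rpow this]; positivity
    · exact key _ _ (abs_nonneg b) h h0
  · rcases (abs_nonneg b).eq_or_lt with h0 | h0
    · have : |a| = 0 := le_antisymm (h.trans h0.ge) (abs_nonneg a)
      rw [← h0, this]
      have : r ≠ 0 := by linarith
      simp [Real.zero_rpow this]; positivity
    · rw [add_comm |a|, abs_sub_comm, add_comm ((|a| ^ r) ^ _)]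
      exact key _ _ (abs_nonneg a) h h0

lemma clarkson_real_le_two {r : ℝ} (hr1 : 1 < r) (hr : r ≤ 2) (a b : ℝ) :
    2 * ((|a| ^ r) ^ (1 / (r - 1)) + (|b| ^ r) ^ (1 / (r - 1))) ^ (r - 1)
      ≤ |a + b| ^ r + |a - b| ^ r := by
  rw [abs_add_rpow_add_abs_sub_rpow]
  have key : ∀ a b : ℝ, 0 ≤ b → b ≤ a → 0 < a →
      2 * ((a ^ r) ^ (1 / (r - 1)) + (b ^ r) ^ (1 / (r - 1))) ^ (r - 1)
        ≤ (a + b) ^ r + |a - b| ^ r := by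
    intro a b hb hab ha
    obtain ⟨h1, h2⟩ := clarkson_reduce (r := r) (by linarith) hb hab ha
    rw [abs_of_nonneg (sub_nonneg.2 hab), h1, h2]
    gcongr
    exact clarkson_unit_le_two hr1 hr (by positivity) ((div_le_one ha).2 hab)
  have hz : (2 : ℝ) * (((0 : ℝ) ^ r) ^ (1 / (r - 1)) + ((0 : ℝ) ^ r) ^ (1 / (r - 1))) ^ (r - 1)
      = 0 := by
    have h1 : r ≠ 0 := by linarith
    have h2 : r - 1 ≠ 0 := by linarith
    rw [Real.zero_rpow h1, Real.zero_rpow (one_div_ne_zero h2), add_zero, Real.zero_rpow h2,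
      mul_zero]
  rcases le_total |b| |a| with h | h
  · rcases (abs_nonneg a).eq_or_lt with h0 | h0
    · have : |b| = 0 := le_antisymm (h.trans h0.ge) (abs_nonneg b)
      rw [← h0, this, hz]; positivity
    · exact key _ _ (abs_nonneg b) h h0
  · rcases (abs_nonneg b).eq_or_lt with h0 | h0
    · have : |a| = 0 := le_antisymm (h.trans h0.ge) (abs_nonneg a)
      rw [← h0, this, hz]; positivity
    · rw [add_comm |a|, abs_sub_comm, add_comm ((|a| ^ r) ^ _)]
      exact key _ _ (abs_nonneg a) h h0

lemma enorm_rpow_eq_ofReal {p : ℝ} (hp : 0 ≤ p) (a : ℝ) :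
    ‖a‖ₑ ^ p = ENNReal.ofReal (|a| ^ p) := by
  rw [Real.enorm_eq_ofReal_abs, ENNReal.ofReal_rpow_of_nonneg (abs_nonneg a) hp]

lemma ofReal_clarkson {r : ℝ} (hr : 1 < r) (a b : ℝ) :
    2 * ((‖a‖ₑ ^ r) ^ (1 / (r - 1)) + (‖b‖ₑ ^ r) ^ (1 / (r - 1))) ^ (r - 1) = ENNReal.ofReal
      (2 * ((|a| ^ r) ^ (1 / (r - 1)) + (|b| ^ r) ^ (1 / (r - 1))) ^ (r - 1)) := by
  have h0 : 0 ≤ r := by linarith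
  have h1 : 0 ≤ r - 1 := by linarith
  have h2 : 0 ≤ 1 / (r - 1) := by positivity
  rw [enorm_rpow_eq_ofReal h0, enorm_rpow_eq_ofReal h0,
    ENNReal.ofReal_rpow_of_nonneg (by positivity) h2,
    ENNReal.ofReal_rpow_of_nonneg (by positivity) h2,
    ← ENNReal.ofReal_add (by positivity) (by positivity),
    ENNReal.ofReal_rpow_of_nonneg (by positivity) h1, ENNReal.ofReal_mul zero_le_two]
  simp

/-- The triangle inequality for `ℓ^(1/s)`-valued integrals of pairs, `0 < s ≤ 1`. -/
lemma rpow_lintegral_add_le {α : Type*} [MeasurableSpace α] {ν : Measure α} {s : ℝ} (hs : 0 < s)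
    (hs1 : s ≤ 1) {f g : α → ℝ≥0∞} (hf : AEMeasurable f ν) (hg : AEMeasurable g ν)
    (hf' : ∫⁻ z, f z ∂ν ≠ ∞) (hg' : ∫⁻ z, g z ∂ν ≠ ∞) :
    ((∫⁻ z, f z ∂ν) ^ (1 / s) + (∫⁻ z, g z ∂ν) ^ (1 / s)) ^ s
      ≤ ∫⁻ z, (f z ^ (1 / s) + g z ^ (1 / s)) ^ s ∂ν := by
  -- The dual exponent `1/(1-s)` degenerates at `s = 1`, where the claim is additivity of the
  -- integral.
  rcases hs1.eq_or_lt with rfl | hs1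
  · simp only [div_one, ENNReal.rpow_one]
    rw [lintegral_add_left' hf]
  set H := ∫⁻ z, f z ∂ν
  set G := ∫⁻ z, g z ∂ν
  set D := H ^ (1 / s) + G ^ (1 / s) with hD
  have hs1' : 0 < 1 - s := by linarith
  have hDtop : D ≠ ∞ := ENNReal.add_ne_top.2
    ⟨ENNReal.rpow_ne_top_of_nonneg (by positivity) hf',
      ENNReal.rpow_ne_top_of_nonneg (by positivity) hg'⟩
  by_cases hD0 : D = 0
  · rw [hD0, ENNReal.zero_rpow_of_pos hs]; exact zero_le
  have hconj : (1 / s).HolderConjugate (1 / (1 - s)) :=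
    Real.holderConjugate_iff.2 ⟨by rw [lt_div_iff₀ hs]; linarith, by field_simp; ring⟩
  -- `(a H, a G)` is the extremal vector in Hölder's inequality for `(H, G)`: it has norm one in the
  -- dual exponent and pairs with `(H, G)` to give exactly `D ^ s`. Pairing it with `(f z, g z)`
  -- under the integral and applying Hölder pointwise gives the claim.
  let a : ℝ≥0∞ → ℝ≥0∞ := fun T => T ^ (1 / s - 1) * D ^ (-(1 - s))
  have ha1 : ∀ T, T ≠ ∞ → a T * T = T ^ (1 / s) * D ^ (-(1 - s)) := by
    intro T hT
    have : T ^ (1 / s) = T ^ (1 / s - 1) * T := by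
      conv_rhs => rw [← ENNReal.rpow_one T]
      rw [← ENNReal.rpow_mul, one_mul, ← ENNReal.rpow_add_of_nonneg _ _ ?_ zero_le_one]
      · ring_nf
      · rw [sub_nonneg, le_div_iff₀ hs]; linarith
    rw [this]; ring
  have hDs : D * D ^ (-(1 - s)) = D ^ s := by
    conv_lhs => rw [← ENNReal.rpow_one D]
    rw [← ENNReal.rpow_mul, ← ENNReal.rpow_add _ _ hD0 hDtop]
    ring_nf
  have ha2 : ∀ T, a T ^ (1 / (1 - s)) = T ^ (1 / s) * D⁻¹ := by
    intro T
    simp only [a]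
    rw [ENNReal.mul_rpow_of_nonneg _ _ (by positivity), ← ENNReal.rpow_mul, ← ENNReal.rpow_mul,
      ← ENNReal.rpow_neg_one D]
    congr 2 <;> field_simp
  have hsum : a H ^ (1 / (1 - s)) + a G ^ (1 / (1 - s)) = 1 := by
    rw [ha2, ha2, ← add_mul, ← hD, ENNReal.mul_inv_cancel hD0 hDtop]
  calc D ^ s = a H * H + a G * G := by
        rw [ha1 _ hf', ha1 _ hg', ← add_mul, ← hD, hDs]
    _ = ∫⁻ z, a H * f z + a G * g z ∂ν := by
        rw [lintegral_add_left' (hf.const_mul _), lintegral_const_mul'' _ hf,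
          lintegral_const_mul'' _ hg]
    _ ≤ _ := by
        refine lintegral_mono fun z => ?_
        have := ENNReal.inner_le_Lp_mul_Lq Finset.univ ![f z, g z] ![a H, a G] hconj
        simp only [Fin.sum_univ_two, Matrix.cons_val_zero, Matrix.cons_val_one, hsum,
          ENNReal.one_rpow, mul_one, one_div_one_div] at this
        rwa [mul_comm (a H), mul_comm (a G)]

/-- The reverse inequality for `1 ≤ s`, a form of Minkowski's inequality. -/
lemma lintegral_rpow_add_le {α : Type*} [MeasurableSpace α] {ν : Measure α} {s : ℝ}
    (hs1 : 1 ≤ s) {f g : α → ℝ≥0∞} (hf : AEMeasurable f ν) (hg : AEMeasurable g ν) :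
    ∫⁻ z, (f z ^ (1 / s) + g z ^ (1 / s)) ^ s ∂ν
      ≤ ((∫⁻ z, f z ∂ν) ^ (1 / s) + (∫⁻ z, g z ∂ν) ^ (1 / s)) ^ s := by
  have hs : 0 < s := by linarith
  have := ENNReal.lintegral_Lp_add_le (hf.pow_const (1 / s)) (hg.pow_const (1 / s)) hs1
  have e : ∀ c : ℝ≥0∞, (c ^ (1 / s)) ^ s = c := fun c => by
    rw [← ENNReal.rpow_mul, one_div_mul_cancel hs.ne', ENNReal.rpow_one]
  simp only [Pi.add_apply, e] at this
  have := ENNReal.rpow_le_rpow this hs.le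
  rwa [e] at this

/-! ### Non-local forms are `p`-energies -/

section form

variable {X : Type*} [MetricSpace X] [MeasurableSpace X] {μ : Measure X} {p : ℝ}

/-- The `p`-th power of the `L^p` norm. -/
noncomputable def pnorm (p : ℝ) (μ : Measure X) (f : X → ℝ) : ℝ≥0∞ := ∫⁻ x, ‖f x‖ₑ ^ p ∂μ

lemma eLpNorm_eq_pnorm (hp : 0 < p) (f : X → ℝ) :
    eLpNorm f (ENNReal.ofReal p) μ = pnorm p μ f ^ (1 / p) := by
  rw [eLpNorm_eq_lintegral_rpow_enorm_toReal (by simpa using hp) ENNReal.ofReal_ne_top,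
    ENNReal.toReal_ofReal hp.le, pnorm]

lemma eLpNorm_rpow_eq_pnorm (hp : 0 < p) (f : X → ℝ) :
    eLpNorm f (ENNReal.ofReal p) μ ^ p = pnorm p μ f := by
  rw [eLpNorm_eq_pnorm hp, ← ENNReal.rpow_mul, one_div_mul_cancel hp.ne', ENNReal.rpow_one]

lemma memLp_iff_pnorm (hp : 0 < p) (f : X → ℝ) :
    MemLp f (ENNReal.ofReal p) μ ↔ AEStronglyMeasurable f μ ∧ pnorm p μ f ≠ ∞ := by
  rw [MemLp, eLpNorm_eq_pnorm hp, ENNReal.rpow_lt_top_iff_of_pos (by positivity), lt_top_iff_ne_top]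

lemma integral_abs_rpow (hp : 0 < p) {f : X → ℝ} (hf : AEStronglyMeasurable f μ) :
    ∫ x, |f x| ^ p ∂μ = (pnorm p μ f).toReal := by
  rw [integral_eq_lintegral_of_nonneg_ae (Filter.Eventually.of_forall fun x => by positivity), pnorm]
  · simp only [enorm_rpow_eq_ofReal hp.le]
  · exact (hf.norm.aemeasurable.pow_const p).aestronglyMeasurable

variable [SFinite μ] {Υ : ℝ → ℝ} {hp : 1 < p} {κ : StableKernel μ Υ}

lemma mem_nonlocalForm_dom {u : X → ℝ} : u ∈ (nonlocalForm hp κ).dom ↔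
    AEStronglyMeasurable u μ ∧ jumpEnergy p μ κ.K u + pnorm p μ u ≠ ∞ := by
  have h0 : 0 < p := by linarith
  change MemLp u (ENNReal.ofReal p) μ ∧ jumpEnergy p μ κ.K u ≠ ∞ ↔ _
  rw [memLp_iff_pnorm h0, ENNReal.add_ne_top]; tauto

lemma energyOne_nonlocalForm {u : X → ℝ} (hu : u ∈ (nonlocalForm hp κ).dom) :
    (nonlocalForm hp κ).energyOne u = (jumpEnergy p μ κ.K u + pnorm p μ u).toReal := by
  obtain ⟨h1, h2⟩ := mem_nonlocalForm_dom.1 hu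
  rw [ENNReal.add_ne_top] at h2
  rw [PForm.energyOne, integral_abs_rpow (by linarith) h1, ENNReal.toReal_add h2.1 h2.2]
  rfl

/-- The measure `K(x,y) μ(dx) μ(dy)` of a kernel. -/
noncomputable def kernelMeasure (κ : StableKernel μ Υ) : Measure (X × X) :=
  (μ.prod μ).withDensity fun z => ENNReal.ofReal (κ.K z.1 z.2)

lemma jumpEnergy_kernel {u : X → ℝ} (hu : AEStronglyMeasurable u μ) :
    jumpEnergy p μ κ.K u = ∫⁻ z, ‖u z.1 - u z.2‖ₑ ^ p ∂(kernelMeasure κ) :=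
  jumpEnergy_eq κ.measurable hu

lemma kernelMeasure_ac : kernelMeasure κ ≪ μ.prod μ := withDensity_absolutelyContinuous _ _

lemma aemeasurable_kernel {u : X → ℝ} (hu : AEStronglyMeasurable u μ) :
    AEMeasurable (fun z : X × X => ‖u z.1 - u z.2‖ₑ ^ p) (kernelMeasure κ) :=
  ((aemeasurable_enorm_sub hu).pow_const p).mono_ac kernelMeasure_ac

/-- The scalar inequality holds for `f(x) - f(y)` and `g(x) - g(y)` at every pair of points.
Integration against `kernelMeasure κ` goes through because `p - 1 ≤ 1`, the range of
`rpow_lintegral_add_le`. -/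
lemma jumpEnergy_clarkson_le_two (hp : 1 < p) (hp2 : p ≤ 2) {f g : X → ℝ}
    (hf : AEStronglyMeasurable f μ) (hg : AEStronglyMeasurable g μ)
    (hf' : jumpEnergy p μ κ.K f ≠ ∞) (hg' : jumpEnergy p μ κ.K g ≠ ∞) :
    2 * (jumpEnergy p μ κ.K f ^ (1 / (p - 1)) + jumpEnergy p μ κ.K g ^ (1 / (p - 1))) ^ (p - 1)
      ≤ jumpEnergy p μ κ.K (f + g) + jumpEnergy p μ κ.K (f - g) := by
  rw [jumpEnergy_kernel hf] at hf'
  rw [jumpEnergy_kernel hg] at hg'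
  rw [jumpEnergy_kernel hf, jumpEnergy_kernel hg, jumpEnergy_kernel (hf.add hg),
    jumpEnergy_kernel (hf.sub hg), ← lintegral_add_left' (aemeasurable_kernel (hf.add hg))]
  refine (mul_le_mul_right (rpow_lintegral_add_le (by linarith) (by linarith)
    (aemeasurable_kernel hf) (aemeasurable_kernel hg) hf' hg') 2).trans ?_
  rw [← lintegral_const_mul' _ _ ENNReal.ofNat_ne_top]
  refine lintegral_mono fun z => ?_
  rw [ofReal_clarkson hp, enorm_rpow_eq_ofReal (by linarith), enorm_rpow_eq_ofReal (by linarith),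
    ← ENNReal.ofReal_add (by positivity) (by positivity)]
  refine ENNReal.ofReal_le_ofReal ((clarkson_real_le_two hp hp2 _ _).trans (le_of_eq ?_))
  simp only [Pi.add_apply, Pi.sub_apply]
  congr 3 <;> ring

/-- Here `p - 1 ≥ 1`, so the scalar inequality is integrated with Minkowski's inequality, which
holds for infinite energies too. -/
lemma jumpEnergy_clarkson_two_le (hp2 : 2 ≤ p) {f g : X → ℝ}
    (hf : AEStronglyMeasurable f μ) (hg : AEStronglyMeasurable g μ) :
    jumpEnergy p μ κ.K (f + g) + jumpEnergy p μ κ.K (f - g) ≤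
      2 * (jumpEnergy p μ κ.K f ^ (1 / (p - 1)) + jumpEnergy p μ κ.K g ^ (1 / (p - 1))) ^ (p - 1)
      := by
  rw [jumpEnergy_kernel hf, jumpEnergy_kernel hg, jumpEnergy_kernel (hf.add hg),
    jumpEnergy_kernel (hf.sub hg), ← lintegral_add_left' (aemeasurable_kernel (hf.add hg))]
  refine le_trans ?_ (mul_le_mul_right (lintegral_rpow_add_le (by linarith)
    (aemeasurable_kernel hf) (aemeasurable_kernel hg)) 2)
  rw [← lintegral_const_mul' _ _ ENNReal.ofNat_ne_top]
  refine lintegral_mono fun z => ?_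
  dsimp only
  rw [ofReal_clarkson (by linarith), enorm_rpow_eq_ofReal (by linarith),
    enorm_rpow_eq_ofReal (by linarith), ← ENNReal.ofReal_add (by positivity) (by positivity)]
  refine ENNReal.ofReal_le_ofReal (le_trans (le_of_eq ?_) (clarkson_real_two_le hp2 _ _))
  simp only [Pi.add_apply, Pi.sub_apply]
  congr 3 <;> ring

/-- Lower semicontinuity of the energy along `μ`-a.e. convergence. -/
lemma jumpEnergy_le_liminf {u : ℕ → X → ℝ} {f : X → ℝ} (hu : ∀ n, AEStronglyMeasurable (u n) μ)
    (hf : AEStronglyMeasurable f μ)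
    (h : ∀ᵐ x ∂μ, Filter.Tendsto (fun n => u n x) Filter.atTop (𝓝 (f x))) :
    jumpEnergy p μ κ.K f ≤ Filter.liminf (fun n => jumpEnergy p μ κ.K (u n)) Filter.atTop := by
  simp only [jumpEnergy_kernel (hu _)]
  rw [jumpEnergy_kernel hf]
  refine le_trans (lintegral_mono_ae ?_) (lintegral_liminf_le' fun n => aemeasurable_kernel (hu n))
  have h1 := Measure.quasiMeasurePreserving_fst (μ := μ) (ν := μ) |>.ae h
  have h2 := Measure.quasiMeasurePreserving_snd (μ := μ) (ν := μ) |>.ae h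
  filter_upwards [kernelMeasure_ac.ae_le h1, kernelMeasure_ac.ae_le h2] with z hz1 hz2
  refine le_of_eq (Filter.Tendsto.liminf_eq ?_).symm
  exact ((hz1.sub hz2).enorm).ennrpow_const p

/-- `L^p` completeness gives a limit `F` and an a.e. convergent subsequence. Fatou applied to `u n -
u (ns k)` as `k → ∞` bounds the energy of `u n - F` by the Cauchy tail, and `F = u N - (u N - F)` is
then in the domain. -/
lemma nonlocalForm_closed (u : ℕ → X → ℝ) (hu : ∀ n, u n ∈ (nonlocalForm hp κ).dom)
    (hc : ∀ ε > (0 : ℝ), ∃ N, ∀ m ≥ N, ∀ n ≥ N,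
      (nonlocalForm hp κ).energyOne (u m - u n) ^ (1 / p) < ε) :
    ∃ f ∈ (nonlocalForm hp κ).dom, Filter.Tendsto
      (fun n => (nonlocalForm hp κ).energyOne (u n - f) ^ (1 / p)) Filter.atTop (𝓝 0) := by
  have h0 : 0 < p := by linarith
  have hm : ∀ n, MemLp (u n) (ENNReal.ofReal p) μ := fun n => (hu n).1
  have hm' : ∀ n, AEStronglyMeasurable (u n) μ := fun n => (hm n).aestronglyMeasurable
  have hc' : ∀ ε : ℝ≥0∞, 0 < ε → ∃ N, ∀ m ≥ N, ∀ n ≥ N,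
      jumpEnergy p μ κ.K (u m - u n) + pnorm p μ (u m - u n) < ε := by
    intro ε hε
    obtain ⟨a, ha0, ha⟩ := ENNReal.lt_iff_exists_real_btwn.1 hε
    have ha' : 0 < a := by
      by_contra! h
      rw [ENNReal.ofReal_of_nonpos h] at ha
      simp at ha
    obtain ⟨N, hN⟩ := hc (a ^ (1 / p)) (by positivity)
    refine ⟨N, fun m hmN n hn => lt_of_lt_of_le ?_ ha.2.le⟩
    have hd := (nonlocalForm hp κ).dom.sub_mem (hu m) (hu n)
    have := hN m hmN n hn
    rw [energyOne_nonlocalForm hd, Real.rpow_lt_rpow_iff ENNReal.toReal_nonneg ha0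
      (by positivity)] at this
    rwa [ENNReal.lt_ofReal_iff_toReal_lt (mem_nonlocalForm_dom.1 hd).2]
  have : Fact (1 ≤ ENNReal.ofReal p) := ⟨by simpa using hp.le⟩
  have hcau : CauchySeq fun n => (hm n).toLp (u n) := by
    refine EMetric.cauchySeq_iff.2 fun ε hε => ?_
    obtain ⟨N, hN⟩ := hc' (ε ^ p) (ENNReal.rpow_pos_of_nonneg hε h0.le)
    refine ⟨N, fun m hmN n hn => ?_⟩
    rw [Lp.edist_toLp_toLp, eLpNorm_eq_pnorm h0, one_div, ENNReal.rpow_inv_lt_iff h0]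
    exact lt_of_le_of_lt le_add_self (hN m hmN n hn)
  obtain ⟨F', hF⟩ := cauchySeq_tendsto_of_complete hcau
  obtain ⟨F, hFm, rfl⟩ : ∃ (F : X → ℝ) (hFm : MemLp F (ENNReal.ofReal p) μ), hFm.toLp F = F' :=
    ⟨F', Lp.memLp F', Lp.toLp_coeFn F' (Lp.memLp F')⟩
  have hF' : Filter.Tendsto (fun n => eLpNorm (u n - F) (ENNReal.ofReal p) μ) Filter.atTop (𝓝 0) :=
    (Lp.tendsto_Lp_iff_tendsto_eLpNorm'' u hm F hFm).1 hF
  obtain ⟨ns, hns, hae⟩ := (tendstoInMeasure_of_tendsto_eLpNorm (by simpa using h0) hm'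
    hFm.aestronglyMeasurable hF').exists_seq_tendsto_ae
  have hE : ∀ ε : ℝ≥0∞, 0 < ε → ∃ N, ∀ n ≥ N, jumpEnergy p μ κ.K (u n - F) ≤ ε := by
    intro ε hε
    obtain ⟨N, hN⟩ := hc' ε hε
    refine ⟨N, fun n hn => ?_⟩
    refine (jumpEnergy_le_liminf (u := fun k => u n - u (ns k))
      (fun k => (hm' n).sub (hm' _)) ((hm' n).sub hFm.aestronglyMeasurable) ?_).trans ?_
    · filter_upwards [hae] with x hx
      exact tendsto_const_nhds.sub hx
    · refine Filter.liminf_le_of_frequently_le' (Filter.Eventually.frequently ?_)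
      filter_upwards [Filter.eventually_ge_atTop N] with k hk
      exact le_self_add.trans (hN n hn _ (hk.trans (hns.id_le k))).le
  have hFdom : F ∈ (nonlocalForm hp κ).dom := by
    obtain ⟨N, hN⟩ := hE 1 one_pos
    have hd : u N - F ∈ (nonlocalForm hp κ).dom :=
      ⟨(hm N).sub hFm, ne_top_of_le_ne_top ENNReal.one_ne_top (hN N le_rfl)⟩
    have := (nonlocalForm hp κ).dom.sub_mem (hu N) hd
    rwa [sub_sub_cancel] at this
  refine ⟨F, hFdom, ?_⟩
  have hsum : Filter.Tendsto (fun n => jumpEnergy p μ κ.K (u n - F) + pnorm p μ (u n - F))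
      Filter.atTop (𝓝 0) := by
    have h1 : Filter.Tendsto (fun n => jumpEnergy p μ κ.K (u n - F)) Filter.atTop (𝓝 0) :=
      ENNReal.tendsto_atTop_zero.2 hE
    have h2 : Filter.Tendsto (fun n => pnorm p μ (u n - F)) Filter.atTop (𝓝 0) := by
      have := hF'.ennrpow_const p
      rw [ENNReal.zero_rpow_of_pos h0] at this
      simpa only [eLpNorm_rpow_eq_pnorm h0] using this
    simpa using h1.add h2
  have h3 := (ENNReal.tendsto_toReal ENNReal.zero_ne_top).comp hsum
  have h4 := h3.rpow_const (p := 1 / p) (Or.inr (by positivity))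
  rw [ENNReal.toReal_zero, Real.zero_rpow (by positivity)] at h4
  refine h4.congr fun n => ?_
  rw [energyOne_nonlocalForm ((nonlocalForm hp κ).dom.sub_mem (hu n) hFdom)]
  rfl

/-- A densely defined non-local form is a `p`-energy. -/
lemma nonlocalForm_isPEnergy (hd : ∀ f : X → ℝ, MemLp f (ENNReal.ofReal p) μ → ∀ ε > (0 : ℝ),
    ∃ g ∈ (nonlocalForm hp κ).dom,
      eLpNorm (f - g) (ENNReal.ofReal p) μ ≤ ENNReal.ofReal ε) :
    (nonlocalForm hp κ).IsPEnergy where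
  dense := hd
  closed := nonlocalForm_closed
  markov φ hφ0 hφ f hf := by
    have h0 : 0 < p := by linarith
    have hlip : LipschitzWith 1 φ := LipschitzWith.of_dist_le_mul fun s t => by
      simpa [Real.dist_eq] using hφ t s
    have hle : jumpEnergy p μ κ.K (φ ∘ f) ≤ jumpEnergy p μ κ.K f := by
      refine lintegral_mono fun x => lintegral_mono fun y => ?_
      gcongr ?_ ^ p * _
      rw [enorm_le_iff_norm_le]
      exact hφ (f y) (f x)
    have hm : MemLp (φ ∘ f) (ENNReal.ofReal p) μ := hlip.comp_memLp hφ0 hf.1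
    exact ⟨⟨hm, ne_top_of_le_ne_top hf.2 hle⟩, ENNReal.toReal_mono hf.2 hle⟩
  clarkson_le_two hp2 f hf g hg := by
    have h := jumpEnergy_clarkson_le_two hp hp2 hf.1.aestronglyMeasurable
      hg.1.aestronglyMeasurable hf.2 hg.2
    have h1 := ((nonlocalForm hp κ).dom.add_mem hf hg).2
    have h2 := ((nonlocalForm hp κ).dom.sub_mem hf hg).2
    have h3 := ENNReal.toReal_mono (ENNReal.add_ne_top.2 ⟨h1, h2⟩) h
    have hq : 0 ≤ 1 / (p - 1) := one_div_nonneg.2 (by linarith)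
    rw [ENNReal.toReal_add h1 h2, ENNReal.toReal_mul, ← ENNReal.toReal_rpow, ENNReal.toReal_add
      (ENNReal.rpow_ne_top_of_nonneg hq hf.2) (ENNReal.rpow_ne_top_of_nonneg hq hg.2),
      ← ENNReal.toReal_rpow, ← ENNReal.toReal_rpow, ENNReal.toReal_ofNat] at h3
    exact h3
  clarkson_two_le hp2 f hf g hg := by
    have h := jumpEnergy_clarkson_two_le (κ := κ) hp2 hf.1.aestronglyMeasurable
      hg.1.aestronglyMeasurable
    have h1 := ((nonlocalForm hp κ).dom.add_mem hf hg).2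
    have h2 := ((nonlocalForm hp κ).dom.sub_mem hf hg).2
    have hq : 0 ≤ 1 / (p - 1) := one_div_nonneg.2 (by linarith)
    have ht1 := ENNReal.rpow_ne_top_of_nonneg hq hf.2
    have ht2 := ENNReal.rpow_ne_top_of_nonneg hq hg.2
    have h3 := ENNReal.toReal_mono (ENNReal.mul_ne_top ENNReal.ofNat_ne_top
      (ENNReal.rpow_ne_top_of_nonneg (by linarith) (ENNReal.add_ne_top.2 ⟨ht1, ht2⟩))) h
    rw [ENNReal.toReal_add h1 h2, ENNReal.toReal_mul, ← ENNReal.toReal_rpow, ENNReal.toReal_add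
      ht1 ht2, ← ENNReal.toReal_rpow, ← ENNReal.toReal_rpow, ENNReal.toReal_ofNat] at h3
    exact h3

end form

/-! ### Weighted difference energies -/

section weighted

variable {X : Type*} [MetricSpace X] [MeasurableSpace X] {μ : Measure X} {p : ℝ}

/-- The energy `∬ |v(x) - v(y)|^p w(x,y) μ(dy) μ(dx)` of a weight `w`. -/
noncomputable def wEnergy (p : ℝ) (μ : Measure X) (w : X → X → ℝ≥0∞) (v : X → ℝ) : ℝ≥0∞ :=
  ∫⁻ x, ∫⁻ y, ‖v x - v y‖ₑ ^ p * w x y ∂μ ∂μ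

/-- The diagonal may be left out of the hypothesis, as the integrand vanishes there; kernel bounds
are only available off it. -/
lemma wEnergy_mono (hp : 0 < p) {w w' : X → X → ℝ≥0∞} {c : ℝ≥0∞} (hc : c ≠ ∞)
    (h : ∀ x y, x ≠ y → w x y ≤ c * w' x y) (v : X → ℝ) :
    wEnergy p μ w v ≤ c * wEnergy p μ w' v := by
  unfold wEnergy
  rw [← lintegral_const_mul' _ _ hc]
  refine lintegral_mono fun x => ?_
  rw [← lintegral_const_mul' _ _ hc]
  refine lintegral_mono fun y => ?_
  rcases eq_or_ne x y with rfl | hxy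
  · simp [hp]
  · calc _ ≤ ‖v x - v y‖ₑ ^ p * (c * w' x y) := by gcongr; exact h x y hxy
      _ = _ := by ring

lemma measurable_enorm_sub {v : X → ℝ} (hv : Measurable v) :
    Measurable fun z : X × X => ‖v z.1 - v z.2‖ₑ ^ p :=
  (((hv.comp measurable_fst).sub (hv.comp measurable_snd)).enorm).pow_const p

lemma enorm_add_rpow_le (hp : 1 ≤ p) (a b : ℝ) :
    ‖a + b‖ₑ ^ p ≤ 2 ^ p * (‖a‖ₑ ^ p + ‖b‖ₑ ^ p) := by
  calc ‖a + b‖ₑ ^ p ≤ (‖a‖ₑ + ‖b‖ₑ) ^ p :=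
        ENNReal.rpow_le_rpow (enorm_add_le a b) (by linarith)
    _ ≤ 2 ^ (p - 1) * (‖a‖ₑ ^ p + ‖b‖ₑ ^ p) := ENNReal.rpow_add_le_mul_rpow_add_rpow _ _ hp
    _ ≤ _ := by gcongr; exacts [one_le_two, by linarith]

lemma two_rpow_ne_top (hp : 0 ≤ p) : (2 : ℝ≥0∞) ^ p ≠ ∞ :=
  ENNReal.rpow_ne_top_of_nonneg hp ENNReal.ofNat_ne_top

variable [SFinite μ]

lemma wEnergy_add_weight {w₁ w₂ w : X → X → ℝ≥0∞} (h₁ : Measurable (Function.uncurry w₁))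
    (hw : ∀ x y, w x y ≤ w₁ x y + w₂ x y) {v : X → ℝ} (hv : Measurable v) :
    wEnergy p μ w v ≤ wEnergy p μ w₁ v + wEnergy p μ w₂ v := by
  have hm : Measurable fun z : X × X => ‖v z.1 - v z.2‖ₑ ^ p * w₁ z.1 z.2 :=
    (measurable_enorm_sub hv).mul h₁
  unfold wEnergy
  rw [← lintegral_add_left hm.lintegral_prod_right]
  refine lintegral_mono fun x => ?_
  dsimp only
  have hmx : Measurable fun y => ‖v x - v y‖ₑ ^ p * w₁ x y := hm.comp measurable_prodMk_left
  rw [← lintegral_add_left hmx]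
  refine lintegral_mono fun y => ?_
  dsimp only
  rw [← mul_add]
  gcongr
  exact hw x y

lemma wEnergy_add_le (hp : 1 ≤ p) {w : X → X → ℝ≥0∞} (hw : Measurable (Function.uncurry w))
    {u v : X → ℝ} (hu : Measurable u) :
    wEnergy p μ w (u + v) ≤ 2 ^ p * (wEnergy p μ w u + wEnergy p μ w v) := by
  have hm : Measurable fun z : X × X => ‖u z.1 - u z.2‖ₑ ^ p * w z.1 z.2 :=
    (measurable_enorm_sub hu).mul hw
  have h2 := two_rpow_ne_top (p := p) (by linarith)
  unfold wEnergy
  rw [← lintegral_add_left hm.lintegral_prod_right, ← lintegral_const_mul' _ _ h2]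
  refine lintegral_mono fun x => ?_
  dsimp only
  have hmx : Measurable fun y => ‖u x - u y‖ₑ ^ p * w x y := hm.comp measurable_prodMk_left
  rw [← lintegral_add_left hmx, ← lintegral_const_mul' _ _ h2]
  refine lintegral_mono fun y => ?_
  dsimp only
  rw [← add_mul, ← mul_assoc, Pi.add_apply, Pi.add_apply, add_sub_add_comm]
  gcongr
  exact enorm_add_rpow_le hp _ _

/-- Schur test: the energy of a weight with bounded marginals is controlled by the `L^p` norm. -/
lemma wEnergy_le_pnorm (hp : 1 ≤ p) {w : X → X → ℝ≥0∞} (hw : Measurable (Function.uncurry w))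
    {c : ℝ≥0∞} (h₁ : ∀ x, ∫⁻ y, w x y ∂μ ≤ c) (h₂ : ∀ y, ∫⁻ x, w x y ∂μ ≤ c) {v : X → ℝ}
    (hv : Measurable v) : wEnergy p μ w v ≤ 2 ^ p * 2 * c * pnorm p μ v := by
  have h2 := two_rpow_ne_top (p := p) (by linarith)
  have hm1 : Measurable fun z : X × X => ‖v z.1‖ₑ ^ p * w z.1 z.2 :=
    ((hv.comp measurable_fst).enorm.pow_const p).mul hw
  have hm2 : Measurable fun z : X × X => ‖v z.2‖ₑ ^ p * w z.1 z.2 :=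
    ((hv.comp measurable_snd).enorm.pow_const p).mul hw
  have hv' : Measurable fun x => ‖v x‖ₑ ^ p := hv.enorm.pow_const p
  have e1 : ∫⁻ x, ∫⁻ y, ‖v x‖ₑ ^ p * w x y ∂μ ∂μ ≤ c * pnorm p μ v := by
    rw [pnorm, ← lintegral_const_mul _ hv']
    refine lintegral_mono fun x => ?_
    have hwx : Measurable (w x) := hw.comp measurable_prodMk_left
    dsimp only
    rw [lintegral_const_mul _ hwx, mul_comm]
    gcongr
    exact h₁ x
  have e2 : ∫⁻ x, ∫⁻ y, ‖v y‖ₑ ^ p * w x y ∂μ ∂μ ≤ c * pnorm p μ v := by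
    rw [lintegral_lintegral_swap hm2.aemeasurable, pnorm, ← lintegral_const_mul _ hv']
    refine lintegral_mono fun y => ?_
    have hwy : Measurable fun x => w x y := hw.comp measurable_prodMk_right
    dsimp only
    rw [lintegral_const_mul _ hwy, mul_comm]
    gcongr
    exact h₂ y
  calc wEnergy p μ w v
      ≤ 2 ^ p * (∫⁻ x, ∫⁻ y, ‖v x‖ₑ ^ p * w x y ∂μ ∂μ
          + ∫⁻ x, ∫⁻ y, ‖v y‖ₑ ^ p * w x y ∂μ ∂μ) := by
        unfold wEnergy
        rw [← lintegral_add_left hm1.lintegral_prod_right, ← lintegral_const_mul' _ _ h2]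
        refine lintegral_mono fun x => ?_
        dsimp only
        have hmx : Measurable fun y => ‖v x‖ₑ ^ p * w x y := hm1.comp measurable_prodMk_left
        rw [← lintegral_add_left hmx, ← lintegral_const_mul' _ _ h2]
        refine lintegral_mono fun y => ?_
        dsimp only
        rw [← add_mul, ← mul_assoc]
        gcongr
        have := enorm_add_rpow_le hp (v x) (-v y)
        rwa [enorm_neg, ← sub_eq_add_neg] at this
    _ ≤ 2 ^ p * (c * pnorm p μ v + c * pnorm p μ v) := by gcongr
    _ = _ := by ring

end weighted

/-! ### Tail estimates for stable kernels -/

section tail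

variable {X : Type*} [MetricSpace X] [ProperSpace X] [MeasurableSpace X] [BorelSpace X]
  {μ : Measure X} [IsFiniteMeasureOnCompacts μ] [μ.IsOpenPosMeasure] {p : ℝ} {Υ : ℝ → ℝ}

/-- The kernel as an extended nonnegative function. -/
noncomputable def StableKernel.k (κ : StableKernel μ Υ) (x y : X) : ℝ≥0∞ :=
  ENNReal.ofReal (κ.K x y)

lemma StableKernel.measurable_k (κ : StableKernel μ Υ) : Measurable (Function.uncurry κ.k) :=
  κ.measurable.ennreal_ofReal

lemma jumpEnergy_eq_wEnergy (κ : StableKernel μ Υ) (v : X → ℝ) :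
    jumpEnergy p μ κ.K v = wEnergy p μ κ.k v := rfl

/-- The kernel at scale `t`, from above. -/
lemma StableKernel.exists_le (κ : StableKernel μ Υ) (hΥ : IsDoublingFunction Υ)
    (hV : VolumeDoubling μ) (Λ : ℝ) : ∃ C > (0 : ℝ), ∀ (x y : X) (t : ℝ), 0 < t → x ≠ y →
      t ≤ Λ * dist x y → κ.K x y ≤ C / (vol μ x t * Υ t) := by
  obtain ⟨C₁, -, C₂, hC₂, hK⟩ := κ.bounds
  obtain ⟨C₃, hC₃, h₃⟩ := hΥ.exists_le Λ
  obtain ⟨C₄, hC₄, h₄⟩ := hV.exists_le Λ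
  refine ⟨C₂ * (C₄ * C₃), by positivity, fun x y t ht hxy hle => ?_⟩
  have hd : 0 < dist x y := dist_pos.2 hxy
  have v1 := vol_pos (μ := μ) x ht
  have v2 := vol_pos (μ := μ) x hd
  have y1 := hΥ.pos ht
  have y2 := hΥ.pos hd
  refine (hK x y hxy).2.trans ?_
  rw [div_le_div_iff₀ (by positivity) (by positivity)]
  have h : vol μ x t * Υ t ≤ (C₄ * vol μ x (dist x y)) * (C₃ * Υ (dist x y)) := by
    gcongr
    · exact h₄ x x _ _ hd (by simpa using hle)
    · exact h₃ _ _ hd ht hle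
  calc C₂ * (vol μ x t * Υ t) ≤ C₂ * ((C₄ * vol μ x (dist x y)) * (C₃ * Υ (dist x y))) := by gcongr
    _ = _ := by ring

/-- The kernel at scale `t`, from below. -/
lemma StableKernel.exists_ge (κ : StableKernel μ Υ) (hΥ : IsDoublingFunction Υ)
    (hV : VolumeDoubling μ) (Λ : ℝ) : ∃ C > (0 : ℝ), ∀ (x y : X) (t : ℝ), 0 < t → x ≠ y →
      dist x y ≤ Λ * t → 1 / (vol μ x t * Υ t) ≤ C * κ.K x y := by
  obtain ⟨C₁, hC₁, C₂, -, hK⟩ := κ.bounds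
  obtain ⟨C₃, hC₃, h₃⟩ := hΥ.exists_le Λ
  obtain ⟨C₄, hC₄, h₄⟩ := hV.exists_le Λ
  refine ⟨C₄ * C₃ / C₁, by positivity, fun x y t ht hxy hle => ?_⟩
  have hd : 0 < dist x y := dist_pos.2 hxy
  have v1 := vol_pos (μ := μ) x ht
  have v2 := vol_pos (μ := μ) x hd
  have y1 := hΥ.pos ht
  have y2 := hΥ.pos hd
  calc 1 / (vol μ x t * Υ t) ≤ C₄ * C₃ / C₁ * (C₁ / (vol μ x (dist x y) * Υ (dist x y))) := by
        have : C₄ * C₃ / C₁ * (C₁ / (vol μ x (dist x y) * Υ (dist x y)))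
          = C₄ * C₃ / (vol μ x (dist x y) * Υ (dist x y)) := by field_simp
        rw [this, div_le_div_iff₀ (by positivity) (by positivity), one_mul]
        calc vol μ x (dist x y) * Υ (dist x y) ≤ (C₄ * vol μ x t) * (C₃ * Υ t) := by
              gcongr
              · exact h₄ x x _ _ ht (by simpa using hle)
              · exact h₃ _ _ ht hd hle
          _ = _ := by ring
    _ ≤ _ := by gcongr; exact (hK x y hxy).1

/-- Integrals of the kernel away from the diagonal, against Hölder weights of small exponent. -/
lemma StableKernel.exists_tail (κ : StableKernel μ Υ) (hΥ : IsDoublingFunction Υ)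
    (hV : VolumeDoubling μ) : ∃ β > (0 : ℝ), ∀ γ, 0 ≤ γ → γ < β → ∃ C > (0 : ℝ),
      ∀ (x : X) (r s : ℝ), 0 < r → 0 < s →
        ∫⁻ y in (ball x s)ᶜ, ENNReal.ofReal (min (dist x y / r) 1 ^ γ) * κ.k x y ∂μ
          ≤ ENNReal.ofReal (C * min (s / r) 1 ^ γ / Υ s) := by
  obtain ⟨C₁, hC₁, β, hβ, hlow⟩ := hΥ.exists_lower
  obtain ⟨C₂, hC₂, hK⟩ := κ.exists_le hΥ hV 1
  obtain ⟨C₃, hC₃, hvol⟩ := hV.exists_le 2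
  refine ⟨β, hβ, fun γ hγ hγβ => ?_⟩
  -- On the annulus `2^n s ≤ d < 2^(n+1) s` the Hölder weight gains at most a multiple of `2^(nγ)`
  -- and `1/Υ` loses `2^(nβ)`. The contributions are geometric with ratio `q < 1` because `γ < β`.
  set q : ℝ := 2 ^ (γ - β) with hq
  have hq0 : 0 < q := by positivity
  have hq1 : q < 1 := Real.rpow_lt_one_of_one_lt_of_neg one_lt_two (by linarith)
  refine ⟨2 ^ γ * C₂ * C₁ * C₃ * (1 - q)⁻¹, by have := sub_pos.2 hq1; positivity,
    fun x r s hr hs => ?_⟩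
  set m := min (s / r) 1 with hm
  have hm0 : 0 < m := lt_min (by positivity) one_pos
  set M := 2 ^ γ * C₂ * C₁ * C₃ * m ^ γ / Υ s with hM
  have hYs := hΥ.pos hs
  have hM0 : 0 < M := by positivity
  let A : ℕ → Set X := fun n => ball x (2 ^ (n + 1) * s) \ ball x (2 ^ n * s)
  have hcov : (ball x s)ᶜ ⊆ ⋃ n, A n := by
    intro y hy
    simp only [Set.mem_compl_iff, mem_ball, not_lt] at hy
    obtain ⟨n, hn⟩ := exists_nat_pow_near (x := dist y x / s) (y := (2 : ℝ))
      ((one_le_div hs).2 hy) one_lt_two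
    rw [le_div_iff₀ hs, div_lt_iff₀ hs] at hn
    exact Set.mem_iUnion.2 ⟨n, hn.2, by simpa using hn.1⟩
  have hA : ∀ n, ∫⁻ y in A n, ENNReal.ofReal (min (dist x y / r) 1 ^ γ) * κ.k x y ∂μ
      ≤ ENNReal.ofReal (M * q ^ n) := by
    intro n
    have ht : 0 < 2 ^ n * s := by positivity
    have hvt := vol_pos (μ := μ) x ht
    have hYt := hΥ.pos ht
    set B := (2 ^ (n + 1) * m) ^ γ * (C₂ / (vol μ x (2 ^ n * s) * Υ (2 ^ n * s))) with hB
    have hptw : ∀ y ∈ A n, ENNReal.ofReal (min (dist x y / r) 1 ^ γ) * κ.k x y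
        ≤ ENNReal.ofReal B := by
      rintro y ⟨hy1, hy2⟩
      rw [mem_ball'] at hy1 hy2
      rw [not_lt] at hy2
      have hd : 0 < dist x y := ht.trans_le hy2
      rw [StableKernel.k, ← ENNReal.ofReal_mul (by positivity)]
      -- Nonnegativity of `K` off the diagonal comes from its lower bound.
      refine ENNReal.ofReal_le_ofReal (mul_le_mul ?_ (hK x y _ ht (dist_pos.1 hd) (by simpa))
        (le_trans ?_ ((κ.bounds.choose_spec.2.choose_spec.2 x y (dist_pos.1 hd)).1))
        (by positivity))
      · refine Real.rpow_le_rpow (by positivity) ?_ hγ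
        have h2 : (1 : ℝ) ≤ 2 ^ (n + 1) := one_le_pow₀ one_le_two
        rw [hm, mul_min_of_nonneg _ _ (by positivity)]
        refine min_le_min ?_ (by linarith)
        rw [← mul_div_assoc]
        gcongr
      · have := κ.bounds.choose_spec.1
        have := vol_pos (μ := μ) x hd
        have := hΥ.pos hd
        positivity
    calc _ ≤ ∫⁻ y in A n, ENNReal.ofReal B ∂μ :=
          setLIntegral_mono' (measurableSet_ball.diff measurableSet_ball) hptw
      _ = ENNReal.ofReal B * μ (A n) := by rw [setLIntegral_const]
      _ ≤ ENNReal.ofReal B * μ (ball x (2 ^ (n + 1) * s)) := by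
          gcongr; exact Set.sdiff_subset
      _ = ENNReal.ofReal (B * vol μ x (2 ^ (n + 1) * s)) := by
          rw [← ofReal_vol, ← ENNReal.ofReal_mul (by positivity)]
      _ ≤ ENNReal.ofReal (M * q ^ n) := by
          refine ENNReal.ofReal_le_ofReal ?_
          have hv2 : vol μ x (2 ^ (n + 1) * s) ≤ C₃ * vol μ x (2 ^ n * s) :=
            hvol x x _ _ ht (by rw [dist_self]; apply le_of_eq; ring)
          have hY2 : ((2 : ℝ) ^ n) ^ β * Υ s ≤ C₁ * Υ (2 ^ n * s) := by
            have := hlow s (2 ^ n * s) hs (le_mul_of_one_le_left hs.le (one_le_pow₀ one_le_two))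
            rwa [mul_div_cancel_right₀ _ hs.ne'] at this
          have hqn : q ^ n = ((2 : ℝ) ^ n) ^ γ / ((2 : ℝ) ^ n) ^ β := by
            rw [hq, ← Real.rpow_natCast, ← Real.rpow_mul zero_le_two, mul_comm,
              Real.rpow_mul zero_le_two, Real.rpow_natCast, Real.rpow_sub (by positivity)]
          have h2n : (0 : ℝ) < 2 ^ n := by positivity
          calc B * vol μ x (2 ^ (n + 1) * s) ≤ B * (C₃ * vol μ x (2 ^ n * s)) := by gcongr
            _ = 2 ^ γ * (2 ^ n) ^ γ * m ^ γ * C₂ * C₃ * (1 / Υ (2 ^ n * s)) := by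
                rw [hB, pow_succ, Real.mul_rpow (by positivity) hm0.le,
                  Real.mul_rpow (by positivity) zero_le_two]
                field_simp
            _ ≤ 2 ^ γ * (2 ^ n) ^ γ * m ^ γ * C₂ * C₃ * (C₁ / ((2 ^ n) ^ β * Υ s)) := by
                refine mul_le_mul_of_nonneg_left ?_ (by positivity)
                rw [div_le_div_iff₀ hYt (by positivity), one_mul]
                exact hY2
            _ = M * q ^ n := by
                rw [hqn, hM]
                have : ((2 : ℝ) ^ n) ^ β ≠ 0 := by positivity
                field_simp
  calc _ ≤ ∫⁻ y in ⋃ n, A n, ENNReal.ofReal (min (dist x y / r) 1 ^ γ) * κ.k x y ∂μ :=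
        lintegral_mono_set hcov
    _ ≤ ∑' n, ∫⁻ y in A n, ENNReal.ofReal (min (dist x y / r) 1 ^ γ) * κ.k x y ∂μ :=
        lintegral_iUnion_le _ _
    _ ≤ ∑' n, ENNReal.ofReal (M * q ^ n) := ENNReal.tsum_le_tsum hA
    _ = ENNReal.ofReal (M * (1 - q)⁻¹) := by
        rw [← ENNReal.ofReal_tsum_of_nonneg (fun n => by positivity)
          ((summable_geometric_of_lt_one hq0.le hq1).mul_left M), tsum_mul_left,
          tsum_geometric_of_lt_one hq0.le hq1]
    _ = _ := by congr 1; rw [hM]; ring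

/-- The part of the kernel within distance `ε` of the diagonal. -/
noncomputable def StableKernel.near (κ : StableKernel μ Υ) (ε : ℝ) (x y : X) : ℝ≥0∞ :=
  (ball x ε).indicator (κ.k x) y

lemma measurable_indicator_ball {w : X → X → ℝ≥0∞} (hw : Measurable (Function.uncurry w)) (ε : ℝ) :
    Measurable (Function.uncurry fun x y => (ball x ε).indicator (w x) y) := by
  have hs : MeasurableSet {z : X × X | dist z.2 z.1 < ε} :=
    measurableSet_lt (measurable_snd.dist measurable_fst) measurable_const
  exact hw.indicator hs

lemma StableKernel.measurable_near (κ : StableKernel μ Υ) (ε : ℝ) :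
    Measurable (Function.uncurry (κ.near ε)) := measurable_indicator_ball κ.measurable_k ε

/-- The energy is controlled by its near-diagonal part and the `L^p` norm. -/
lemma StableKernel.exists_energy_le (κ : StableKernel μ Υ) (hΥ : IsDoublingFunction Υ)
    (hV : VolumeDoubling μ) (hp : 1 ≤ p) : ∃ C > (0 : ℝ), ∀ ε > (0 : ℝ), ∀ v : X → ℝ,
      Measurable v → jumpEnergy p μ κ.K v
        ≤ wEnergy p μ (κ.near ε) v + ENNReal.ofReal (C / Υ ε) * pnorm p μ v := by
  obtain ⟨β, hβ, ht⟩ := κ.exists_tail hΥ hV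
  -- With exponent `0` the tail estimate bounds one marginal of the far part by `C / Υ ε`; symmetry
  -- gives the other, and the Schur test `wEnergy_le_pnorm` applies.
  obtain ⟨C, hC, hT⟩ := ht 0 le_rfl hβ
  refine ⟨2 ^ p * 2 * C, by positivity, fun ε hε v hv => ?_⟩
  let far : X → X → ℝ≥0∞ := fun x y => (ball x ε)ᶜ.indicator (κ.k x) y
  have hfar : Measurable (Function.uncurry far) := by
    have hs : MeasurableSet {z : X × X | dist z.2 z.1 < ε} :=
      measurableSet_lt (measurable_snd.dist measurable_fst) measurable_const
    exact κ.measurable_k.indicator hs.compl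
  have h1 : ∀ x, ∫⁻ y, far x y ∂μ ≤ ENNReal.ofReal (C / Υ ε) := fun x => by
    have := hT x ε ε hε hε
    simp only [Real.rpow_zero, ENNReal.ofReal_one, one_mul, mul_one] at this
    rwa [← lintegral_indicator measurableSet_ball.compl] at this
  have hsymm : ∀ x y, far x y = far y x := by
    intro x y
    by_cases h : dist x y < ε
    · have h' : dist y x < ε := by rwa [dist_comm]
      simp [far, h, h']
    · have h' : ¬ dist y x < ε := by rwa [dist_comm]
      have hxy : x ≠ y := by
        rintro rfl
        rw [dist_self] at h; exact h hε
      simp [far, h, h', StableKernel.k, κ.symm x y hxy]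
  have h2 : ∀ y, ∫⁻ x, far x y ∂μ ≤ ENNReal.ofReal (C / Υ ε) := fun y => by
    simpa only [hsymm _ y] using h1 y
  calc jumpEnergy p μ κ.K v ≤ wEnergy p μ (κ.near ε) v + wEnergy p μ far v := by
        rw [jumpEnergy_eq_wEnergy]
        refine wEnergy_add_weight (κ.measurable_near ε) (fun x y => ?_) hv
        simp only [StableKernel.near, far]
        by_cases h : y ∈ ball x ε <;> simp [h]
    _ ≤ _ := by
        gcongr
        refine (wEnergy_le_pnorm hp hfar h1 h2 hv).trans (le_of_eq ?_)
        rw [mul_div_assoc, ENNReal.ofReal_mul (p := 2 ^ p * 2) (by positivity),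
          ENNReal.ofReal_mul (by positivity),
          ← ENNReal.ofReal_rpow_of_nonneg zero_le_two (by linarith)]
        simp

end tail

/-! ### From near-diagonal bounds to the cutoff energy inequality -/

section cutoff

variable {X : Type*} [MetricSpace X] [ProperSpace X] [MeasurableSpace X] [BorelSpace X]
  {μ : Measure X} [IsFiniteMeasureOnCompacts μ] [μ.IsOpenPosMeasure] {p : ℝ} {Υ : ℝ → ℝ}

lemma continuous_of_holder {φ : X → ℝ} {C r δ : ℝ} (hδ : 0 < δ)
    (h : ∀ x y : X, |φ x - φ y| ≤ C * min (dist x y / r) 1 ^ δ) : Continuous φ := by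
  refine continuous_iff_continuousAt.2 fun x => tendsto_iff_dist_tendsto_zero.2 ?_
  have hc : Continuous fun y : X => C * min (dist y x / r) 1 ^ δ := by
    refine continuous_const.mul (Continuous.rpow_const ?_ fun _ => Or.inr hδ.le)
    exact ((continuous_id.dist continuous_const).div_const r).min continuous_const
  have h0 := hc.tendsto x
  rw [dist_self, zero_div, min_eq_left zero_le_one, Real.zero_rpow hδ.ne', mul_zero] at h0
  exact squeeze_zero (fun _ => dist_nonneg) (fun y => h y x) h0

/-- Full support of `μ` upgrades a.e. statements about a continuous `φ` to pointwise ones: an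
exceptional open set that is nonempty would have positive measure. The next two lemmas rest on the
same principle. -/
lemma IsCutoff.mem_Icc {φ : X → ℝ} {U V : Set X} (h : IsCutoff μ φ U V) (hφ : Continuous φ)
    (x : X) : φ x ∈ Set.Icc 0 1 := by
  have hcl : IsClosed (φ ⁻¹' Set.Icc 0 1) := isClosed_Icc.preimage hφ
  have : φ ⁻¹' Set.Icc 0 1 = Set.univ := by
    by_contra hne
    have := hcl.isOpen_compl.measure_pos μ (Set.nonempty_compl.2 hne)
    exact this.ne' h.bounds
  exact (this ▸ Set.mem_univ x : x ∈ φ ⁻¹' Set.Icc 0 1)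

lemma IsCutoff.eq_one_of_mem {φ : X → ℝ} {U V : Set X} (h : IsCutoff μ φ U V)
    (hφ : Continuous φ) {x : X} (hx : x ∈ U) : φ x = 1 := by
  obtain ⟨W, hW, hUW, hae⟩ := h.eq_one
  have := Measure.eqOn_open_of_ae_eq ((ae_restrict_iff' hW.measurableSet).2 hae) hW
    hφ.continuousOn (continuousOn_const (c := (1 : ℝ)))
  exact this (hUW (subset_closure hx))

lemma IsCutoff.eq_zero_of_notMem {φ : X → ℝ} {U V : Set X} (h : IsCutoff μ φ U V)
    (hφ : Continuous φ) {x : X} (hx : x ∉ V) : φ x = 0 := by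
  have hO : IsOpen (essSupport μ φ)ᶜ := Measure.isOpen_compl_support
  have h0 : (μ.withDensity fun x => ‖φ x‖ₑ) (essSupport μ φ)ᶜ = 0 := Measure.measure_compl_support
  rw [withDensity_apply _ hO.measurableSet, lintegral_eq_zero_iff hφ.measurable.enorm] at h0
  have h1 : φ =ᵐ[μ.restrict (essSupport μ φ)ᶜ] fun _ => 0 := by
    filter_upwards [h0] with z hz
    simpa using hz
  exact Measure.eqOn_open_of_ae_eq h1 hO hφ.continuousOn continuousOn_const
    fun hx' => hx (h.support_subset hx')

lemma wEnergy_near (κ : StableKernel μ Υ) (ε : ℝ) (v : X → ℝ) :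
    wEnergy p μ (κ.near ε) v = ∫⁻ x, ∫⁻ y in ball x ε, ‖v x - v y‖ₑ ^ p * κ.k x y ∂μ ∂μ := by
  refine lintegral_congr fun x => ?_
  rw [← lintegral_indicator measurableSet_ball]
  refine lintegral_congr fun y => ?_
  by_cases h : y ∈ ball x ε <;> simp [StableKernel.near, h]

lemma jumpEnergyMeasure_ball (κ : StableKernel μ Υ) (v : X → ℝ) (x : X) (s : ℝ) :
    jumpEnergyMeasure p μ κ.K Set.univ v (ball x s)
      = ∫⁻ y in ball x s, ∫⁻ z, ‖v y - v z‖ₑ ^ p * κ.k y z ∂μ ∂μ := by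
  rw [jumpEnergyMeasure, withDensity_apply _ measurableSet_ball, Measure.restrict_univ]
  rfl

/-- Hölder continuous cutoff functions whose near-diagonal energy satisfies the strong cutoff
energy bound. -/
def HasNearCutoffs (p : ℝ) (κ : StableKernel μ Υ) : Prop :=
  ∃ δ ∈ Set.Ioo (0 : ℝ) 1, ∃ A > (1 : ℝ), ∃ C > (0 : ℝ), ∀ (x₀ : X) (r : ℝ), 0 < r →
    ∃ φ : X → ℝ, MemLp φ (ENNReal.ofReal p) μ ∧ IsCutoff μ φ (ball x₀ r) (ball x₀ (A * r)) ∧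
      (∀ x y : X, |φ x - φ y| ≤ C * min (dist x y / r) 1 ^ δ) ∧
      ∀ (x : X) (s : ℝ), 0 < s → s ≤ r →
        ∫⁻ y in ball x s, ∫⁻ z in ball y s, ‖φ y - φ z‖ₑ ^ p * κ.k y z ∂μ ∂μ
          ≤ ENNReal.ofReal (C * (s / r) ^ δ * (vol μ x s / Υ s))

/-- The far part of the energy density of a Hölder continuous function. -/
lemma lintegral_compl_ball_le (hp : 1 ≤ p) (κ : StableKernel μ Υ) {φ : X → ℝ}
    {C δ γ r s T : ℝ} (hC : 0 < C) (hγ : 0 ≤ γ) (hγδ : γ ≤ δ) (hr : 0 < r)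
    (hφ : ∀ x y : X, |φ x - φ y| ≤ C * min (dist x y / r) 1 ^ δ) {y : X}
    (hT : ∫⁻ z in (ball y s)ᶜ, ENNReal.ofReal (min (dist y z / r) 1 ^ γ) * κ.k y z ∂μ
      ≤ ENNReal.ofReal T) :
    ∫⁻ z in (ball y s)ᶜ, ‖φ y - φ z‖ₑ ^ p * κ.k y z ∂μ ≤ ENNReal.ofReal (C ^ p * T) := by
  rw [ENNReal.ofReal_mul (by positivity)]
  refine le_trans ?_ (mul_le_mul_right hT _)
  rw [← lintegral_const_mul' _ _ ENNReal.ofReal_ne_top]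
  refine lintegral_mono fun z => ?_
  dsimp only
  rw [← mul_assoc]
  gcongr
  have hm : 0 ≤ min (dist y z / r) 1 := le_min (by positivity) zero_le_one
  rw [enorm_rpow_eq_ofReal (by linarith), ← ENNReal.ofReal_mul (by positivity)]
  refine ENNReal.ofReal_le_ofReal ?_
  calc |φ y - φ z| ^ p ≤ (C * min (dist y z / r) 1 ^ δ) ^ p :=
        Real.rpow_le_rpow (abs_nonneg _) (hφ y z) (by linarith)
    _ = C ^ p * min (dist y z / r) 1 ^ (δ * p) := by
        rw [Real.mul_rpow hC.le (by positivity), ← Real.rpow_mul hm]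
    _ ≤ C ^ p * min (dist y z / r) 1 ^ γ := by
        refine mul_le_mul_of_nonneg_left ?_ (by positivity)
        exact Real.rpow_le_rpow_of_exponent_ge' hm (min_le_right _ _) hγ (by nlinarith)

/-- Long jumps cost only the Hölder bound together with the kernel tail, so the short-range estimate
is the entire content of the cutoff inequality. The price is a possibly smaller exponent. -/
lemma HasNearCutoffs.nonlocalCEStrong {hp : 1 < p} {κ : StableKernel μ Υ}
    (hΥ : IsDoublingFunction Υ) (hV : VolumeDoubling μ) (h : HasNearCutoffs p κ) :
    NonlocalCEStrong hp κ := by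
  obtain ⟨δ, hδ, A, hA, C, hC, hcut⟩ := h
  obtain ⟨β, hβ, htail⟩ := κ.exists_tail hΥ hV
  -- `γ ≤ δ` lets the Hölder bound of `φ` dominate the weight; `γ < β` makes the tail converge.
  set γ := min δ (β / 2) with hγ
  have hγ0 : 0 < γ := lt_min hδ.1 (by positivity)
  have hγδ : γ ≤ δ := min_le_left _ _
  obtain ⟨T, hT0, hT⟩ := htail γ hγ0.le (lt_of_le_of_lt (min_le_right _ _) (by linarith))
  obtain ⟨N, hN⟩ := hV.exists_overlap 1
  obtain ⟨D, hD0, hD⟩ := hV.exists_le 2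
  obtain ⟨E, hE0, hE⟩ := κ.exists_energy_le hΥ hV hp.le
  set M := C + C ^ p * T with hM
  have hM0 : 0 < M := by positivity
  refine ⟨γ, ⟨hγ0, lt_of_le_of_lt hγδ hδ.2⟩, A, hA, C + M + M * N * D, by positivity,
    fun x₀ r hr => ?_⟩
  obtain ⟨φ, hφm, hφc, hφh, hφe⟩ := hcut x₀ r hr
  have hcont := continuous_of_holder hδ.1 hφh
  have hYr := hΥ.pos hr
  have hsmall : ∀ (x : X) (s : ℝ), 0 < s → s ≤ r →
      jumpEnergyMeasure p μ κ.K Set.univ φ (ball x s)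
        ≤ ENNReal.ofReal (M * (s / r) ^ γ * (vol μ x s / Υ s)) := by
    intro x s hs hsr
    have hYs := hΥ.pos hs
    have hvs := vol_pos (μ := μ) x hs
    have hsr1 : s / r ≤ 1 := (div_le_one hr).2 hsr
    rw [jumpEnergyMeasure_ball]
    calc _ ≤ ∫⁻ y in ball x s, ((∫⁻ z in ball y s, ‖φ y - φ z‖ₑ ^ p * κ.k y z ∂μ)
            + ENNReal.ofReal (C ^ p * (T * min (s / r) 1 ^ γ / Υ s))) ∂μ := by
          refine lintegral_mono fun y => ?_
          dsimp only
          rw [← lintegral_add_compl _ (measurableSet_ball (x := y) (ε := s))]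
          gcongr
          exact lintegral_compl_ball_le hp.le κ hC hγ0.le hγδ hr hφh (hT y r s hr hs)
      _ ≤ ENNReal.ofReal (C * (s / r) ^ δ * (vol μ x s / Υ s))
            + ENNReal.ofReal (C ^ p * (T * min (s / r) 1 ^ γ / Υ s)) * ENNReal.ofReal (vol μ x s) := by
          rw [lintegral_add_right _ measurable_const, setLIntegral_const, ofReal_vol]
          gcongr
          exact hφe x s hs hsr
      _ ≤ _ := by
          rw [← ENNReal.ofReal_mul (by positivity), ← ENNReal.ofReal_add (by positivity)
            (by positivity)]
          refine ENNReal.ofReal_le_ofReal ?_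
          rw [min_eq_left hsr1]
          have h1 : (s / r) ^ δ ≤ (s / r) ^ γ :=
            Real.rpow_le_rpow_of_exponent_ge (by positivity) hsr1 hγδ
          calc _ ≤ C * (s / r) ^ γ * (vol μ x s / Υ s)
                + C ^ p * (T * (s / r) ^ γ / Υ s) * vol μ x s := by gcongr
            _ = _ := by rw [hM]; ring
  -- Beyond scale `r` the bound grows like volume: `B(x,s)` is covered by balls of radius `r` with
  -- bounded overlap, and `hsmall` at `s = r` applies to each.
  have hlarge : ∀ (x : X) (s : ℝ), r < s →
      jumpEnergyMeasure p μ κ.K Set.univ φ (ball x s)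
        ≤ ENNReal.ofReal (M * N * D * (vol μ x s / Υ r)) := by
    intro x s hs
    obtain ⟨J, hJ, hJx, hJc⟩ := hV.exists_net x s hr
    have hs0 := hr.trans hs
    calc jumpEnergyMeasure p μ κ.K Set.univ φ (ball x s)
        = ∫⁻ y in ball x s, 1 ∂(jumpEnergyMeasure p μ κ.K Set.univ φ) := by simp
      _ ≤ ∑ j ∈ J, ∫⁻ y in ball j r, 1 ∂(jumpEnergyMeasure p μ κ.K Set.univ φ) :=
          lintegral_le_sum_ball (fun y hy => hJc y hy) _
      _ ≤ ∑ j ∈ J, ENNReal.ofReal (M / Υ r) * ∫⁻ y in ball j (1 * r), 1 ∂μ := by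
          refine Finset.sum_le_sum fun j _ => ?_
          rw [setLIntegral_one, setLIntegral_one, one_mul, ← ofReal_vol (μ := μ),
            ← ENNReal.ofReal_mul (by positivity)]
          refine (hsmall j r hr le_rfl).trans (le_of_eq ?_)
          rw [div_self hr.ne', Real.one_rpow]
          congr 1; ring
      _ ≤ ENNReal.ofReal (M / Υ r) * (N * ∫⁻ y in ball x (2 * s), 1 ∂μ) := by
          rw [← Finset.mul_sum]
          gcongr
          refine hN r J hr hJ μ _ (fun j hj => ball_subset_ball' ?_) _
          have := hJx j hj
          linarith
      _ = ENNReal.ofReal (M / Υ r * (N * vol μ x (2 * s))) := by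
          rw [setLIntegral_one, ← ofReal_vol, ENNReal.ofReal_mul (by positivity),
            ENNReal.ofReal_mul (by positivity), ENNReal.ofReal_natCast]
      _ ≤ _ := by
          refine ENNReal.ofReal_le_ofReal ?_
          have := hD x x (2 * s) s hs0 (by simp)
          calc M / Υ r * (N * vol μ x (2 * s)) ≤ M / Υ r * (N * (D * vol μ x s)) := by gcongr
            _ = _ := by ring
  -- Far jumps are bounded by the `L^p` norm. Jumps shorter than `r` from a point outside `B(x₀,
  -- (A+1)r)` join two zeros of `φ`, so the near part lives on a ball covered by `hlarge`.
  have hdom : jumpEnergy p μ κ.K φ ≠ ∞ := by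
    refine ne_top_of_le_ne_top (ENNReal.add_ne_top.2 ⟨?_, ENNReal.mul_ne_top ENNReal.ofReal_ne_top
      ((memLp_iff_pnorm (by linarith) φ).1 hφm).2⟩) (hE r hr φ hcont.measurable)
    have hb : r < (A + 1) * r := by nlinarith
    refine ne_top_of_le_ne_top ENNReal.ofReal_ne_top (le_trans ?_ (hlarge x₀ ((A + 1) * r) hb))
    rw [wEnergy_near, jumpEnergyMeasure_ball, ← lintegral_indicator measurableSet_ball]
    refine lintegral_mono fun x => ?_
    by_cases hx : x ∈ ball x₀ ((A + 1) * r)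
    · rw [Set.indicator_of_mem hx]
      exact setLIntegral_le_lintegral _ _
    · rw [Set.indicator_of_notMem hx, nonpos_iff_eq_zero]
      refine setLIntegral_eq_zero measurableSet_ball fun y hy => ?_
      rw [mem_ball, not_lt] at hx
      rw [mem_ball'] at hy
      have h1 : φ x = 0 := hφc.eq_zero_of_notMem hcont (by
        rw [mem_ball, not_lt]; nlinarith)
      have h2 : φ y = 0 := hφc.eq_zero_of_notMem hcont (by
        rw [mem_ball, not_lt]
        have := dist_triangle x y x₀
        nlinarith)
      have hp0 : 0 < p := by linarith
      simp [h1, h2, hp0]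
  refine ⟨φ, ⟨hφm, hdom⟩, hφc, fun x y => (hφh x y).trans ?_, fun x s hs => ?_⟩
  · have hm : 0 ≤ min (dist x y / r) 1 := le_min (by positivity) zero_le_one
    calc C * min (dist x y / r) 1 ^ δ ≤ C * min (dist x y / r) 1 ^ γ := by
          refine mul_le_mul_of_nonneg_left ?_ hC.le
          exact Real.rpow_le_rpow_of_exponent_ge' hm (min_le_right _ _) hγ0.le hγδ
      _ ≤ _ := by
          gcongr
          have : 0 ≤ M * N * D := by positivity
          linarith
  · have hvs := vol_pos (μ := μ) x hs
    rcases le_or_gt s r with hsr | hsr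
    · refine (hsmall x s hs hsr).trans (ENNReal.ofReal_le_ofReal ?_)
      have hYs := hΥ.pos hs
      rw [min_eq_left hsr, min_eq_left ((div_le_one hr).2 hsr)]
      gcongr
      have : 0 ≤ M * N * D := by positivity
      linarith
    · refine (hlarge x s hsr).trans (ENNReal.ofReal_le_ofReal ?_)
      rw [min_eq_right hsr.le, min_eq_right ((one_le_div hr).2 hsr.le), Real.one_rpow, mul_one]
      gcongr
      linarith

end cutoff

/-! ### Near-diagonal bounds from comparison of scaling functions -/

section transfer

variable {X : Type*} [MetricSpace X] [ProperSpace X] [MeasurableSpace X] [BorelSpace X]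
  {μ : Measure X} [IsFiniteMeasureOnCompacts μ] [μ.IsOpenPosMeasure] {p : ℝ} {Ψ Υ : ℝ → ℝ}

/-- `UpperGrowth` between `d < s` and `s` reads `1/Υ(d) ≤ G (Ψ(s)/Υ(s)) / Ψ(d)`. Hence below
distance `s` the kernel `κ` is at most a multiple of `Ψ(s)/Υ(s)` times `η`, and the same factor
turns `V/Ψ(s)` into `V/Υ(s)`. -/
lemma hasNearCutoffs_of_upperGrowth {hp : 1 < p} {η : StableKernel μ Ψ} (κ : StableKernel μ Υ)
    (hΨ : IsDoublingFunction Ψ) (hΥ : IsDoublingFunction Υ) (hV : VolumeDoubling μ)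
    (hCE : NonlocalCEStrong hp η) (hUG : UpperGrowth Υ Ψ) : HasNearCutoffs p κ := by
  obtain ⟨δ, hδ, A, hA, C, hC, hcut⟩ := hCE
  obtain ⟨G, hG, hgrow⟩ := hUG
  obtain ⟨C₁, hC₁, hκ⟩ := κ.exists_le hΥ hV 1
  obtain ⟨C₂, hC₂, hη⟩ := η.exists_ge hΨ hV 1
  have hG0 : 0 < G := by linarith
  refine ⟨δ, hδ, A, hA, C + C₁ * G * C₂ * C, by positivity, fun x₀ r hr => ?_⟩
  obtain ⟨φ, hφd, hφc, hφh, hφe⟩ := hcut x₀ r hr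
  refine ⟨φ, hφd.1, hφc, fun x y => (hφh x y).trans ?_, fun x s hs hsr => ?_⟩
  · have hm : 0 ≤ min (dist x y / r) 1 := le_min (by positivity) zero_le_one
    refine mul_le_mul_of_nonneg_right ?_ (by positivity)
    have : 0 ≤ C₁ * G * C₂ * C := by positivity
    linarith
  have hYs := hΥ.pos hs
  have hPs := hΨ.pos hs
  have hvs := vol_pos (μ := μ) x hs
  have hK : ∀ y z : X, y ≠ z → dist y z < s →
      κ.K y z ≤ C₁ * G * C₂ * (Ψ s / Υ s) * η.K y z := by
    intro y z hyz hd
    have hd0 : 0 < dist y z := dist_pos.2 hyz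
    have hYd := hΥ.pos hd0
    have hPd := hΨ.pos hd0
    have hvd := vol_pos (μ := μ) y hd0
    have h1 := hκ y z _ hd0 hyz (by simp)
    have h2 := hη y z _ hd0 hyz (by simp)
    have h3 := hgrow _ s hd0 hd.le
    have h4 : 1 / Υ (dist y z) ≤ G * (Ψ s / Υ s) * (1 / Ψ (dist y z)) := by
      calc 1 / Υ (dist y z) = Υ s / Υ (dist y z) * (1 / Υ s) := by field_simp
        _ ≤ G * (Ψ s / Ψ (dist y z)) * (1 / Υ s) := by gcongr
        _ = _ := by ring
    calc κ.K y z ≤ C₁ * (1 / vol μ y (dist y z)) * (1 / Υ (dist y z)) := by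
          refine h1.trans (le_of_eq ?_)
          field_simp
      _ ≤ C₁ * (1 / vol μ y (dist y z)) * (G * (Ψ s / Υ s) * (1 / Ψ (dist y z))) := by gcongr
      _ = C₁ * G * (Ψ s / Υ s) * (1 / (vol μ y (dist y z) * Ψ (dist y z))) := by
          field_simp
      _ ≤ C₁ * G * (Ψ s / Υ s) * (C₂ * η.K y z) := by gcongr
      _ = _ := by ring
  calc ∫⁻ y in ball x s, ∫⁻ z in ball y s, ‖φ y - φ z‖ₑ ^ p * κ.k y z ∂μ ∂μ
      ≤ ∫⁻ y in ball x s, ENNReal.ofReal (C₁ * G * C₂ * (Ψ s / Υ s)) *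
          ∫⁻ z, ‖φ y - φ z‖ₑ ^ p * η.k y z ∂μ ∂μ := by
        refine lintegral_mono fun y => ?_
        dsimp only
        rw [← lintegral_const_mul' _ _ ENNReal.ofReal_ne_top]
        refine le_trans (setLIntegral_mono' measurableSet_ball fun z hz => ?_)
          (setLIntegral_le_lintegral (ball y s) _)
        rcases eq_or_ne y z with rfl | hyz
        · have : 0 < p := by linarith
          simp [this]
        · rw [mul_left_comm, StableKernel.k, StableKernel.k, ← ENNReal.ofReal_mul (by positivity)]
          gcongr
          exact hK y z hyz (mem_ball'.1 hz)
    _ = ENNReal.ofReal (C₁ * G * C₂ * (Ψ s / Υ s)) *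
          jumpEnergyMeasure p μ η.K Set.univ φ (ball x s) := by
        rw [jumpEnergyMeasure_ball, lintegral_const_mul' _ _ ENNReal.ofReal_ne_top]
    _ ≤ ENNReal.ofReal (C₁ * G * C₂ * (Ψ s / Υ s)) *
          ENNReal.ofReal (C * min (s / r) 1 ^ δ * (vol μ x s / Ψ (min s r))) := by
        gcongr
        exact hφe x s hs
    _ ≤ _ := by
        rw [← ENNReal.ofReal_mul (by positivity), min_eq_left hsr,
          min_eq_left ((div_le_one hr).2 hsr)]
        refine ENNReal.ofReal_le_ofReal ?_
        calc C₁ * G * C₂ * (Ψ s / Υ s) * (C * (s / r) ^ δ * (vol μ x s / Ψ s))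
            = C₁ * G * C₂ * C * (s / r) ^ δ * (vol μ x s / Υ s) := by field_simp
          _ ≤ _ := by
            gcongr
            linarith

/-- Double oscillation integrals over a set are controlled by deviations from a constant. -/
lemma lintegral_lintegral_sub_le (hp : 1 ≤ p) {φ : X → ℝ} (hφ : Measurable φ) (B : Set X) (c : ℝ) :
    ∫⁻ y in B, ∫⁻ z in B, ‖φ y - φ z‖ₑ ^ p ∂μ ∂μ
      ≤ 2 ^ p * 2 * μ B * ∫⁻ y in B, ‖φ y - c‖ₑ ^ p ∂μ := by
  have := wEnergy_le_pnorm (μ := μ.restrict B) hp (w := fun _ _ => 1) measurable_const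
    (c := μ B) (by simp) (by simp) (hφ.sub_const c)
  simpa [wEnergy, pnorm] using this

/-- The energy at distances in `(t/2, t]` from the Poincaré inequality. -/
lemma exists_annulus_le (hp : 1 < p) {F : Set (X → ℝ)} {Γ : (X → ℝ) → Measure X}
    (κ : StableKernel μ Υ) (hΨ : IsDoublingFunction Ψ) (hΥ : IsDoublingFunction Υ)
    (hV : VolumeDoubling μ) (hPI : PoincareInequality p μ F Γ Ψ) :
    ∃ C > (0 : ℝ), ∃ L ≥ (1 : ℝ), ∀ φ ∈ F, Measurable φ → ∀ (x : X) (s t : ℝ), 0 < t → t ≤ s →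
      ∫⁻ y in ball x s, ∫⁻ z, {q : X × X | t / 2 < dist q.1 q.2 ∧ dist q.1 q.2 ≤ t}.indicator
          (fun q => ‖φ q.1 - φ q.2‖ₑ ^ p * κ.k q.1 q.2) (y, z) ∂μ ∂μ
        ≤ ENNReal.ofReal (C * (Ψ t / Υ t)) * Γ φ (ball x (L * s)) := by
  obtain ⟨P, hP, A, hA, hPI⟩ := hPI
  obtain ⟨C₁, hC₁, hκ⟩ := κ.exists_le hΥ hV 2
  obtain ⟨C₂, hC₂, hvol⟩ := hV.exists_le 3
  obtain ⟨C₃, hC₃, hdb⟩ := hΨ.exists_le 2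
  obtain ⟨N, hN⟩ := hV.exists_overlap (2 * A)
  -- For `j ∈ B(x,s)` and `t ≤ s` the Poincaré balls `B(j, 2At)` lie in `B(x, (1+2A)s)`. Writing `N
  -- + 1` instead of `N` keeps the constant positive.
  refine ⟨C₁ * C₂ * (2 ^ p * 2) * (P * C₃) * (N + 1), by positivity, 1 + 2 * A, by linarith,
    fun φ hφ hφm x s t ht hts => ?_⟩
  have hYt := hΥ.pos ht
  have hPt := hΨ.pos ht
  obtain ⟨J, hJ, hJx, hJc⟩ := hV.exists_net x s ht
  -- If `y ∈ B(j,t)` and `d(y,z) ≤ t`, then `z ∈ B(j,2t)`. On this slice the kernel is at most a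
  -- multiple of `1/(V(j,2t) Υ t)`, so the Poincaré inequality on `B(j,2t)` applies.
  have hball : ∀ j : X, ∫⁻ y in ball j t, ∫⁻ z,
      {q : X × X | t / 2 < dist q.1 q.2 ∧ dist q.1 q.2 ≤ t}.indicator
        (fun q => ‖φ q.1 - φ q.2‖ₑ ^ p * κ.k q.1 q.2) (y, z) ∂μ ∂μ
      ≤ ENNReal.ofReal (C₁ * C₂ * (2 ^ p * 2) * (P * C₃) * (Ψ t / Υ t)) *
        ∫⁻ y in ball j (2 * A * t), 1 ∂(Γ φ) := by
    intro j
    have h2t : 0 < 2 * t := by positivity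
    have hv := vol_pos (μ := μ) j h2t
    have hin : ∀ y ∈ ball j t, ∫⁻ z,
        {q : X × X | t / 2 < dist q.1 q.2 ∧ dist q.1 q.2 ≤ t}.indicator
          (fun q => ‖φ q.1 - φ q.2‖ₑ ^ p * κ.k q.1 q.2) (y, z) ∂μ
        ≤ ENNReal.ofReal (C₁ * C₂ / (vol μ j (2 * t) * Υ t)) *
          ∫⁻ z in ball j (2 * t), ‖φ y - φ z‖ₑ ^ p ∂μ := by
      intro y hy
      rw [← lintegral_const_mul' _ _ ENNReal.ofReal_ne_top, ← lintegral_indicator measurableSet_ball]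
      refine lintegral_mono fun z => ?_
      by_cases hz : t / 2 < dist y z ∧ dist y z ≤ t
      · rw [Set.indicator_of_mem (by exact hz), Set.indicator_of_mem, mul_comm]
        · gcongr
          refine ENNReal.ofReal_le_ofReal ?_
          have hyz : y ≠ z := by
            rintro rfl
            rw [dist_self] at hz; linarith
          refine (hκ y z t ht hyz (by linarith)).trans ?_
          have hvy := vol_pos (μ := μ) y ht
          rw [div_le_div_iff₀ (by positivity) (by positivity)]
          have := hvol y j (2 * t) t ht (by rw [mem_ball] at hy; linarith)
          calc C₁ * (vol μ j (2 * t) * Υ t) ≤ C₁ * ((C₂ * vol μ y t) * Υ t) := by gcongr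
            _ = _ := by ring
        · rw [mem_ball]
          have h1 := dist_triangle z y j
          rw [dist_comm z y] at h1
          rw [mem_ball] at hy
          linarith
      · rw [Set.indicator_of_notMem (by exact hz)]
        exact zero_le
    calc _ ≤ ∫⁻ y in ball j t, ENNReal.ofReal (C₁ * C₂ / (vol μ j (2 * t) * Υ t)) *
          ∫⁻ z in ball j (2 * t), ‖φ y - φ z‖ₑ ^ p ∂μ ∂μ :=
          setLIntegral_mono' measurableSet_ball hin
      _ ≤ ENNReal.ofReal (C₁ * C₂ / (vol μ j (2 * t) * Υ t)) *
          ∫⁻ y in ball j (2 * t), ∫⁻ z in ball j (2 * t), ‖φ y - φ z‖ₑ ^ p ∂μ ∂μ := by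
          rw [lintegral_const_mul' _ _ ENNReal.ofReal_ne_top]
          refine mul_le_mul_right ?_ _
          exact lintegral_mono_set (ball_subset_ball (by linarith))
      _ ≤ ENNReal.ofReal (C₁ * C₂ / (vol μ j (2 * t) * Υ t)) *
          (2 ^ p * 2 * μ (ball j (2 * t)) *
            (ENNReal.ofReal (P * Ψ (2 * t)) * Γ φ (ball j (A * (2 * t))))) := by
          gcongr
          refine (lintegral_lintegral_sub_le hp.le hφm _
            (⨍ z in ball j (2 * t), φ z ∂μ)).trans ?_
          gcongr
          simpa only [enorm_rpow_eq_ofReal (zero_le_one.trans hp.le)] using hPI j (2 * t) h2t φ hφ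
      _ = ENNReal.ofReal (C₁ * C₂ / (vol μ j (2 * t) * Υ t) * (2 ^ p * 2 * vol μ j (2 * t)) *
            (P * Ψ (2 * t))) * ∫⁻ y in ball j (2 * A * t), 1 ∂(Γ φ) := by
          have e : (2 : ℝ≥0∞) ^ p * 2 * μ (ball j (2 * t))
              = ENNReal.ofReal (2 ^ p * 2 * vol μ j (2 * t)) := by
            rw [ENNReal.ofReal_mul (by positivity), ENNReal.ofReal_mul (by positivity), ofReal_vol,
              ← ENNReal.ofReal_rpow_of_nonneg zero_le_two (by linarith), ENNReal.ofReal_ofNat]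
          rw [setLIntegral_one, e, ← mul_assoc, ← mul_assoc, ← ENNReal.ofReal_mul (by positivity),
            ← ENNReal.ofReal_mul (by positivity), show A * (2 * t) = 2 * A * t by ring]
      _ ≤ _ := by
          refine mul_le_mul_left (ENNReal.ofReal_le_ofReal ?_) _
          have := hdb t (2 * t) ht h2t le_rfl
          calc _ ≤ C₁ * C₂ / (vol μ j (2 * t) * Υ t) * (2 ^ p * 2 * vol μ j (2 * t)) *
                (P * (C₃ * Ψ t)) := by gcongr
            _ = _ := by field_simp
  calc _ ≤ ∑ j ∈ J, ∫⁻ y in ball j t, ∫⁻ z,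
          {q : X × X | t / 2 < dist q.1 q.2 ∧ dist q.1 q.2 ≤ t}.indicator
            (fun q => ‖φ q.1 - φ q.2‖ₑ ^ p * κ.k q.1 q.2) (y, z) ∂μ ∂μ :=
        lintegral_le_sum_ball (fun y hy => hJc y hy) _
    _ ≤ ∑ j ∈ J, ENNReal.ofReal (C₁ * C₂ * (2 ^ p * 2) * (P * C₃) * (Ψ t / Υ t)) *
          ∫⁻ y in ball j (2 * A * t), 1 ∂(Γ φ) := Finset.sum_le_sum fun j _ => hball j
    _ ≤ ENNReal.ofReal (C₁ * C₂ * (2 ^ p * 2) * (P * C₃) * (Ψ t / Υ t)) *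
          (N * ∫⁻ y in ball x ((1 + 2 * A) * s), 1 ∂(Γ φ)) := by
        rw [← Finset.mul_sum]
        gcongr
        refine hN t J ht hJ (Γ φ) _ (fun j hj => ball_subset_ball' ?_) _
        have := hJx j hj
        nlinarith
    _ ≤ _ := by
        rw [setLIntegral_one, ← mul_assoc, ← ENNReal.ofReal_natCast, ← ENNReal.ofReal_mul
          (by positivity)]
        refine mul_le_mul_left (ENNReal.ofReal_le_ofReal ?_) _
        have : 0 ≤ C₁ * C₂ * (2 ^ p * 2) * (P * C₃) * (Ψ t / Υ t) := by positivity
        nlinarith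

/-- Every slice of jump lengths is charged to the same quantity `Γ φ (B(x, Ls))`. Its coefficient
`Ψ(t)/Υ(t)` at `t = s/2^n` is at most `Θ(2^(-n)) Ψ(s)/Υ(s)`, and summability of `Θ` closes the
estimate. -/
lemma hasNearCutoffs_of_strictUpperGrowth (hp : 1 < p) {F : Set (X → ℝ)}
    {Γ : (X → ℝ) → Measure X} (hF : ∀ f ∈ F, MemLp f (ENNReal.ofReal p) μ)
    (κ : StableKernel μ Υ) (hΨ : IsDoublingFunction Ψ) (hΥ : IsDoublingFunction Υ)
    (hV : VolumeDoubling μ) (hPI : PoincareInequality p μ F Γ Ψ) (hCE : CEStrong μ F Γ Ψ)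
    (hSUG : StrictUpperGrowth Υ Ψ) : HasNearCutoffs p κ := by
  obtain ⟨δ, hδ, A, hA, C, hC, hcut⟩ := hCE
  obtain ⟨Θ, -, hΘ0, -, hΘs, hgrow⟩ := hSUG
  obtain ⟨C₁, hC₁, L, hL, hann⟩ := exists_annulus_le hp κ hΨ hΥ hV hPI
  obtain ⟨C₂, hC₂, hdb⟩ := hΨ.exists_le 1
  obtain ⟨C₃, hC₃, hvol⟩ := hV.exists_le L
  have hΘn : ∀ n : ℕ, 0 ≤ Θ (1 / 2 ^ n) := fun n =>
    hΘ0 _ ⟨by positivity, by rw [div_le_one (by positivity)]; exact one_le_pow₀ one_le_two⟩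
  set S := ∑' n : ℕ, Θ (1 / 2 ^ n) with hS
  have hS0 : 0 ≤ S := tsum_nonneg hΘn
  have hL0 : 0 < L := by linarith
  refine ⟨δ, hδ, A, hA, C + C₁ * (C * L ^ δ * C₃ * C₂) * S, by positivity, fun x₀ r hr => ?_⟩
  obtain ⟨φ, hφF, hφc, hφh, hφe⟩ := hcut x₀ r hr
  have hφm : Measurable φ := (continuous_of_holder hδ.1 hφh).measurable
  refine ⟨φ, hF φ hφF, hφc, fun x y => (hφh x y).trans ?_, fun x s hs hsr => ?_⟩
  · have hm : 0 ≤ min (dist x y / r) 1 := le_min (by positivity) zero_le_one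
    refine mul_le_mul_of_nonneg_right ?_ (by positivity)
    have : 0 ≤ C₁ * (C * L ^ δ * C₃ * C₂) * S := by positivity
    linarith
  have hYs := hΥ.pos hs
  have hPs := hΨ.pos hs
  have hvs := vol_pos (μ := μ) x hs
  let t : ℕ → ℝ := fun n => s / 2 ^ n
  have ht : ∀ n, 0 < t n := fun n => by positivity
  have hts : ∀ n, t n ≤ s := fun n => div_le_self hs.le (one_le_pow₀ one_le_two)
  let D : ℕ → Set (X × X) := fun n => {q | t n / 2 < dist q.1 q.2 ∧ dist q.1 q.2 ≤ t n}
  have hD : ∀ n, MeasurableSet (D n) := fun n =>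
    (measurableSet_lt measurable_const (measurable_fst.dist measurable_snd)).inter
      (measurableSet_le (measurable_fst.dist measurable_snd) measurable_const)
  let g : X × X → ℝ≥0∞ := fun q => ‖φ q.1 - φ q.2‖ₑ ^ p * κ.k q.1 q.2
  have hg : Measurable g := (measurable_enorm_sub hφm).mul κ.measurable_k
  have hgD : ∀ n, Measurable ((D n).indicator g) := fun n => hg.indicator (hD n)
  have hcov : ∀ y z, z ∈ ball y s → g (y, z) ≤ ∑' n, (D n).indicator g (y, z) := by
    intro y z hz
    rcases eq_or_ne y z with rfl | hyz
    · have : 0 < p := by linarith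
      simp [g, this]
    · have hd : 0 < dist y z := dist_pos.2 hyz
      rw [mem_ball'] at hz
      -- Some `n` has `(1/2)^(n+1) < d(y,z)/s ≤ (1/2)^n`, which matches the half-open slices `D n`.
      obtain ⟨n, hn1, hn2⟩ := exists_nat_pow_near_of_lt_one (x := dist y z / s) (y := (1 / 2 : ℝ))
        (by positivity) ((div_le_one hs).2 hz.le) (by norm_num) (by norm_num)
      have hmem : (y, z) ∈ D n := by
        rw [lt_div_iff₀ hs] at hn1
        rw [div_le_iff₀ hs] at hn2
        refine ⟨lt_of_eq_of_lt ?_ hn1, hn2.trans_eq ?_⟩ <;> simp only [t, one_div, inv_pow]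
        · rw [pow_succ]; field_simp
        · field_simp
      refine le_trans (le_of_eq ?_) (ENNReal.le_tsum n)
      rw [Set.indicator_of_mem hmem]
  have hΓ : Γ φ (ball x (L * s)) ≤ ENNReal.ofReal
      (C * L ^ δ * C₃ * C₂ * (s / r) ^ δ * (vol μ x s / Ψ s)) := by
    have hLs : 0 < L * s := by positivity
    refine (hφe x (L * s) hLs).trans (ENNReal.ofReal_le_ofReal ?_)
    have hm0 : 0 < min (L * s) r := lt_min hLs hr
    have hPm := hΨ.pos hm0
    have h1 : min (L * s / r) 1 ^ δ ≤ L ^ δ * (s / r) ^ δ := by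
      rw [← Real.mul_rpow hL0.le (by positivity), ← mul_div_assoc]
      exact Real.rpow_le_rpow (le_min (by positivity) zero_le_one) (min_le_left _ _) hδ.1.le
    have h2 : vol μ x (L * s) ≤ C₃ * vol μ x s := hvol x x _ _ hs (by simp)
    -- Both `L ≥ 1` and `s ≤ r` are used: they give `s ≤ min (L * s) r`, and `Ψ` is monotone up to a
    -- constant.
    have h3 : Ψ s ≤ C₂ * Ψ (min (L * s) r) :=
      hdb _ _ hm0 hs (by rw [one_mul]; exact le_min (le_mul_of_one_le_left hs.le hL) hsr)
    have h4 : vol μ x (L * s) / Ψ (min (L * s) r) ≤ C₃ * C₂ * (vol μ x s / Ψ s) := by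
      rw [← mul_div_assoc, div_le_div_iff₀ hPm hPs]
      calc vol μ x (L * s) * Ψ s ≤ (C₃ * vol μ x s) * (C₂ * Ψ (min (L * s) r)) := by gcongr
        _ = _ := by ring
    have h5 : 0 ≤ vol μ x (L * s) := measureReal_nonneg
    calc _ ≤ C * (L ^ δ * (s / r) ^ δ) * (C₃ * C₂ * (vol μ x s / Ψ s)) := by gcongr
      _ = _ := by ring
  set M := C₁ * (C * L ^ δ * C₃ * C₂) * (s / r) ^ δ * (vol μ x s / Υ s) with hM
  have hM0 : 0 ≤ M := by positivity
  have hI : ∀ n, ∫⁻ y in ball x s, ∫⁻ z, (D n).indicator g (y, z) ∂μ ∂μ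
      ≤ ENNReal.ofReal (M * Θ (1 / 2 ^ n)) := by
    intro n
    have hYt := hΥ.pos (ht n)
    have hPt := hΨ.pos (ht n)
    refine (hann φ hφF hφm x s (t n) (ht n) (hts n)).trans ?_
    refine (mul_le_mul_right hΓ _).trans ?_
    rw [← ENNReal.ofReal_mul (by positivity)]
    refine ENNReal.ofReal_le_ofReal ?_
    have h1 := hgrow (t n) s (ht n) (hts n)
    rw [show t n / s = 1 / 2 ^ n by simp only [t]; field_simp] at h1
    have h2 : Ψ (t n) / Υ (t n) * (1 / Ψ s) ≤ Θ (1 / 2 ^ n) * (1 / Υ s) := by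
      calc Ψ (t n) / Υ (t n) * (1 / Ψ s)
          = Υ s / Υ (t n) * (Ψ (t n) / (Ψ s * Υ s)) := by field_simp
        _ ≤ Θ (1 / 2 ^ n) * (Ψ s / Ψ (t n)) * (Ψ (t n) / (Ψ s * Υ s)) := by gcongr
        _ = _ := by field_simp
    calc _ = C₁ * (C * L ^ δ * C₃ * C₂) * (s / r) ^ δ * vol μ x s *
          (Ψ (t n) / Υ (t n) * (1 / Ψ s)) := by ring
      _ ≤ C₁ * (C * L ^ δ * C₃ * C₂) * (s / r) ^ δ * vol μ x s *
          (Θ (1 / 2 ^ n) * (1 / Υ s)) := by gcongr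
      _ = _ := by rw [hM]; ring
  calc ∫⁻ y in ball x s, ∫⁻ z in ball y s, ‖φ y - φ z‖ₑ ^ p * κ.k y z ∂μ ∂μ
      ≤ ∫⁻ y in ball x s, ∫⁻ z, ∑' n, (D n).indicator g (y, z) ∂μ ∂μ := by
        refine lintegral_mono fun y => ?_
        exact (setLIntegral_mono' measurableSet_ball fun z hz => hcov y z hz).trans
          (setLIntegral_le_lintegral _ _)
    _ = ∑' n, ∫⁻ y in ball x s, ∫⁻ z, (D n).indicator g (y, z) ∂μ ∂μ := by
        rw [← lintegral_tsum fun n => (hgD n).lintegral_prod_right'.aemeasurable]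
        refine lintegral_congr fun y => ?_
        exact lintegral_tsum fun n => ((hgD n).comp measurable_prodMk_left).aemeasurable
    _ ≤ ∑' n, ENNReal.ofReal (M * Θ (1 / 2 ^ n)) := ENNReal.tsum_le_tsum hI
    _ = ENNReal.ofReal (M * S) := by
        rw [← ENNReal.ofReal_tsum_of_nonneg (fun n => mul_nonneg hM0 (hΘn n))
          (hΘs.mul_left M), tsum_mul_left]
    _ ≤ _ := by
        refine ENNReal.ofReal_le_ofReal ?_
        have : 0 ≤ C * (s / r) ^ δ * (vol μ x s / Υ s) := by positivity
        rw [hM]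
        linarith

end transfer

/-! ### Discrete convolution -/

section disc

variable {X : Type*} [MetricSpace X]

/-- Continuous cutoff functions `Φ j` for the balls `B(j, ε) ⊆ B(j, A ε)`. -/
structure IsCutoffFamily (A ε : ℝ) (Φ : X → X → ℝ) : Prop where
  cont : ∀ j, Continuous (Φ j)
  mem_Icc : ∀ j x, Φ j x ∈ Set.Icc (0 : ℝ) 1
  eq_one : ∀ j, ∀ x ∈ ball j ε, Φ j x = 1
  eq_zero : ∀ j, ∀ x ∉ ball j (A * ε), Φ j x = 0

/-- The sum of the cutoff functions over `J`. -/
def cutSum (Φ : X → X → ℝ) (J : Finset X) (x : X) : ℝ := ∑ j ∈ J, Φ j x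

/-- The combination of the normalized cutoff functions with coefficients `a`. -/
noncomputable def disc (Φ : X → X → ℝ) (J : Finset X) (a : X → ℝ) (x : X) : ℝ :=
  (∑ j ∈ J, a j * Φ j x) / max (cutSum Φ J x) 1

variable {A ε : ℝ} {Φ : X → X → ℝ} {J : Finset X} {a : X → ℝ}

lemma IsCutoffFamily.continuous_disc (h : IsCutoffFamily A ε Φ) : Continuous (disc Φ J a) := by
  refine Continuous.div (continuous_finsetSum _ fun j _ => continuous_const.mul (h.cont j))
    ((continuous_finsetSum _ fun j _ => h.cont j).max continuous_const) fun x => ?_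
  exact (zero_lt_one.trans_le (le_max_right _ _)).ne'

lemma IsCutoffFamily.exists_of_disc_ne_zero (h : IsCutoffFamily A ε Φ) {x : X}
    (hx : disc Φ J a x ≠ 0) : ∃ j ∈ J, a j ≠ 0 ∧ dist x j < A * ε := by
  by_contra! hc
  refine hx ?_
  rw [disc, Finset.sum_eq_zero, zero_div]
  intro j hj
  by_cases ha : a j = 0
  · rw [ha, zero_mul]
  · rw [h.eq_zero j x (by rw [mem_ball, not_lt]; exact hc j hj ha), mul_zero]

lemma IsCutoffFamily.one_le_cutSum (h : IsCutoffFamily A ε Φ) {x : X}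
    (hx : ∃ j ∈ J, dist x j < ε) : 1 ≤ cutSum Φ J x := by
  obtain ⟨j, hj, hxj⟩ := hx
  rw [← h.eq_one j x hxj]
  exact Finset.single_le_sum (f := fun j => Φ j x) (fun i _ => (h.mem_Icc i x).1) hj

/-- Within `ε` of a net point the denominator is `cutSum` itself, so the normalized cutoffs sum to
one and constants are reproduced. Elsewhere the maximum with `1` only keeps the quotient defined and
continuous. -/
lemma IsCutoffFamily.disc_sub (h : IsCutoffFamily A ε Φ) {x : X}
    (hx : ∃ j ∈ J, dist x j < ε) (c : ℝ) :
    disc Φ J a x - c = (∑ j ∈ J, (a j - c) * Φ j x) / cutSum Φ J x := by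
  have h1 := h.one_le_cutSum hx
  have h0 : cutSum Φ J x ≠ 0 := by linarith
  rw [disc, max_eq_left h1, eq_div_iff h0, sub_mul, div_mul_cancel₀ _ h0]
  simp only [sub_mul, Finset.sum_sub_distrib, ← Finset.mul_sum]
  rfl

lemma IsCutoffFamily.abs_sum_le (h : IsCutoffFamily A ε Φ) {x : X} {c M : ℝ}
    (hM : ∀ i ∈ J, dist x i < A * ε → |a i - c| ≤ M) :
    |∑ j ∈ J, (a j - c) * Φ j x| ≤ M * cutSum Φ J x := by
  rw [cutSum, Finset.mul_sum]
  refine (Finset.abs_sum_le_sum_abs _ _).trans (Finset.sum_le_sum fun i hi => ?_)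
  rw [abs_mul, abs_of_nonneg (h.mem_Icc i x).1]
  by_cases hxi : dist x i < A * ε
  · exact mul_le_mul_of_nonneg_right (hM i hi hxi) (h.mem_Icc i x).1
  · rw [h.eq_zero i x hxi, mul_zero, mul_zero]

/-- The value at `x` is a weighted mean of those `a i` whose cutoff can be nonzero at `x`. -/
lemma IsCutoffFamily.abs_disc_sub_le (h : IsCutoffFamily A ε Φ) {x : X} {c M : ℝ}
    (hx : ∃ j ∈ J, dist x j < ε) (hM : ∀ i ∈ J, dist x i < A * ε → |a i - c| ≤ M) :
    |disc Φ J a x - c| ≤ M := by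
  have h1 := h.one_le_cutSum hx
  rw [h.disc_sub hx, abs_div, abs_of_nonneg (zero_le_one.trans h1), div_le_iff₀ (by linarith)]
  exact h.abs_sum_le hM

/-- The quotient rule for `g / cutSum` with `g = ∑ (a j - c) Φ j`. As `cutSum ≥ 1` and `|g| ≤ M *
cutSum`, the variations of numerator and denominator each cost `M` times the variation of the
cutoffs indexed by `I`. Subtracting `c` first makes only differences of coefficients matter. -/
lemma IsCutoffFamily.abs_disc_sub_disc_le (h : IsCutoffFamily A ε Φ) {x y : X} {c M : ℝ}
    (hx : ∃ j ∈ J, dist x j < ε) (hy : ∃ j ∈ J, dist y j < ε) {I : Finset X} (hIJ : I ⊆ J)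
    (hI : ∀ i ∈ J, dist x i < A * ε ∨ dist y i < A * ε → i ∈ I) (hM0 : 0 ≤ M)
    (hM : ∀ i ∈ I, |a i - c| ≤ M) :
    |disc Φ J a x - disc Φ J a y| ≤ 2 * M * ∑ i ∈ I, |Φ i x - Φ i y| := by
  have hx1 := h.one_le_cutSum hx
  have hy1 := h.one_le_cutSum hy
  set g : X → ℝ := fun z => ∑ j ∈ J, (a j - c) * Φ j z with hg
  set T := ∑ i ∈ I, |Φ i x - Φ i y| with hT
  have hT0 : 0 ≤ T := Finset.sum_nonneg fun _ _ => abs_nonneg _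
  have hout : ∀ i ∈ J, i ∉ I → Φ i x - Φ i y = 0 := by
    intro i hi hiI
    have h1 : ¬ dist x i < A * ε := fun hd => hiI (hI i hi (Or.inl hd))
    have h2 : ¬ dist y i < A * ε := fun hd => hiI (hI i hi (Or.inr hd))
    rw [h.eq_zero i x h1, h.eq_zero i y h2, sub_zero]
  have hgxy : |g x - g y| ≤ M * T := by
    have : g x - g y = ∑ i ∈ I, (a i - c) * (Φ i x - Φ i y) := by
      rw [Finset.sum_subset hIJ fun i hi hiI => by rw [hout i hi hiI, mul_zero]]
      simp only [hg, ← Finset.sum_sub_distrib, mul_sub]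
    rw [this, hT, Finset.mul_sum]
    refine (Finset.abs_sum_le_sum_abs _ _).trans (Finset.sum_le_sum fun i hi => ?_)
    rw [abs_mul]
    exact mul_le_mul_of_nonneg_right (hM i hi) (abs_nonneg _)
  have hSxy : |cutSum Φ J y - cutSum Φ J x| ≤ T := by
    have : cutSum Φ J y - cutSum Φ J x = ∑ i ∈ I, (Φ i y - Φ i x) := by
      rw [Finset.sum_subset hIJ fun i hi hiI => by have := hout i hi hiI; linarith]
      simp only [cutSum, Finset.sum_sub_distrib]
    rw [this]
    refine (Finset.abs_sum_le_sum_abs _ _).trans (Finset.sum_le_sum fun i _ => ?_)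
    rw [abs_sub_comm]
  have hgy : |g y| ≤ M * cutSum Φ J y :=
    h.abs_sum_le fun i hi hd => hM i (hI i hi (Or.inr hd))
  have e : disc Φ J a x - disc Φ J a y
      = (g x - g y) / cutSum Φ J x
        + g y / cutSum Φ J y * ((cutSum Φ J y - cutSum Φ J x) / cutSum Φ J x) := by
    have e1 := h.disc_sub (a := a) hx c
    have e2 := h.disc_sub (a := a) hy c
    have n1 : cutSum Φ J x ≠ 0 := by linarith
    have n2 : cutSum Φ J y ≠ 0 := by linarith
    calc disc Φ J a x - disc Φ J a y = g x / cutSum Φ J x - g y / cutSum Φ J y := by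
          rw [← e1, ← e2]; ring
      _ = _ := by field_simp; ring
  rw [e]
  have b1 : |(g x - g y) / cutSum Φ J x| ≤ M * T := by
    rw [abs_div, abs_of_nonneg (zero_le_one.trans hx1)]
    exact (div_le_self (abs_nonneg _) hx1).trans hgxy
  have b2 : |g y / cutSum Φ J y| ≤ M := by
    rw [abs_div, abs_of_nonneg (zero_le_one.trans hy1), div_le_iff₀ (by linarith)]
    exact hgy
  have b3 : |(cutSum Φ J y - cutSum Φ J x) / cutSum Φ J x| ≤ T := by
    rw [abs_div, abs_of_nonneg (zero_le_one.trans hx1)]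
    exact (div_le_self (abs_nonneg _) hx1).trans hSxy
  calc _ ≤ M * T + M * T := (abs_add_le _ _).trans (add_le_add b1 (by
        rw [abs_mul]; exact mul_le_mul b2 b3 (abs_nonneg _) hM0))
    _ = _ := by ring

end disc

/-! ### Ball averages and averaging weights -/

section average

variable {X : Type*} [MetricSpace X] [ProperSpace X] [MeasurableSpace X] [BorelSpace X]
  {μ : Measure X} [IsFiniteMeasureOnCompacts μ] [μ.IsOpenPosMeasure] {p : ℝ} {Υ : ℝ → ℝ}

/-- Jensen's inequality for the average over a ball. -/
lemma enorm_average_sub_rpow_le (hp : 1 ≤ p) {v : X → ℝ} {j : X} {ε : ℝ} (hε : 0 < ε)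
    (hv : MemLp v (ENNReal.ofReal p) μ) (c : ℝ) :
    ‖⨍ y in ball j ε, v y ∂μ - c‖ₑ ^ p
      ≤ (μ (ball j ε))⁻¹ * ∫⁻ y in ball j ε, ‖v y - c‖ₑ ^ p ∂μ := by
  have h0 : 0 < p := by linarith
  have hB0 := (measure_ball_pos μ j hε).ne'
  have hBt := measure_ball_ne_top (μ := μ) j ε
  set ν : Measure X := (μ (ball j ε))⁻¹ • μ.restrict (ball j ε) with hν
  have : IsProbabilityMeasure ν := ⟨by
    rw [hν, Measure.smul_apply, Measure.restrict_apply_univ, smul_eq_mul,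
      ENNReal.inv_mul_cancel hB0 hBt]⟩
  have hvν : MemLp v (ENNReal.ofReal p) ν :=
    (hv.restrict _).smul_measure (ENNReal.inv_ne_top.2 hB0)
  have hint : Integrable v ν := hvν.integrable (by simpa using hp)
  have hsub : MemLp (fun y => v y - c) (ENNReal.ofReal p) ν := hvν.sub (memLp_const c)
  have e : ⨍ y in ball j ε, v y ∂μ - c = ∫ y, (v y - c) ∂ν := by
    rw [integral_sub hint (integrable_const c), integral_const, probReal_univ, one_smul,
      average, Measure.restrict_apply_univ]
  rw [e]
  calc ‖∫ y, (v y - c) ∂ν‖ₑ ^ p ≤ (∫⁻ y, ‖v y - c‖ₑ ∂ν) ^ p :=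
        ENNReal.rpow_le_rpow (enorm_integral_le_lintegral_enorm _) h0.le
    _ ≤ (eLpNorm (fun y => v y - c) (ENNReal.ofReal p) ν) ^ p := by
        rw [← eLpNorm_one_eq_lintegral_enorm]
        exact ENNReal.rpow_le_rpow (eLpNorm_le_eLpNorm_of_exponent_le (by simpa using hp)
          hsub.aestronglyMeasurable) h0.le
    _ = _ := by
        rw [eLpNorm_rpow_eq_pnorm h0, pnorm, hν, lintegral_smul_measure, smul_eq_mul]

/-- The weight `1_{d(x,y) < s} / V(x, ε)`. -/
noncomputable def avgWeight (μ : Measure X) (s ε : ℝ) (x y : X) : ℝ≥0∞ :=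
  (ball x s).indicator (fun _ => (μ (ball x ε))⁻¹) y

lemma measurable_avgWeight (s ε : ℝ) : Measurable (Function.uncurry (avgWeight μ s ε)) := by
  refine measurable_indicator_ball (w := fun x _ => (μ (ball x ε))⁻¹) ?_ s
  have hs : MeasurableSet {z : X × X | dist z.2 z.1 < ε} :=
    measurableSet_lt (measurable_snd.dist measurable_fst) measurable_const
  exact ((measurable_measure_prodMk_left hs).inv).comp measurable_fst

lemma lintegral_mul_avgWeight (s ε : ℝ) (x : X) (f : X → ℝ≥0∞) :
    ∫⁻ y, f y * avgWeight μ s ε x y ∂μ = ∫⁻ y in ball x s, f y * (μ (ball x ε))⁻¹ ∂μ := by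
  rw [← lintegral_indicator measurableSet_ball]
  refine lintegral_congr fun y => ?_
  by_cases h : y ∈ ball x s <;> simp [avgWeight, h]

end average

/-! ### Approximation by combinations of cutoff functions -/

section approx

variable {X : Type*} [MetricSpace X] [ProperSpace X] [MeasurableSpace X] [BorelSpace X]
  {μ : Measure X} [IsFiniteMeasureOnCompacts μ] [μ.IsOpenPosMeasure] {p : ℝ} {Υ : ℝ → ℝ}

/-- At `s = r = ε` the Hölder factor is `1`, and each cutoff has energy at most `C V/Υ(ε)` on every
ball of radius `ε`. -/
lemma NonlocalCEStrong.exists_family {hp : 1 < p} {κ : StableKernel μ Υ}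
    (h : NonlocalCEStrong hp κ) : ∃ A > (1 : ℝ), ∃ C > (0 : ℝ), ∀ ε > (0 : ℝ),
      ∃ Φ : X → X → ℝ, IsCutoffFamily A ε Φ ∧ ∀ j x,
        ∫⁻ y in ball x ε, ∫⁻ z, ‖Φ j y - Φ j z‖ₑ ^ p * κ.k y z ∂μ ∂μ
          ≤ ENNReal.ofReal (C * (vol μ x ε / Υ ε)) := by
  obtain ⟨δ, hδ, A, hA, C, hC, hcut⟩ := h
  refine ⟨A, hA, C, hC, fun ε hε => ?_⟩
  choose Φ hΦ using fun j => hcut j ε hε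
  have hc : ∀ j, Continuous (Φ j) := fun j => continuous_of_holder hδ.1 (hΦ j).2.2.1
  refine ⟨Φ, ⟨hc, fun j x => (hΦ j).2.1.mem_Icc (hc j) x,
    fun j x hx => (hΦ j).2.1.eq_one_of_mem (hc j) hx,
    fun j x hx => (hΦ j).2.1.eq_zero_of_notMem (hc j) hx⟩, fun j x => ?_⟩
  have := (hΦ j).2.2.2 x ε hε
  rwa [div_self hε.ne', min_self, min_self, Real.one_rpow, mul_one, jumpEnergyMeasure_ball] at this

lemma inv_le_mul_inv {a b c : ℝ≥0∞} (ha : a ≠ 0) (ha' : a ≠ ∞) (hb : b ≠ 0) (hb' : b ≠ ∞)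
    (h : a ≤ c * b) : b⁻¹ ≤ c * a⁻¹ := by
  calc b⁻¹ = a * a⁻¹ * b⁻¹ := by rw [ENNReal.mul_inv_cancel ha ha', one_mul]
    _ ≤ c * b * a⁻¹ * b⁻¹ := by gcongr
    _ = c * a⁻¹ * (b * b⁻¹) := by ring
    _ = _ := by rw [ENNReal.mul_inv_cancel hb hb', mul_one]

/-- The averages of `v` over the balls `B(j, ε)`. -/
noncomputable def ballAvg (μ : Measure X) (v : X → ℝ) (ε : ℝ) (j : X) : ℝ :=
  ⨍ y in ball j ε, v y ∂μ

lemma exists_of_ballAvg_ne_zero {v : X → ℝ} {ε : ℝ} {j : X} (h : ballAvg μ v ε j ≠ 0) :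
    ∃ y ∈ ball j ε, v y ≠ 0 := by
  by_contra! hc
  refine h ?_
  have : ∫ y in ball j ε, v y ∂μ = 0 := by
    rw [setIntegral_congr_fun measurableSet_ball fun y hy => hc y hy]
    simp
  rw [ballAvg, setAverage_eq, this, smul_zero]

lemma abs_ballAvg_sub_le {v : X → ℝ} (hv : LocallyIntegrable v μ) {ε : ℝ} (hε : 0 < ε) {j : X}
    {c η : ℝ} (h : ∀ y ∈ ball j ε, |v y - c| ≤ η) : |ballAvg μ v ε j - c| ≤ η := by
  have hi : IntegrableOn v (ball j ε) μ :=
    (hv.integrableOn_isCompact (isCompact_closedBall j ε)).mono_set ball_subset_closedBall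
  have := (convex_closedBall c η).set_average_mem isClosed_closedBall
    (measure_ball_pos μ j hε).ne' (measure_ball_ne_top j ε)
    ((ae_restrict_iff' measurableSet_ball).2 (Filter.Eventually.of_forall fun y hy => by
      rw [mem_closedBall, Real.dist_eq]; exact h y hy)) hi
  rwa [mem_closedBall, Real.dist_eq] at this

/-- The local oscillation `⨍_{B(x, L ε)} |v(x) - v(y)|^p μ(dy)`, up to a constant. -/
noncomputable def osc (p : ℝ) (μ : Measure X) (s ε : ℝ) (v : X → ℝ) (x : X) : ℝ≥0∞ :=
  ∫⁻ y, ‖v x - v y‖ₑ ^ p * avgWeight μ s ε x y ∂μ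

/-- Deviations from nearby averages are controlled by the local oscillation. -/
lemma exists_dev_le (hp : 1 ≤ p) (hV : VolumeDoubling μ) (A : ℝ) :
    ∃ C : ℝ≥0∞, C ≠ ∞ ∧ ∀ ε > (0 : ℝ), ∀ v : X → ℝ, MemLp v (ENNReal.ofReal p) μ →
      ∀ i j : X, dist i j < (A + 2) * ε →
        (∀ x ∈ ball j ε, ‖v x - ballAvg μ v ε i‖ₑ ^ p ≤ C * osc p μ ((A + 4) * ε) ε v x) ∧
        ‖ballAvg μ v ε i - ballAvg μ v ε j‖ₑ ^ p * μ (ball j ε)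
          ≤ C * ∫⁻ x in ball j ε, osc p μ ((A + 4) * ε) ε v x ∂μ := by
  obtain ⟨C, hC, hvol⟩ := hV.exists_le (A + 4)
  refine ⟨ENNReal.ofReal C, ENNReal.ofReal_ne_top, fun ε hε v hv i j hij => ?_⟩
  have hpos := fun x : X => (measure_ball_pos μ x hε).ne'
  have htop := fun x : X => measure_ball_ne_top (μ := μ) x ε
  have h1 : ∀ x ∈ ball j ε,
      ‖v x - ballAvg μ v ε i‖ₑ ^ p ≤ ENNReal.ofReal C * osc p μ ((A + 4) * ε) ε v x := by
    intro x hx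
    rw [mem_ball] at hx
    -- Consequently `B(i,ε) ⊆ B(x, (A+4)ε)`, which is the radius used in `osc`.
    have hix : dist i x < (A + 3) * ε := by
      have := dist_triangle_right i x j
      linarith
    have hm : (μ (ball i ε))⁻¹ ≤ ENNReal.ofReal C * (μ (ball x ε))⁻¹ := by
      refine inv_le_mul_inv (hpos x) (htop x) (hpos i) (htop i) ?_
      rw [← ofReal_vol, ← ofReal_vol, ← ENNReal.ofReal_mul hC.le]
      exact ENNReal.ofReal_le_ofReal (hvol i x ε ε hε (by linarith))
    rw [enorm_sub_rev]
    calc _ ≤ (μ (ball i ε))⁻¹ * ∫⁻ y in ball i ε, ‖v y - v x‖ₑ ^ p ∂μ :=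
          enorm_average_sub_rpow_le hp hε hv (v x)
      _ ≤ ENNReal.ofReal C * (μ (ball x ε))⁻¹ *
            ∫⁻ y in ball x ((A + 4) * ε), ‖v x - v y‖ₑ ^ p ∂μ := by
          refine mul_le_mul' hm ?_
          simp only [enorm_sub_rev (v x)]
          exact lintegral_mono_set (ball_subset_ball' (by linarith))
      _ = _ := by
          rw [osc, lintegral_mul_avgWeight, lintegral_mul_const' _ _ (ENNReal.inv_ne_top.2 (hpos x))]
          ring
  refine ⟨h1, ?_⟩
  calc _ ≤ (μ (ball j ε))⁻¹ * (∫⁻ y in ball j ε, ‖v y - ballAvg μ v ε i‖ₑ ^ p ∂μ)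
          * μ (ball j ε) := by
        rw [enorm_sub_rev]
        gcongr
        exact enorm_average_sub_rpow_le hp hε hv _
    _ = ((μ (ball j ε))⁻¹ * μ (ball j ε)) * ∫⁻ y in ball j ε, ‖v y - ballAvg μ v ε i‖ₑ ^ p ∂μ := by
        ring
    _ = ∫⁻ y in ball j ε, ‖v y - ballAvg μ v ε i‖ₑ ^ p ∂μ := by
        rw [ENNReal.inv_mul_cancel (hpos j) (htop j), one_mul]
    _ ≤ ∫⁻ y in ball j ε, ENNReal.ofReal C * osc p μ ((A + 4) * ε) ε v y ∂μ :=
        setLIntegral_mono' measurableSet_ball h1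
    _ = _ := lintegral_const_mul' _ _ ENNReal.ofReal_ne_top

lemma ofReal_sum_abs_rpow_le (hp : 1 ≤ p) {ι : Type*} (I : Finset ι) (b : ι → ℝ) {N : ℕ}
    (hN : I.card ≤ N) :
    ENNReal.ofReal (∑ i ∈ I, |b i|) ^ p ≤ (N : ℝ≥0∞) ^ (p - 1) * ∑ i ∈ I, ‖b i‖ₑ ^ p := by
  rw [ENNReal.ofReal_sum_of_nonneg fun _ _ => abs_nonneg _]
  simp only [← Real.enorm_eq_ofReal_abs]
  refine (ENNReal.rpow_sum_le_const_mul_sum_rpow I (fun i => ‖b i‖ₑ) hp).trans ?_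
  gcongr

open Classical in
/-- Compactly supported functions are approximated by combinations of cutoff functions. -/
lemma exists_discretization (hp : 1 < p) {κ : StableKernel μ Υ} (hΥ : IsDoublingFunction Υ)
    (hV : VolumeDoubling μ) (hCE : NonlocalCEStrong hp κ) :
    ∃ L > (1 : ℝ), ∃ C : ℝ≥0∞, C ≠ ∞ ∧ ∀ ε > (0 : ℝ), ∀ (x₀ : X) (R : ℝ) (v : X → ℝ),
      Measurable v → MemLp v (ENNReal.ofReal p) μ → (∀ x ∉ ball x₀ R, v x = 0) →
      ∃ U : X → ℝ, Continuous U ∧ (∀ x ∉ ball x₀ (R + L * ε), U x = 0) ∧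
        pnorm p μ (v - U) ≤ C * wEnergy p μ (avgWeight μ (L * ε) ε) v ∧
        wEnergy p μ (κ.near ε) U
          ≤ C * ENNReal.ofReal (1 / Υ ε) * wEnergy p μ (avgWeight μ (L * ε) ε) v ∧
        ∀ η : ℝ, (∀ x y, dist x y < L * ε → |v x - v y| ≤ η) → ∀ x, |U x - v x| ≤ η := by
  obtain ⟨A, hA, C₀, hC₀, hfam⟩ := hCE.exists_family
  obtain ⟨C₁, hC₁, hdev⟩ := exists_dev_le (μ := μ) hp.le hV A
  obtain ⟨N, hN⟩ := hV.exists_card_le (A + 2)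
  obtain ⟨N₁, hN₁⟩ := hV.exists_overlap 1
  have hp0 : 0 < p := by linarith
  have h2p := two_rpow_ne_top hp0.le
  have hNp : (N : ℝ≥0∞) ^ (p - 1) ≠ ∞ :=
    ENNReal.rpow_ne_top_of_nonneg (by linarith) (ENNReal.natCast_ne_top N)
  set K : ℝ≥0∞ := (N : ℝ≥0∞) ^ (p - 1) * (N * C₁) with hK
  have hKt : K ≠ ∞ := ENNReal.mul_ne_top hNp (ENNReal.mul_ne_top (ENNReal.natCast_ne_top N) hC₁)
  set K₁ : ℝ≥0∞ := 2 ^ p * (C₁ + K) * N₁ with hK₁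
  set K₂ : ℝ≥0∞ := 2 ^ p * (N : ℝ≥0∞) ^ (p - 1) * N * ENNReal.ofReal C₀ * K * N₁ with hK₂
  refine ⟨A + 4, by linarith, K₁ + K₂, ?_, fun ε hε x₀ R v hvm hvp hv0 => ?_⟩
  · refine ENNReal.add_ne_top.2 ⟨?_, ?_⟩ <;> finiteness
  obtain ⟨Φ, hΦ, hΦE⟩ := hfam ε hε
  -- `U` vanishes off `B(x₀, R + (A+1)ε)`. The extra `ε` ensures that a pair at distance below `ε`
  -- either lies in the region covered by the net or consists of two zeros of `U`.
  set ρ := R + (A + 2) * ε with hρ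
  obtain ⟨J, hJ, hJx, hJc⟩ := hV.exists_net x₀ ρ hε
  set a := ballAvg μ v ε with ha
  set U := disc Φ J a with hU
  set G := osc p μ ((A + 4) * ε) ε v with hG
  set D := wEnergy p μ (avgWeight μ ((A + 4) * ε) ε) v with hD
  have hYε := hΥ.pos hε
  have hUsupp : ∀ x, U x ≠ 0 → dist x x₀ < R + (A + 1) * ε := by
    intro x hx
    obtain ⟨j, hj, haj, hxj⟩ := hΦ.exists_of_disc_ne_zero hx
    obtain ⟨y, hy, hvy⟩ := exists_of_ballAvg_ne_zero haj
    have hyR : dist y x₀ < R := by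
      by_contra h
      exact hvy (hv0 y h)
    have h1 := dist_triangle x j x₀
    have h2 := dist_triangle j y x₀
    rw [mem_ball'] at hy
    linarith
  have hUcont : Continuous U := hΦ.continuous_disc
  -- For `x ∈ B(j,ε)` and `y ∈ B(x,ε)`, a cutoff `Φ i` that is nonzero at `x` or `y` has `d(i,j) <
  -- (A+2)ε`. So only `I j` matters, and it has at most `N` elements.
  let I : X → Finset X := fun j => J.filter fun i => dist i j < (A + 2) * ε
  have hIJ : ∀ j, I j ⊆ J := fun j => Finset.filter_subset _ _
  have hIcard : ∀ j, (I j).card ≤ N := fun j =>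
    hN ε j (I j) hε (hJ.filter _) fun i hi => (Finset.mem_filter.1 hi).2
  -- A sum instead of a maximum: it dominates each difference, and its `p`-th power splits over the
  -- boundedly many indices.
  let M : X → ℝ := fun j => ∑ i ∈ I j, |a i - a j|
  have hM0 : ∀ j, 0 ≤ M j := fun j => Finset.sum_nonneg fun _ _ => abs_nonneg _
  have hMle : ∀ j, ∀ i ∈ I j, |a i - a j| ≤ M j := fun j i hi =>
    Finset.single_le_sum (f := fun i => |a i - a j|) (fun _ _ => abs_nonneg _) hi
  have hMG : ∀ j, ENNReal.ofReal (M j) ^ p * μ (ball j ε) ≤ K * ∫⁻ x in ball j ε, G x ∂μ := by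
    intro j
    calc _ ≤ (N : ℝ≥0∞) ^ (p - 1) * (∑ i ∈ I j, ‖a i - a j‖ₑ ^ p) * μ (ball j ε) := by
          gcongr
          exact ofReal_sum_abs_rpow_le hp.le _ _ (hIcard j)
      _ = (N : ℝ≥0∞) ^ (p - 1) * ∑ i ∈ I j, ‖a i - a j‖ₑ ^ p * μ (ball j ε) := by
          rw [mul_assoc, Finset.sum_mul]
      _ ≤ (N : ℝ≥0∞) ^ (p - 1) * ∑ i ∈ I j, C₁ * ∫⁻ x in ball j ε, G x ∂μ := by
          refine mul_le_mul_right (Finset.sum_le_sum fun i hi => ?_) _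
          exact (hdev ε hε v hvp i j (Finset.mem_filter.1 hi).2).2
      _ ≤ (N : ℝ≥0∞) ^ (p - 1) * (N * (C₁ * ∫⁻ x in ball j ε, G x ∂μ)) := by
          rw [Finset.sum_const, nsmul_eq_mul]
          gcongr
          exact hIcard j
      _ = _ := by rw [hK]; ring
  have hGsum : ∑ j ∈ J, ∫⁻ x in ball j ε, G x ∂μ ≤ N₁ * D := by
    have := hN₁ ε J hε hJ μ Set.univ (fun _ _ => Set.subset_univ _) G
    rw [one_mul, Measure.restrict_univ] at this
    exact this
  -- Both required bounds reduce to estimates on single net balls; bounded overlap reassembles the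
  -- oscillation.
  have hsum : ∀ (f : X → ℝ≥0∞) (c : ℝ≥0∞), (∀ x ∉ ball x₀ ρ, f x = 0) →
      (∀ j ∈ J, ∫⁻ x in ball j ε, f x ∂μ ≤ c * ∫⁻ x in ball j ε, G x ∂μ) →
      ∫⁻ x, f x ∂μ ≤ c * N₁ * D := by
    intro f c hf0 hf
    calc ∫⁻ x, f x ∂μ = ∫⁻ x in ball x₀ ρ, f x ∂μ := by
          rw [← lintegral_indicator measurableSet_ball]
          refine lintegral_congr fun x => ?_
          by_cases h : x ∈ ball x₀ ρ
          · rw [Set.indicator_of_mem h]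
          · rw [Set.indicator_of_notMem h, hf0 x h]
      _ ≤ ∑ j ∈ J, ∫⁻ x in ball j ε, f x ∂μ := lintegral_le_sum_ball (fun y hy => hJc y hy) f
      _ ≤ ∑ j ∈ J, c * ∫⁻ x in ball j ε, G x ∂μ := Finset.sum_le_sum hf
      _ ≤ c * (N₁ * D) := by rw [← Finset.mul_sum]; gcongr
      _ = _ := by ring
  have hUa : ∀ j ∈ J, ∀ x ∈ ball j ε, |U x - a j| ≤ M j := by
    intro j hj x hx
    refine hΦ.abs_disc_sub_le ⟨j, hj, hx⟩ fun i hi hxi => hMle j i ?_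
    refine Finset.mem_filter.2 ⟨hi, ?_⟩
    have := dist_triangle_left i j x
    rw [mem_ball] at hx
    linarith
  have hR : ∀ x ∉ ball x₀ ρ, v x = 0 ∧ U x = 0 := by
    intro x hx
    rw [mem_ball, not_lt] at hx
    refine ⟨hv0 x ?_, ?_⟩
    · rw [mem_ball, not_lt]; nlinarith
    · by_contra h
      have := hUsupp x h
      linarith
  refine ⟨U, hUcont, fun x hx => ?_, ?_, ?_, ?_⟩
  · by_contra h
    have := hUsupp x h
    rw [mem_ball, not_lt] at hx
    linarith
  · refine le_trans (hsum _ (2 ^ p * (C₁ + K)) (fun x hx => ?_) fun j hj => ?_) ?_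
    · rw [Pi.sub_apply, (hR x hx).1, (hR x hx).2, sub_zero, enorm_zero,
        ENNReal.zero_rpow_of_pos hp0]
    · calc ∫⁻ x in ball j ε, ‖(v - U) x‖ₑ ^ p ∂μ
          ≤ ∫⁻ x in ball j ε, 2 ^ p * (C₁ * G x + ENNReal.ofReal (M j) ^ p) ∂μ := by
            refine setLIntegral_mono' measurableSet_ball fun x hx => ?_
            have e : (v - U) x = (v x - a j) + (a j - U x) := by rw [Pi.sub_apply]; ring
            rw [e]
            refine (enorm_add_rpow_le hp.le _ _).trans ?_
            gcongr
            · exact (hdev ε hε v hvp j j (by rw [dist_self]; positivity)).1 x hx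
            · rw [Real.enorm_eq_ofReal_abs, abs_sub_comm]
              exact ENNReal.ofReal_le_ofReal (hUa j hj x hx)
        _ = 2 ^ p * (C₁ * ∫⁻ x in ball j ε, G x ∂μ + ENNReal.ofReal (M j) ^ p * μ (ball j ε)) := by
            rw [lintegral_const_mul' _ _ h2p, lintegral_add_right _ measurable_const,
              lintegral_const_mul' _ _ hC₁, setLIntegral_const]
        _ ≤ 2 ^ p * (C₁ * ∫⁻ x in ball j ε, G x ∂μ + K * ∫⁻ x in ball j ε, G x ∂μ) := by
            refine mul_le_mul_right (add_le_add_right (hMG j) _) _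
        _ = _ := by ring
    · gcongr
      exact le_self_add
  · rw [wEnergy_near]
    refine le_trans (hsum _ (2 ^ p * (N : ℝ≥0∞) ^ (p - 1) * N * ENNReal.ofReal C₀ * K *
      ENNReal.ofReal (1 / Υ ε)) (fun x hx => ?_) fun j hj => ?_) ?_
    · refine setLIntegral_eq_zero measurableSet_ball fun y hy => ?_
      have hUy : U y = 0 := by
        by_contra h
        have h1 := hUsupp y h
        rw [mem_ball, not_lt] at hx
        rw [mem_ball'] at hy
        have := dist_triangle x y x₀
        linarith
      rw [(hR x hx).2, hUy]
      simp [hp0]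
    · have hpt : ∀ x ∈ ball j ε, ∀ y ∈ ball x ε, ‖U x - U y‖ₑ ^ p
          ≤ (2 ^ p * ENNReal.ofReal (M j) ^ p * (N : ℝ≥0∞) ^ (p - 1)) *
            ∑ i ∈ I j, ‖Φ i x - Φ i y‖ₑ ^ p := by
        intro x hx y hy
        rw [mem_ball] at hx
        rw [mem_ball'] at hy
        by_cases hin : dist x x₀ < ρ ∧ dist y x₀ < ρ
        · have h1 := hΦ.abs_disc_sub_disc_le (a := a) (c := a j) (hJc x hin.1) (hJc y hin.2) (hIJ j)
            (fun i hi hor => Finset.mem_filter.2 ⟨hi, by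
              rcases hor with h | h
              · have := dist_triangle_left i j x
                linarith
              · have := dist_triangle_left i x y
                have := dist_triangle i x j
                rw [dist_comm y x] at *
                linarith⟩) (hM0 j) (hMle j)
          have h2 : ‖U x - U y‖ₑ
              ≤ 2 * ENNReal.ofReal (M j) * ENNReal.ofReal (∑ i ∈ I j, |Φ i x - Φ i y|) := by
            rw [Real.enorm_eq_ofReal_abs]
            refine (ENNReal.ofReal_le_ofReal h1).trans (le_of_eq ?_)
            rw [ENNReal.ofReal_mul (by have := hM0 j; positivity), ENNReal.ofReal_mul zero_le_two,
              ENNReal.ofReal_ofNat]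
          calc ‖U x - U y‖ₑ ^ p
              ≤ (2 * ENNReal.ofReal (M j) * ENNReal.ofReal (∑ i ∈ I j, |Φ i x - Φ i y|)) ^ p :=
                ENNReal.rpow_le_rpow h2 hp0.le
            _ = 2 ^ p * ENNReal.ofReal (M j) ^ p
                  * ENNReal.ofReal (∑ i ∈ I j, |Φ i x - Φ i y|) ^ p := by
                rw [ENNReal.mul_rpow_of_nonneg _ _ hp0.le, ENNReal.mul_rpow_of_nonneg _ _ hp0.le]
            _ ≤ 2 ^ p * ENNReal.ofReal (M j) ^ p
                  * ((N : ℝ≥0∞) ^ (p - 1) * ∑ i ∈ I j, ‖Φ i x - Φ i y‖ₑ ^ p) := by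
                gcongr
                exact ofReal_sum_abs_rpow_le hp.le _ _ (hIcard j)
            _ = _ := by ring
        -- If either point leaves `B(x₀, ρ)`, both are at distance at least `ρ - ε = R + (A+1)ε`
        -- from `x₀`, where `U = 0`.
        · have hxy : ρ - ε ≤ dist x x₀ ∧ ρ - ε ≤ dist y x₀ := by
            have t1 := dist_triangle x y x₀
            have t2 := dist_triangle_left y x₀ x
            by_contra! h
            apply hin
            constructor <;> by_contra! h'
            · have := h (by linarith)
              linarith
            · have : ρ - ε ≤ dist x x₀ := by linarith
              have := h this
              linarith
          have hx0 : U x = 0 := by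
            by_contra h
            have := hUsupp x h
            linarith [hxy.1]
          have hy0 : U y = 0 := by
            by_contra h
            have := hUsupp y h
            linarith [hxy.2]
          rw [hx0, hy0, sub_zero, enorm_zero, ENNReal.zero_rpow_of_pos hp0]
          exact zero_le
      have hgm : ∀ i, Measurable fun z : X × X => ‖Φ i z.1 - Φ i z.2‖ₑ ^ p * κ.k z.1 z.2 :=
        fun i => (measurable_enorm_sub (hΦ.cont i).measurable).mul κ.measurable_k
      set T := 2 ^ p * ENNReal.ofReal (M j) ^ p * (N : ℝ≥0∞) ^ (p - 1) with hT
      have hTt : T ≠ ∞ := ENNReal.mul_ne_top (ENNReal.mul_ne_top h2p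
        (ENNReal.rpow_ne_top_of_nonneg hp0.le ENNReal.ofReal_ne_top)) hNp
      calc ∫⁻ x in ball j ε, ∫⁻ y in ball x ε, ‖U x - U y‖ₑ ^ p * κ.k x y ∂μ ∂μ
          ≤ ∫⁻ x in ball j ε, T * ∑ i ∈ I j, ∫⁻ y, ‖Φ i x - Φ i y‖ₑ ^ p * κ.k x y ∂μ ∂μ := by
            refine setLIntegral_mono' measurableSet_ball fun x hx => ?_
            have hmx : ∀ i, Measurable fun y => ‖Φ i x - Φ i y‖ₑ ^ p * κ.k x y :=
              fun i => (hgm i).comp measurable_prodMk_left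
            rw [← lintegral_finsetSum _ fun i _ => hmx i, ← lintegral_const_mul' _ _ hTt]
            refine (setLIntegral_mono' measurableSet_ball fun y hy => ?_).trans
              (setLIntegral_le_lintegral _ _)
            rw [← Finset.sum_mul, ← mul_assoc]
            gcongr
            exact hpt x hx y hy
        _ = T * ∑ i ∈ I j, ∫⁻ x in ball j ε, ∫⁻ y, ‖Φ i x - Φ i y‖ₑ ^ p * κ.k x y ∂μ ∂μ := by
            rw [lintegral_const_mul' _ _ hTt, lintegral_finsetSum _ fun i _ =>
              (hgm i).lintegral_prod_right']
        _ ≤ T * ∑ i ∈ I j, ENNReal.ofReal (C₀ * (vol μ j ε / Υ ε)) := by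
            gcongr with i hi
            exact hΦE i j
        _ ≤ T * (N * ENNReal.ofReal (C₀ * (vol μ j ε / Υ ε))) := by
            rw [Finset.sum_const, nsmul_eq_mul]
            gcongr
            exact hIcard j
        _ = 2 ^ p * (N : ℝ≥0∞) ^ (p - 1) * N * ENNReal.ofReal C₀ * ENNReal.ofReal (1 / Υ ε) *
              (ENNReal.ofReal (M j) ^ p * μ (ball j ε)) := by
            rw [hT, ENNReal.ofReal_mul hC₀.le, div_eq_mul_one_div,
              ENNReal.ofReal_mul (vol_pos j hε).le, ofReal_vol]
            ring
        _ ≤ 2 ^ p * (N : ℝ≥0∞) ^ (p - 1) * N * ENNReal.ofReal C₀ * ENNReal.ofReal (1 / Υ ε) *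
              (K * ∫⁻ x in ball j ε, G x ∂μ) := by
            exact mul_le_mul_right (hMG j) _
        _ = _ := by ring
    · calc _ = K₂ * ENNReal.ofReal (1 / Υ ε) * D := by rw [hK₂]; ring
        _ ≤ _ := by
          gcongr
          exact le_add_self
  · intro η hη x
    have hη0 : 0 ≤ η := by
      have := hη x x (by rw [dist_self]; positivity)
      rwa [sub_self, abs_zero] at this
    by_cases hx : x ∈ ball x₀ ρ
    · refine hΦ.abs_disc_sub_le (hJc x hx) fun i hi hxi => ?_
      have hloc : LocallyIntegrable v μ := hvp.locallyIntegrable (by simpa using hp.le)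
      -- The averages that enter `U x` are over balls `B(i,ε)` with `d(x,i) < Aε`; their points are
      -- within `(A+1)ε` of `x`.
      refine abs_ballAvg_sub_le hloc hε fun y hy => hη y x ?_
      have := dist_triangle_right y x i
      rw [mem_ball] at hy
      nlinarith
    · rw [(hR x hx).1, (hR x hx).2, sub_zero, abs_zero]
      exact hη0

end approx

/-! ### Regularity of non-local forms -/

section regular

variable {X : Type*} [MetricSpace X] [ProperSpace X] [MeasurableSpace X] [BorelSpace X]
  {μ : Measure X} [IsFiniteMeasureOnCompacts μ] [μ.IsOpenPosMeasure] {p : ℝ} {Υ : ℝ → ℝ}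

lemma pnorm_add_le (hp : 1 ≤ p) {u : X → ℝ} (hu : Measurable u) (v : X → ℝ) :
    pnorm p μ (u + v) ≤ 2 ^ p * (pnorm p μ u + pnorm p μ v) := by
  unfold pnorm
  rw [← lintegral_add_left (hu.enorm.pow_const p),
    ← lintegral_const_mul' _ _ (two_rpow_ne_top (by linarith))]
  exact lintegral_mono fun x => enorm_add_rpow_le hp _ _

lemma pnorm_neg (v : X → ℝ) : pnorm p μ (-v) = pnorm p μ v := by
  simp [pnorm]

lemma wEnergy_neg (w : X → X → ℝ≥0∞) (v : X → ℝ) : wEnergy p μ w (-v) = wEnergy p μ w v := by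
  unfold wEnergy
  refine lintegral_congr fun x => lintegral_congr fun y => ?_
  rw [Pi.neg_apply, Pi.neg_apply, neg_sub_neg, enorm_sub_rev]

/-- The averaged oscillation is bounded on `L^p`. -/
lemma exists_avg_le_pnorm (hp : 1 ≤ p) (hV : VolumeDoubling μ) {L : ℝ} (hL : 1 < L) :
    ∃ C : ℝ≥0∞, C ≠ ∞ ∧ ∀ ε > (0 : ℝ), ∀ v : X → ℝ, Measurable v →
      wEnergy p μ (avgWeight μ (L * ε) ε) v ≤ C * pnorm p μ v := by
  obtain ⟨C, hC, hvol⟩ := hV.exists_le (2 * L)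
  refine ⟨2 ^ p * 2 * ENNReal.ofReal C, by have := two_rpow_ne_top (p := p) (by linarith); finiteness,
    fun ε hε v hv => ?_⟩
  have hpos := fun x : X => (measure_ball_pos μ x hε).ne'
  have htop := fun x : X => measure_ball_ne_top (μ := μ) x ε
  -- The weight is normalized at `x`. Volume comparison moves the normalization to `y`, which bounds
  -- the marginal in the other variable; `y = x` serves the first marginal.
  have key : ∀ x y : X, y ∈ ball x (L * ε) → (μ (ball x ε))⁻¹
      ≤ ENNReal.ofReal C * (μ (ball y (L * ε)))⁻¹ := by
    intro x y hy
    have hLε : 0 < L * ε := by positivity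
    refine inv_le_mul_inv (measure_ball_pos μ y hLε).ne' (measure_ball_ne_top _ _) (hpos x)
      (htop x) ?_
    rw [← ofReal_vol, ← ofReal_vol, ← ENNReal.ofReal_mul hC.le]
    rw [mem_ball'] at hy
    exact ENNReal.ofReal_le_ofReal (hvol x y _ ε hε (by linarith))
  refine wEnergy_le_pnorm hp (measurable_avgWeight _ _) (fun x => ?_) (fun y => ?_) hv
  · have := lintegral_mul_avgWeight (μ := μ) (L * ε) ε x fun _ => 1
    simp only [one_mul] at this
    rw [this, setLIntegral_const]
    refine (mul_le_mul_left (key x x (mem_ball_self (by positivity))) _).trans ?_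
    rw [mul_assoc, ENNReal.inv_mul_cancel (measure_ball_pos μ x (by positivity)).ne'
      (measure_ball_ne_top _ _), mul_one]
  · calc ∫⁻ x, avgWeight μ (L * ε) ε x y ∂μ
        ≤ ∫⁻ x, (ball y (L * ε)).indicator
            (fun _ => ENNReal.ofReal C * (μ (ball y (L * ε)))⁻¹) x ∂μ := by
          refine lintegral_mono fun x => ?_
          by_cases h : dist x y < L * ε
          · have h1 : y ∈ ball x (L * ε) := by rwa [mem_ball']
            have h2 : x ∈ ball y (L * ε) := h
            rw [avgWeight, Set.indicator_of_mem h1, Set.indicator_of_mem h2]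
            exact key x y h1
          · have h1 : y ∉ ball x (L * ε) := by rwa [mem_ball']
            rw [avgWeight, Set.indicator_of_notMem h1]
            exact zero_le
      _ = _ := by
          rw [lintegral_indicator measurableSet_ball, setLIntegral_const, mul_assoc,
            ENNReal.inv_mul_cancel (measure_ball_pos μ y (by positivity)).ne'
            (measure_ball_ne_top _ _), mul_one]

/-- The averaged oscillation is controlled by the near-diagonal energy. -/
lemma exists_avg_le_near (hp : 1 ≤ p) (κ : StableKernel μ Υ) (hΥ : IsDoublingFunction Υ)
    (hV : VolumeDoubling μ) (L : ℝ) : ∃ C > (0 : ℝ), ∀ ε > (0 : ℝ), ∀ v : X → ℝ,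
      wEnergy p μ (avgWeight μ (L * ε) ε) v
        ≤ ENNReal.ofReal (C * Υ ε) * wEnergy p μ (κ.near (L * ε)) v := by
  obtain ⟨C, hC, hK⟩ := κ.exists_ge hΥ hV L
  refine ⟨C, hC, fun ε hε v => wEnergy_mono (by linarith) ENNReal.ofReal_ne_top
    (fun x y hxy => ?_) v⟩
  have hYε := hΥ.pos hε
  have hvε := vol_pos (μ := μ) x hε
  by_cases h : y ∈ ball x (L * ε)
  · rw [avgWeight, StableKernel.near, Set.indicator_of_mem h, Set.indicator_of_mem h,
      ← ofReal_vol, ← ENNReal.ofReal_inv_of_pos hvε, StableKernel.k,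
      ← ENNReal.ofReal_mul (by positivity)]
    refine ENNReal.ofReal_le_ofReal ?_
    have := hK x y ε hε hxy (mem_ball'.1 h).le
    calc (vol μ x ε)⁻¹ = Υ ε * (1 / (vol μ x ε * Υ ε)) := by field_simp
      _ ≤ Υ ε * (C * κ.K x y) := by gcongr
      _ = _ := by ring
  · rw [avgWeight, Set.indicator_of_notMem h]
    exact zero_le

/-- Continuity from above of the finite measure with density `f`. It serves both limits below:
strips shrinking to the diagonal, and complements of growing balls. -/
lemma exists_setLIntegral_lt {α : Type*} [MeasurableSpace α] {ν : Measure α} {f : α → ℝ≥0∞}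
    (hf : ∫⁻ x, f x ∂ν ≠ ∞) {S : ℕ → Set α} (hS : ∀ n, MeasurableSet (S n)) (hanti : Antitone S)
    (h0 : ∀ x ∈ ⋂ n, S n, f x = 0) {τ : ℝ≥0∞} (hτ : 0 < τ) :
    ∃ n, ∫⁻ x in S n, f x ∂ν < τ := by
  have hρ : ∀ n, (ν.withDensity f) (S n) = ∫⁻ x in S n, f x ∂ν := fun n =>
    withDensity_apply _ (hS n)
  have hfin : (ν.withDensity f) (S 0) ≠ ∞ := by
    rw [hρ]
    exact ne_top_of_le_ne_top hf (setLIntegral_le_lintegral _ _)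
  have ht := tendsto_measure_iInter_atTop (μ := ν.withDensity f)
    (fun n => (hS n).nullMeasurableSet) hanti ⟨0, hfin⟩
  have hz : (ν.withDensity f) (⋂ n, S n) = 0 := by
    rw [withDensity_apply _ (MeasurableSet.iInter hS)]
    exact setLIntegral_eq_zero (MeasurableSet.iInter hS) h0
  rw [hz] at ht
  obtain ⟨n, hn⟩ := (ht.eventually_lt_const hτ).exists
  exact ⟨n, by rwa [← hρ]⟩

lemma exists_near_lt (hp : 0 < p) (κ : StableKernel μ Υ) {u : X → ℝ} (hu : Measurable u)
    (hE : jumpEnergy p μ κ.K u ≠ ∞) {L : ℝ} (hL : 0 < L) {τ : ℝ≥0∞} (hτ : 0 < τ) :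
    ∃ ε > (0 : ℝ), ε ≤ 1 ∧ wEnergy p μ (κ.near (L * ε)) u < τ := by
  let g : X × X → ℝ≥0∞ := fun z => ‖u z.1 - u z.2‖ₑ ^ p * κ.k z.1 z.2
  have hg : Measurable g := (measurable_enorm_sub hu).mul κ.measurable_k
  let S : ℕ → Set (X × X) := fun n => {z | dist z.2 z.1 < L * (1 / (n + 1))}
  have hS : ∀ n, MeasurableSet (S n) := fun n =>
    measurableSet_lt (measurable_snd.dist measurable_fst) measurable_const
  have hanti : Antitone S := by
    intro m n hmn z hz
    have hz' : dist z.2 z.1 < L * (1 / (n + 1)) := hz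
    have hmn' : (m : ℝ) ≤ n := by exact_mod_cast hmn
    have hle : L * (1 / ((n : ℝ) + 1)) ≤ L * (1 / (m + 1)) := by gcongr
    exact lt_of_lt_of_le hz' hle
  have h0 : ∀ z ∈ ⋂ n, S n, g z = 0 := by
    intro z hz
    have hd : dist z.2 z.1 = 0 := by
      refine le_antisymm (le_of_forall_pos_le_add fun τ hτ => ?_) dist_nonneg
      obtain ⟨n, hn⟩ := exists_nat_one_div_lt (show 0 < τ / L by positivity)
      have h1 : dist z.2 z.1 < L * (1 / (n + 1)) := Set.mem_iInter.1 hz n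
      rw [lt_div_iff₀ hL] at hn
      linarith
    have := dist_eq_zero.1 hd
    simp [g, this, hp]
  have hfin : ∫⁻ z, g z ∂(μ.prod μ) ≠ ∞ := by
    rw [lintegral_prod _ hg.aemeasurable]
    exact hE
  obtain ⟨n, hn⟩ := exists_setLIntegral_lt hfin hS hanti h0 hτ
  refine ⟨1 / (n + 1), by positivity, ?_, lt_of_le_of_lt (le_of_eq ?_) hn⟩
  · rw [div_le_one (by positivity)]
    linarith [(Nat.cast_nonneg n : (0 : ℝ) ≤ n)]
  · rw [← lintegral_indicator (hS n), lintegral_prod _ (hg.indicator (hS n)).aemeasurable]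
    refine lintegral_congr fun x => lintegral_congr fun y => ?_
    by_cases h : dist y x < L * (1 / (n + 1))
    · rw [Set.indicator_of_mem (by exact h), StableKernel.near, Set.indicator_of_mem (by exact h)]
    · rw [Set.indicator_of_notMem (by exact h), StableKernel.near,
        Set.indicator_of_notMem (by exact h), mul_zero]

lemma exists_pnorm_compl_lt (hp : 0 < p) {u : X → ℝ} (hu : pnorm p μ u ≠ ∞) (x₀ : X) {τ : ℝ≥0∞}
    (hτ : 0 < τ) : ∃ R : ℝ, pnorm p μ (u - (ball x₀ R).indicator u) < τ := by
  obtain ⟨n, hn⟩ := exists_setLIntegral_lt (S := fun n : ℕ => (ball x₀ n)ᶜ) hu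
    (fun n => measurableSet_ball.compl)
    (fun m n hmn => Set.compl_subset_compl.2 (ball_subset_ball (by exact_mod_cast hmn)))
    (fun x hx => by
      obtain ⟨n, hn⟩ := exists_nat_gt (dist x x₀)
      exact absurd hn (Set.mem_iInter.1 hx n)) hτ
  refine ⟨n, lt_of_le_of_lt (le_of_eq ?_) hn⟩
  rw [pnorm, ← lintegral_indicator measurableSet_ball.compl]
  refine lintegral_congr fun x => ?_
  by_cases h : x ∈ ball x₀ (n : ℝ)
  · rw [Set.indicator_of_notMem (by simpa using h), Pi.sub_apply, Set.indicator_of_mem h, sub_self,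
      enorm_zero, ENNReal.zero_rpow_of_pos hp]
  · rw [Set.indicator_of_mem (by simpa using h), Pi.sub_apply, Set.indicator_of_notMem h, sub_zero]

lemma hasCompactSupport_of_eq_zero {U : X → ℝ} {x₀ : X} {R : ℝ} (h : ∀ x ∉ ball x₀ R, U x = 0) :
    HasCompactSupport U :=
  HasCompactSupport.intro (isCompact_closedBall x₀ R) fun x hx =>
    h x fun hx' => hx (ball_subset_closedBall hx')

/-- Continuous compactly supported functions of finite near-diagonal energy are in the core. -/
lemma mem_core_of_near (hp : 1 < p) {κ : StableKernel μ Υ} (hΥ : IsDoublingFunction Υ)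
    (hV : VolumeDoubling μ) {U : X → ℝ} (hU : Continuous U) (hUs : HasCompactSupport U) {ε : ℝ}
    (hε : 0 < ε) (h : wEnergy p μ (κ.near ε) U ≠ ∞) : U ∈ (nonlocalForm hp κ).core := by
  obtain ⟨C, hC, hE⟩ := κ.exists_energy_le hΥ hV hp.le
  have hm : MemLp U (ENNReal.ofReal p) μ := hU.memLp_of_hasCompactSupport hUs
  refine ⟨⟨hm, ne_top_of_le_ne_top ?_ (hE ε hε U hU.measurable)⟩, hU, hUs⟩
  exact ENNReal.add_ne_top.2 ⟨h, ENNReal.mul_ne_top ENNReal.ofReal_ne_top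
    ((memLp_iff_pnorm (by linarith) U).1 hm).2⟩

/-- Quantitative approximation in the domain by functions in the core. -/
lemma exists_core_approx (hp : 1 < p) {κ : StableKernel μ Υ} (hΥ : IsDoublingFunction Υ)
    (hV : VolumeDoubling μ) (hCE : NonlocalCEStrong hp κ) (x₀ : X) :
    ∃ L > (1 : ℝ), ∃ a : ℝ≥0∞, a ≠ ∞ ∧ ∀ ε > (0 : ℝ), ε ≤ 1 → ∃ b : ℝ≥0∞, b ≠ ∞ ∧
      ∀ (R : ℝ) (u : X → ℝ), Measurable u → MemLp u (ENNReal.ofReal p) μ →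
        ∃ U ∈ (nonlocalForm hp κ).core, jumpEnergy p μ κ.K (u - U) + pnorm p μ (u - U)
          ≤ a * wEnergy p μ (κ.near (L * ε)) u
            + b * pnorm p μ (u - (ball x₀ R).indicator u) := by
  obtain ⟨L, hL, C₁, hC₁, hdisc⟩ := exists_discretization hp hΥ hV hCE
  obtain ⟨C₂, hC₂, havg⟩ := exists_avg_le_pnorm (μ := μ) hp.le hV hL
  obtain ⟨C₃, hC₃, hnear⟩ := exists_avg_le_near hp.le κ hΥ hV L
  obtain ⟨C₄, hC₄, hE⟩ := κ.exists_energy_le hΥ hV hp.le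
  obtain ⟨C₅, hC₅, hY1⟩ := hΥ.exists_le 1
  have hp0 : 0 < p := by linarith
  set t : ℝ≥0∞ := 2 ^ p with ht
  have htt : t ≠ ∞ := two_rpow_ne_top hp0.le
  set c₃ := ENNReal.ofReal C₃
  set c₄ := ENNReal.ofReal C₄
  set M := ENNReal.ofReal (C₅ * Υ 1)
  have hc₃ : c₃ ≠ ∞ := ENNReal.ofReal_ne_top
  have hc₄ : c₄ ≠ ∞ := ENNReal.ofReal_ne_top
  have hM : M ≠ ∞ := ENNReal.ofReal_ne_top
  -- The coefficient of the near-diagonal energy must not depend on `ε`; that of the truncation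
  -- error may.
  refine ⟨L, hL, t + t * c₃ * (t * C₁ + c₄ * t * C₁ + t * C₁ * M), by finiteness,
    fun ε hε hε1 => ?_⟩
  have hYε := hΥ.pos hε
  set r := ENNReal.ofReal (1 / Υ ε)
  set y := ENNReal.ofReal (Υ ε)
  have hr : r ≠ ∞ := ENNReal.ofReal_ne_top
  -- This is the cancellation between the energy cost `1/Υ ε` of the discretization and the gain `Υ
  -- ε` in the averaged oscillation. Any `y` left over is bounded by `M`, as `ε ≤ 1`.
  have hry : r * y = 1 := by
    rw [← ENNReal.ofReal_mul (by positivity), one_div, inv_mul_cancel₀ hYε.ne', ENNReal.ofReal_one]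
  have hyM : y ≤ M := ENNReal.ofReal_le_ofReal (hY1 1 ε one_pos hε (by linarith))
  refine ⟨(c₄ * r + 1) * t + (t * C₁ * r + (c₄ * r + 1) * (t * C₁)) * t * C₂, by finiteness,
    fun R u hu hum => ?_⟩
  set v := (ball x₀ R).indicator u with hv
  have hvm : Measurable v := hu.indicator measurableSet_ball
  have hvL : MemLp v (ENNReal.ofReal p) μ := hum.indicator measurableSet_ball
  obtain ⟨U, hU, hUs, hPU, hNU, -⟩ := hdisc ε hε x₀ R v hvm hvL fun x hx =>
    Set.indicator_of_notMem hx _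
  have hUm := hU.measurable
  set D := wEnergy p μ (avgWeight μ (L * ε) ε) v with hD
  set q := wEnergy p μ (κ.near (L * ε)) u with hq
  set w := pnorm p μ (u - v) with hw
  have hDtop : D ≠ ∞ := ne_top_of_le_ne_top
    (ENNReal.mul_ne_top hC₂ ((memLp_iff_pnorm hp0 v).1 hvL).2) (havg ε hε v hvm)
  -- The oscillation of the truncation `v = u - (u - v)` is split so that `u` is charged to its
  -- energy and `u - v` to its `L^p` norm; no energy bound for `v` is needed.
  have hDle : D ≤ t * (c₃ * y * q + C₂ * w) := by
    have hsplit : v = u + -(u - v) := by abel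
    have h1 := wEnergy_add_le (μ := μ) (v := -(u - v)) hp.le (measurable_avgWeight (μ := μ) (L * ε) ε) hu
    rw [← hsplit, wEnergy_neg] at h1
    refine h1.trans (mul_le_mul_right (add_le_add ?_ (havg ε hε _ (hu.sub hvm))) _)
    have h2 := hnear ε hε u
    rwa [ENNReal.ofReal_mul hC₃.le] at h2
  have hnq : wEnergy p μ (κ.near ε) u ≤ q := by
    have := wEnergy_mono (μ := μ) (w := κ.near ε) (w' := κ.near (L * ε)) hp0 ENNReal.one_ne_top
      (fun x z _ => by
        rw [one_mul]
        exact Set.indicator_le_indicator_of_subset (ball_subset_ball (by nlinarith))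
          (fun _ => zero_le) z) u
    rwa [one_mul] at this
  have hneg : u - U = u + -U := sub_eq_add_neg u U
  have h1 : wEnergy p μ (κ.near ε) (u - U) ≤ t * (q + C₁ * r * D) := by
    rw [hneg]
    refine (wEnergy_add_le (v := -U) hp.le (κ.measurable_near ε) hu).trans
      (mul_le_mul_right (add_le_add hnq ?_) _)
    rw [wEnergy_neg]
    exact hNU
  have h2 : pnorm p μ (u - U) ≤ t * (w + C₁ * D) := by
    have hsplit : u - U = (u - v) + (v - U) := by abel
    rw [hsplit]
    exact (pnorm_add_le hp.le (hu.sub hvm) _).trans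
      (mul_le_mul_right (add_le_add le_rfl hPU) _)
  have h3 : jumpEnergy p μ κ.K (u - U)
      ≤ wEnergy p μ (κ.near ε) (u - U) + c₄ * r * pnorm p μ (u - U) := by
    have := hE ε hε (u - U) (hu.sub hUm)
    rwa [div_eq_mul_one_div, ENNReal.ofReal_mul hC₄.le] at this
  refine ⟨U, mem_core_of_near hp hΥ hV hU (hasCompactSupport_of_eq_zero hUs) hε
    (ne_top_of_le_ne_top (by finiteness) hNU), ?_⟩
  calc jumpEnergy p μ κ.K (u - U) + pnorm p μ (u - U)
      ≤ t * (q + C₁ * r * D) + c₄ * r * (t * (w + C₁ * D)) + t * (w + C₁ * D) :=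
        add_le_add (h3.trans (add_le_add h1 (mul_le_mul_right h2 _))) h2
    _ = t * q + (c₄ * r + 1) * t * w + (t * C₁ * r + (c₄ * r + 1) * (t * C₁)) * D := by ring
    _ ≤ t * q + (c₄ * r + 1) * t * w
        + (t * C₁ * r + (c₄ * r + 1) * (t * C₁)) * (t * (c₃ * y * q + C₂ * w)) :=
        add_le_add le_rfl (mul_le_mul_right hDle _)
    _ = (t + t * c₃ * (t * C₁ * (r * y) + c₄ * t * C₁ * (r * y) + t * C₁ * y)) * q
        + ((c₄ * r + 1) * t + (t * C₁ * r + (c₄ * r + 1) * (t * C₁)) * t * C₂) * w := by ring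
    _ ≤ _ := by
        rw [hry, mul_one, mul_one]
        refine add_le_add (mul_le_mul_left (add_le_add le_rfl (mul_le_mul_right
          (add_le_add le_rfl (mul_le_mul_right hyM _)) _)) _) le_rfl

/-- `𝓔₁`-density of the core. -/
lemma exists_core_energyOne_le (hp : 1 < p) {κ : StableKernel μ Υ} (hΥ : IsDoublingFunction Υ)
    (hV : VolumeDoubling μ) (hCE : NonlocalCEStrong hp κ) (x₀ : X) {g : X → ℝ}
    (hg : g ∈ (nonlocalForm hp κ).dom) {δ : ℝ} (hδ : 0 < δ) :
    ∃ f ∈ (nonlocalForm hp κ).core, (nonlocalForm hp κ).energyOne (f - g) ^ (1 / p) ≤ δ := by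
  have hp0 : 0 < p := by linarith
  obtain ⟨L, hL, a, ha, happrox⟩ := exists_core_approx hp hΥ hV hCE x₀
  have hgm : AEStronglyMeasurable g μ := hg.1.aestronglyMeasurable
  set u := hgm.mk g with hu
  have hgu : g =ᵐ[μ] u := hgm.ae_eq_mk
  have hum : Measurable u := hgm.stronglyMeasurable_mk.measurable
  have hud := (nonlocalForm hp κ).dom_congr g hg u hgu
  have hδp : 0 < ENNReal.ofReal (δ ^ p) / 2 := by simp; positivity
  -- The order of choices matters: `a` is known, `ε` makes the near-diagonal term small, this fixes
  -- `b`, and only then is `R` chosen.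
  obtain ⟨ε, hε, hε1, hnear⟩ := exists_near_lt hp0 κ hum hud.2 (show 0 < L by linarith)
    (ENNReal.div_pos hδp.ne' ha)
  obtain ⟨b, hb, hU⟩ := happrox ε hε hε1
  obtain ⟨R, hR⟩ := exists_pnorm_compl_lt hp0 ((memLp_iff_pnorm hp0 u).1 hud.1).2 x₀
    (ENNReal.div_pos hδp.ne' hb)
  obtain ⟨U, hUc, hle⟩ := hU R u hum hud.1
  have hmul : ∀ {c x : ℝ≥0∞}, x < ENNReal.ofReal (δ ^ p) / 2 / c →
      c * x ≤ ENNReal.ofReal (δ ^ p) / 2 := fun h =>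
    (mul_le_mul_right h.le _).trans ENNReal.mul_div_le
  have hle' := hle.trans (add_le_add (hmul hnear) (hmul hR))
  rw [ENNReal.add_halves] at hle'
  refine ⟨U, hUc, ?_⟩
  have hsub : u - U =ᵐ[μ] -(U - g) := by
    filter_upwards [hgu] with x hx
    simp [hx]
  have hUg := (nonlocalForm hp κ).dom.sub_mem hUc.1 hg
  have hneg := (nonlocalForm hp κ).dom.neg_mem hUg
  have hval : jumpEnergy p μ κ.K (U - g) + pnorm p μ (U - g)
      = jumpEnergy p μ κ.K (u - U) + pnorm p μ (u - U) := by
    rw [jumpEnergy_congr hsub, jumpEnergy_eq_wEnergy, jumpEnergy_eq_wEnergy, wEnergy_neg,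
      ← pnorm_neg (U - g)]
    congr 1
    refine lintegral_congr_ae ?_
    filter_upwards [hsub] with x hx
    rw [hx]
  rw [energyOne_nonlocalForm hUg, hval, one_div, Real.rpow_inv_le_iff_of_pos
    ENNReal.toReal_nonneg hδ.le hp0]
  exact ENNReal.toReal_le_of_le_ofReal (by positivity) hle'

/-- Uniform approximation by the core, with control of the supports. -/
lemma exists_core_uniform (hp : 1 < p) {κ : StableKernel μ Υ} (hΥ : IsDoublingFunction Υ)
    (hV : VolumeDoubling μ) (hCE : NonlocalCEStrong hp κ) {g : X → ℝ} (hg : Continuous g)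
    {x₀ : X} {R : ℝ} (hgs : ∀ x ∉ ball x₀ R, g x = 0) {η : ℝ} (hη : 0 < η) :
    ∃ f ∈ (nonlocalForm hp κ).core, (∀ x ∉ ball x₀ (R + 1), f x = 0) ∧
      ∀ x, |f x - g x| ≤ η := by
  obtain ⟨L, hL, C, hC, hdisc⟩ := exists_discretization hp hΥ hV hCE
  obtain ⟨C₂, hC₂, havg⟩ := exists_avg_le_pnorm (μ := μ) hp.le hV hL
  have hp0 : 0 < p := by linarith
  have hgc : HasCompactSupport g := hasCompactSupport_of_eq_zero hgs
  have hgL : MemLp g (ENNReal.ofReal p) μ := hg.memLp_of_hasCompactSupport hgc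
  obtain ⟨δ, hδ, hunif⟩ := Metric.uniformContinuous_iff.1
    (hgc.uniformContinuous_of_continuous hg) η hη
  -- `Lε ≤ δ` gives the uniform bound by uniform continuity, and `Lε ≤ 1` keeps the support in
  -- `B(x₀, R+1)`.
  set ε := min δ 1 / L with hεd
  have hε : 0 < ε := by positivity
  have hLε : L * ε = min δ 1 := by rw [hεd]; field_simp
  obtain ⟨U, hU, hUs, -, hN, hη'⟩ := hdisc ε hε x₀ R g hg.measurable hgL hgs
  have hUs' : ∀ x ∉ ball x₀ (R + 1), U x = 0 := fun x hx =>
    hUs x fun h => hx (ball_subset_ball (by rw [hLε]; gcongr; exact min_le_right _ _) h)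
  have hD : wEnergy p μ (avgWeight μ (L * ε) ε) g ≠ ∞ := ne_top_of_le_ne_top
    (ENNReal.mul_ne_top hC₂ ((memLp_iff_pnorm hp0 g).1 hgL).2) (havg ε hε g hg.measurable)
  refine ⟨U, mem_core_of_near hp hΥ hV hU (hasCompactSupport_of_eq_zero hUs) hε
    (ne_top_of_le_ne_top (by finiteness) hN), hUs', hη' η fun x y hxy => ?_⟩
  exact (hunif (hxy.trans_le (by rw [hLε]; exact min_le_left _ _))).le

lemma exists_ball_support {g : X → ℝ} (hg : HasCompactSupport g) (x₀ : X) :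
    ∃ R, ∀ x ∉ ball x₀ R, g x = 0 := by
  obtain ⟨R, hR⟩ := hg.isCompact.isBounded.subset_ball x₀
  exact ⟨R, fun x hx => image_eq_zero_of_notMem_tsupport fun h => hx (hR h)⟩

/-- The domain is dense in `L^p`. -/
lemma exists_dom_eLpNorm_le (hp : 1 < p) {κ : StableKernel μ Υ} (hΥ : IsDoublingFunction Υ)
    (hV : VolumeDoubling μ) (hCE : NonlocalCEStrong hp κ) (x₀ : X) {f : X → ℝ}
    (hf : MemLp f (ENNReal.ofReal p) μ) {δ : ℝ} (hδ : 0 < δ) :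
    ∃ g ∈ (nonlocalForm hp κ).dom,
      eLpNorm (f - g) (ENNReal.ofReal p) μ ≤ ENNReal.ofReal δ := by
  have hp0 : 0 < p := by linarith
  have hp1 : 1 ≤ ENNReal.ofReal p := by simpa using hp.le
  have hδ2 : ENNReal.ofReal (δ / 2) ≠ 0 := by simpa using hδ
  obtain ⟨h, hhc, hle, hcont, hhL⟩ :=
    hf.exists_hasCompactSupport_eLpNorm_sub_le ENNReal.ofReal_ne_top hδ2
  obtain ⟨R, hR⟩ := exists_ball_support hhc x₀
  set S := ball x₀ (R + 1)
  have hS : μ S ^ (1 / p) ≠ ∞ :=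
    ENNReal.rpow_ne_top_of_nonneg (by positivity) (measure_ball_ne_top _ _)
  set T := (μ S ^ (1 / p)).toReal with hT
  have hT0 : 0 ≤ T := ENNReal.toReal_nonneg
  -- The uniform error is scaled by `T = μ(S)^(1/p)`, since both functions vanish off the fixed ball
  -- `S`; `T + 1` avoids dividing by zero.
  obtain ⟨U, hU, hUs, hUη⟩ := exists_core_uniform hp hΥ hV hCE hcont hR
    (show 0 < δ / 2 / (T + 1) by positivity)
  refine ⟨U, hU.1, ?_⟩
  have hUh : eLpNorm (h - U) (ENNReal.ofReal p) μ ≤ ENNReal.ofReal (δ / 2) := by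
    have hpn : pnorm p μ (h - U) ≤ ENNReal.ofReal (δ / 2 / (T + 1)) ^ p * μ S := by
      rw [← setLIntegral_const, ← lintegral_indicator measurableSet_ball]
      refine lintegral_mono fun x => ?_
      by_cases hx : x ∈ S
      · rw [Set.indicator_of_mem hx]
        refine ENNReal.rpow_le_rpow ?_ hp0.le
        rw [Real.enorm_eq_ofReal_abs, Pi.sub_apply, abs_sub_comm]
        exact ENNReal.ofReal_le_ofReal (hUη x)
      · have hx' : x ∉ ball x₀ R := fun h' => hx (ball_subset_ball (by linarith) h')
        simp [hUs x hx, hR x hx', hp0]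
    rw [eLpNorm_eq_pnorm hp0]
    calc pnorm p μ (h - U) ^ (1 / p)
        ≤ (ENNReal.ofReal (δ / 2 / (T + 1)) ^ p * μ S) ^ (1 / p) := by gcongr
      _ = ENNReal.ofReal (δ / 2 / (T + 1)) * ENNReal.ofReal T := by
          rw [ENNReal.mul_rpow_of_nonneg _ _ (by positivity), ← ENNReal.rpow_mul,
            mul_one_div_cancel hp0.ne', ENNReal.rpow_one, hT, ENNReal.ofReal_toReal hS]
      _ ≤ _ := by
          rw [← ENNReal.ofReal_mul (by positivity)]
          refine ENNReal.ofReal_le_ofReal ?_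
          rw [div_mul_eq_mul_div, div_le_iff₀ (by positivity)]
          nlinarith
  have hsplit : f - U = (f - h) + (h - U) := by abel
  rw [hsplit]
  refine (eLpNorm_add_le (hf.sub hhL).aestronglyMeasurable
    (hhL.sub hU.1.1).aestronglyMeasurable hp1).trans ((add_le_add hle hUh).trans ?_)
  rw [← ENNReal.ofReal_add (by positivity) (by positivity), add_halves]

/-- A non-local form with near-diagonal cutoff functions is a regular `p`-energy satisfying the
strong cutoff energy inequality. -/
lemma HasNearCutoffs.regular_pEnergy (hp : 1 < p) {κ : StableKernel μ Υ}
    (hΥ : IsDoublingFunction Υ) (hV : VolumeDoubling μ) (h : HasNearCutoffs p κ) (x₀ : X) :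
    (nonlocalForm hp κ).IsPEnergy ∧ (nonlocalForm hp κ).IsRegular ∧ NonlocalCEStrong hp κ := by
  have hCE : NonlocalCEStrong hp κ := h.nonlocalCEStrong hΥ hV
  refine ⟨nonlocalForm_isPEnergy fun f hf δ hδ => exists_dom_eLpNorm_le hp hΥ hV hCE x₀ hf hδ,
    ⟨fun g hg hgc δ hδ => ?_, fun g hg δ hδ => exists_core_energyOne_le hp hΥ hV hCE x₀ hg hδ⟩, hCE⟩
  obtain ⟨R, hR⟩ := exists_ball_support hgc x₀
  obtain ⟨f, hf, -, hle⟩ := exists_core_uniform hp hΥ hV hCE hg hR hδ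
  exact ⟨f, hf, hle⟩

end regular

end PEnergy

theorem mainTheorem1 {X : Type*} [MetricSpace X] [ProperSpace X] [MeasurableSpace X]
    [BorelSpace X] (hX : ¬ Bornology.IsBounded (Set.univ : Set X))
    (μ : Measure X) [IsFiniteMeasureOnCompacts μ] [μ.IsOpenPosMeasure]
    (p : ℝ) (hp : 1 < p)
    (hCC : PEnergy.ChainCondition X) (hVD : PEnergy.VolumeDoubling μ)
    (Ψ Υ : ℝ → ℝ) (hΨ : PEnergy.IsDoublingFunction Ψ) (hΥ : PEnergy.IsDoublingFunction Υ) :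
    (∀ 𝓔 : PEnergy.PForm p μ, 𝓔.IsPEnergy → 𝓔.IsRegular → 𝓔.IsStronglyLocal →
      PEnergy.LocalPI 𝓔 Ψ → PEnergy.LocalCEStrong 𝓔 Ψ → PEnergy.StrictUpperGrowth Υ Ψ →
      ∀ κ : PEnergy.StableKernel μ Υ,
        (PEnergy.nonlocalForm hp κ).IsPEnergy ∧ (PEnergy.nonlocalForm hp κ).IsRegular ∧
          PEnergy.NonlocalCEStrong hp κ) ∧
    (∀ η : PEnergy.StableKernel μ Ψ,
      (PEnergy.nonlocalForm hp η).IsPEnergy → (PEnergy.nonlocalForm hp η).IsRegular →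
      PEnergy.NonlocalCEStrong hp η → PEnergy.UpperGrowth Υ Ψ →
      ∀ κ : PEnergy.StableKernel μ Υ,
        (PEnergy.nonlocalForm hp κ).IsPEnergy ∧ (PEnergy.nonlocalForm hp κ).IsRegular ∧
          PEnergy.NonlocalCEStrong hp κ) := by
  -- Unboundedness supplies a base point for the truncations.
  obtain ⟨x₀⟩ : Nonempty X := by
    by_contra h
    rw [not_nonempty_iff] at h
    exact hX (Set.subsingleton_of_subsingleton.finite.isBounded)
  refine ⟨fun 𝓔 _ _ _ hPI hCE hSUG κ => ?_, fun η _ _ hCE hUG κ => ?_⟩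
  · exact (PEnergy.hasNearCutoffs_of_strictUpperGrowth hp 𝓔.memLp κ hΨ hΥ hVD hPI hCE
      hSUG).regular_pEnergy hp hΥ hVD x₀
  · exact (PEnergy.hasNearCutoffs_of_upperGrowth κ hΨ hΥ hVD hCE hUG).regular_pEnergy hp hΥ hVD x₀
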